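/- **Setting.** Let $M$ be a connected (Hausdorff, second countable, smooth) manifold with $\dim M\ge 8$. Let $(g,I,J,K)$ be a hyperKähler structure on $M$ with $g$ pseudo-Riemannian of arbitrary signature: $I,J,K$ are smooth almost complex structures with $IJ=K=-JI$, $g$ is Hermitian for each of them, and $\omega_I=g(I\cdot,\cdot)$, $\omega_J$, $\omega_K$ are closed. Let $X$ be a rotating symmetry, i.e. a smooth Killing field with $L_XI=0$ and $L_XJ=K$, and suppose that $X$ is nowhere null. Put $$\alpha_0=g(X,\cdot),\quad \alpha_I=-\alpha_0(I\cdot),\quad \alpha_J=-\alpha_0(J\cdot),\quad \alpha_K=-\alpha_0(K\cdot),\qquad g_\alpha=\alpha_0^2+\alpha_I^2+\alpha_J^2+\alpha_K^2 ,$$ and let $\mu:M\to\mathbb R$ be a Kähler moment map, $d\mu=\alpha_I$. An *elementary deformation* of $g$ is a metric $g^N=fg+hg_\alpha$ with $f,h\in C^\infty(M)$. *Twist data* $(X,F,a)$ consist of $X$, generating a circle action, a closed two-form $F$ on $M$, and a nowhere zero smooth function $a$ with $da=-X\lrcorner F$. A *twist* of $M$ with these data is a manifold $W=P/\langle X'\rangle$,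 where $\pi_M:P\to M$ is a principal $S^1$-bundle with principal vector field $Y$ and connection one-form $\theta$ such that $d\theta=\pi_M^*F$, and $\langle X'\rangle$ is the flow of $X'=X^\theta+(\pi_M^*a)Y$, with $X^\theta$ the horizontal lift of $X$; it is assumed that $\pi_W:P\to W$ is a smooth submersion onto $W$. Tensors on $M$ and $W$ are *$\mathcal H$-related* if they correspond under the isomorphisms $T_{\pi_M(p)}M\cong\ker\theta_p\cong T_{\pi_W(p)}W$, $p\in P$. Let $g_W$ be the pseudo-Riemannian metric on $W$ that is $\mathcal H$-related to $g^N$, and $\mathcal G_W\subset\operatorname{End}(TW)$ the bundle that is $\mathcal H$-related to $\langle I,J,K\rangle$. The twist is *quaternionic Kähler* if $\mathcal G_W$ is locally spanned by smooth almost complex structures $I_W,J_W,K_W$ for which $g_W$ is Hermitian, with $I_WJ_W=K_W=-J_WI_W$, and $\mathcal G_W$ is parallel for the Levi-Civita connection of $g_W$ (locally hyperKähler metrics are thus allowed). **Theorem.** Let $W$ be a twist of $M$ with data $(X,F,a)$, and let $g_W$ be a metric on $W$ that is $\mathcal H$-related to an elementary deformation $g^N=fg+hg_\alpha$. Then $(W,g_W,\mathcal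 G_W)$ is quaternionic Kähler if and only if one of the following holds. 1. There are real constants $c$, $\lambda\neq0$ and $k\neq 0$ such that $\mu\neq c$ everywhere and $$g^N=\lambda\Bigl(\frac1{(\mu-c)^2}\,g_\alpha-\frac1{\mu-c}\,g\Bigr),\qquad F=k\,(d\alpha_0+\omega_I),\qquad a=k\,\bigl(g(X,X)-\mu+c\bigr).$$ 2. (The trivial twist of the hyperKähler metric.) $g^N=b\,g$, $F=0$ and $a=k$ for some real constants $b\ne0$ and $k\ne0$. -/

import Mathlib

open scoped Manifold ContDiff
open Bundle

noncomputable section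

namespace HKQK

/-! ## Tensor fields and Cartan calculus

All manifolds are real, smooth and without boundary, modelled on `EuclideanSpace ℝ (Fin m)`. -/

section Tensors

/-- Vector fields on `M`. -/
abbrev VectorField (m : ℕ) (M : Type*) [TopologicalSpace M]
    [ChartedSpace (EuclideanSpace ℝ (Fin m)) M] : Type _ :=
  (x : M) → TangentSpace (𝓡 m) x

/-- Fields of linear forms on the tangent spaces. -/
abbrev CovectorField (m : ℕ) (M : Type*) [TopologicalSpace M]
    [ChartedSpace (EuclideanSpace ℝ (Fin m)) M] : Type _ :=
  (x : M) → TangentSpace (𝓡 m) x →L[ℝ] ℝ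

/-- Fields of bilinear forms on the tangent spaces. -/
abbrev BilinField (m : ℕ) (M : Type*) [TopologicalSpace M]
    [ChartedSpace (EuclideanSpace ℝ (Fin m)) M] : Type _ :=
  (x : M) → TangentSpace (𝓡 m) x →L[ℝ] TangentSpace (𝓡 m) x →L[ℝ] ℝ

/-- Fields of endomorphisms of the tangent spaces. -/
abbrev EndField (m : ℕ) (M : Type*) [TopologicalSpace M]
    [ChartedSpace (EuclideanSpace ℝ (Fin m)) M] : Type _ :=
  (x : M) → TangentSpace (𝓡 m) x →L[ℝ] TangentSpace (𝓡 m) x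

variable {m : ℕ} {M : Type*} [TopologicalSpace M] [ChartedSpace (EuclideanSpace ℝ (Fin m)) M]

/-- The vector field `A` is differentiable at `x`. -/
def DiffAt [IsManifold (𝓡 m) ∞ M] (A : VectorField m M) (x : M) : Prop :=
  MDifferentiableAt (𝓡 m) (𝓡 m).tangent
    (fun y => TotalSpace.mk' (EuclideanSpace ℝ (Fin m)) y (A y)) x

/-- The derivative `v φ` of a real function `φ` at `x` in the direction `v`. -/
def dirDeriv (φ : M → ℝ) (x : M) (v : TangentSpace (𝓡 m) x) : ℝ :=
  mvfderiv (𝓡 m) φ x v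

/-- `dα(A, B) = A (α B) - B (α A) - α [A, B]` at `x`. -/
def extDerivOne (α : CovectorField m M) (A B : VectorField m M) (x : M) : ℝ :=
  dirDeriv (fun y => α y (B y)) x (A x) - dirDeriv (fun y => α y (A y)) x (B x)
    - α x (VectorField.mlieBracket (𝓡 m) A B x)

/-- `dw₂(A, B, C)` at `x`, for a two-form `w₂`, by Cartan's formula. -/
def extDerivTwo (w₂ : BilinField m M) (A B C : VectorField m M) (x : M) : ℝ :=
  dirDeriv (fun y => w₂ y (B y) (C y)) x (A x)
    - dirDeriv (fun y => w₂ y (A y) (C y)) x (B x)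
    + dirDeriv (fun y => w₂ y (A y) (B y)) x (C x)
    - w₂ x (VectorField.mlieBracket (𝓡 m) A B x) (C x)
    + w₂ x (VectorField.mlieBracket (𝓡 m) A C x) (B x)
    - w₂ x (VectorField.mlieBracket (𝓡 m) B C x) (A x)

/-- The two-form `w₂` is closed. -/
def IsClosedTwoForm [IsManifold (𝓡 m) ∞ M] (w₂ : BilinField m M) : Prop :=
  ∀ (x : M) (A B C : VectorField m M), DiffAt A x → DiffAt B x → DiffAt C x →
    extDerivTwo w₂ A B C x = 0

/-- `(L_X T) A = [X, T A] - T [X, A]` at `x`, for a field of endomorphisms `T`. -/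
def lieDerivEnd (X : VectorField m M) (T : EndField m M) (A : VectorField m M) (x : M) :
    TangentSpace (𝓡 m) x :=
  VectorField.mlieBracket (𝓡 m) X (fun y => T y (A y)) x
    - T x (VectorField.mlieBracket (𝓡 m) X A x)

/-- `(L_X g)(A, B) = X (g(A, B)) - g([X, A], B) - g(A, [X, B])` at `x`. -/
def lieDerivBilin (X : VectorField m M) (g : BilinField m M) (A B : VectorField m M) (x : M) : ℝ :=
  dirDeriv (fun y => g y (A y) (B y)) x (X x)
    - g x (VectorField.mlieBracket (𝓡 m) X A x) (B x)
    - g x (A x) (VectorField.mlieBracket (𝓡 m) X B x)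

variable [IsManifold (𝓡 m) ∞ M]

/-- Smooth vector fields. -/
def SmoothVector (A : VectorField m M) : Prop :=
  ContMDiff (𝓡 m) (𝓡 m).tangent ∞
    (fun y => TotalSpace.mk' (EuclideanSpace ℝ (Fin m)) y (A y))

/-- Smooth one-forms. -/
def SmoothCovector (α : CovectorField m M) : Prop :=
  ContMDiff (𝓡 m) ((𝓡 m).prod 𝓘(ℝ, EuclideanSpace ℝ (Fin m) →L[ℝ] ℝ)) ∞
    (fun y => TotalSpace.mk' (EuclideanSpace ℝ (Fin m) →L[ℝ] ℝ)
      (E := fun y : M => TangentSpace (𝓡 m) y →L[ℝ] ℝ) y (α y))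

/-- Smooth fields of bilinear forms. -/
def SmoothBilin (b : BilinField m M) : Prop :=
  ContMDiff (𝓡 m)
    ((𝓡 m).prod 𝓘(ℝ, EuclideanSpace ℝ (Fin m) →L[ℝ] EuclideanSpace ℝ (Fin m) →L[ℝ] ℝ)) ∞
    (fun y => TotalSpace.mk'
      (EuclideanSpace ℝ (Fin m) →L[ℝ] EuclideanSpace ℝ (Fin m) →L[ℝ] ℝ)
      (E := fun y : M => TangentSpace (𝓡 m) y →L[ℝ] TangentSpace (𝓡 m) y →L[ℝ] ℝ) y (b y))

/-- Fields of endomorphisms that are smooth on `U`. -/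
def SmoothEndOn (T : EndField m M) (U : Set M) : Prop :=
  ContMDiffOn (𝓡 m)
    ((𝓡 m).prod 𝓘(ℝ, EuclideanSpace ℝ (Fin m) →L[ℝ] EuclideanSpace ℝ (Fin m))) ∞
    (fun y => TotalSpace.mk' (EuclideanSpace ℝ (Fin m) →L[ℝ] EuclideanSpace ℝ (Fin m))
      (E := fun y : M => TangentSpace (𝓡 m) y →L[ℝ] TangentSpace (𝓡 m) y) y (T y)) U

/-! ## Pseudo-Riemannian metrics and the Levi-Civita connection -/

/-- A pseudo-Riemannian metric: smooth, symmetric, nondegenerate, of arbitrary signature. -/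
structure IsPseudoMetric (g : BilinField m M) : Prop where
  smooth : SmoothBilin g
  symm : ∀ (x : M) (u v : TangentSpace (𝓡 m) x), g x u v = g x v u
  nondegenerate : ∀ (x : M) (u : TangentSpace (𝓡 m) x), (∀ v, g x u v = 0) → u = 0

/-- `nab` is the Levi-Civita connection of `g`: it is torsion-free and metric.
Here `nab B x v` is `∇_v B`. -/
structure IsLeviCivita (g : BilinField m M)
    (nab : CovariantDerivative (𝓡 m) (EuclideanSpace ℝ (Fin m))
      (TangentSpace (𝓡 m) : M → Type _)) : Prop where
  torsion_free : nab.torsion = 0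
  metric : ∀ (x : M) (A B : VectorField m M), DiffAt A x → DiffAt B x →
    ∀ v : TangentSpace (𝓡 m) x,
      dirDeriv (fun y => g y (A y) (B y)) x v = g x (nab A x v) (B x) + g x (A x) (nab B x v)

end Tensors

/-! ## HyperKähler and quaternionic Kähler structures -/

section Quaternionic

variable {m : ℕ} {M : Type*} [TopologicalSpace M] [ChartedSpace (EuclideanSpace ℝ (Fin m)) M]

/-- At `x`, the endomorphisms `I, J, K` are almost complex structures with `IJ = K = -JI`, and
`g` is Hermitian with respect to each of them. -/
structure IsQuaternionHermitianAt (g : BilinField m M) (I J K : EndField m M) (x : M) : Prop where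
  sq_I : ∀ u : TangentSpace (𝓡 m) x, I x (I x u) = -u
  sq_J : ∀ u : TangentSpace (𝓡 m) x, J x (J x u) = -u
  sq_K : ∀ u : TangentSpace (𝓡 m) x, K x (K x u) = -u
  I_J : ∀ u : TangentSpace (𝓡 m) x, I x (J x u) = K x u
  J_I : ∀ u : TangentSpace (𝓡 m) x, J x (I x u) = -K x u
  herm_I : ∀ u v : TangentSpace (𝓡 m) x, g x (I x u) (I x v) = g x u v
  herm_J : ∀ u v : TangentSpace (𝓡 m) x, g x (J x u) (J x v) = g x u v
  herm_K : ∀ u v : TangentSpace (𝓡 m) x, g x (K x u) (K x v) = g x u v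

/-- The bilinear form `ω_T = g(T·, ·)`. -/
def fundForm (g : BilinField m M) (T : EndField m M) : BilinField m M :=
  fun x => (g x).comp (T x)

/-- The span `⟨I, J, K⟩` in the endomorphisms of each tangent space. -/
def quatSpan (I J K : EndField m M) (x : M) :
    Submodule ℝ (TangentSpace (𝓡 m) x →L[ℝ] TangentSpace (𝓡 m) x) :=
  Submodule.span ℝ {I x, J x, K x}

variable [IsManifold (𝓡 m) ∞ M]

/-- `(M, g, I, J, K)` is hyperKähler (of arbitrary signature). -/
structure IsHyperKahler (g : BilinField m M) (I J K : EndField m M) : Prop where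
  metric : IsPseudoMetric g
  smooth_I : SmoothEndOn I Set.univ
  smooth_J : SmoothEndOn J Set.univ
  smooth_K : SmoothEndOn K Set.univ
  hermitian : ∀ x : M, IsQuaternionHermitianAt g I J K x
  closed_I : IsClosedTwoForm (fundForm g I)
  closed_J : IsClosedTwoForm (fundForm g J)
  closed_K : IsClosedTwoForm (fundForm g K)

/-- `(M, g, Q)` is quaternionic Kähler: `Q ⊂ End(TM)` is locally spanned by smooth almost complex
structures `I, J, K` with `IJ = K = -JI` for which `g` is Hermitian, and `Q` is preserved by the
Levi-Civita connection `∇` of `g`, i.e. `∇_v I, ∇_v J, ∇_v K ∈ Q` for each tangent vector `v`,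
where `(∇_v T) B = ∇_v (T B) - T (∇_v B)`. (In dimension at least 8 this says that the four-form
`ω_I² + ω_J² + ω_K²` is parallel; locally hyperKähler metrics are included.) -/
structure IsQuaternionicKahler (g : BilinField m M)
    (Q : (x : M) → Submodule ℝ (TangentSpace (𝓡 m) x →L[ℝ] TangentSpace (𝓡 m) x)) : Prop where
  metric : IsPseudoMetric g
  parallel : ∃ nab : CovariantDerivative (𝓡 m) (EuclideanSpace ℝ (Fin m))
      (TangentSpace (𝓡 m) : M → Type _),
    IsLeviCivita g nab ∧
    ∀ x₀ : M, ∃ (U : Set M) (I J K : EndField m M), IsOpen U ∧ x₀ ∈ U ∧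
      SmoothEndOn I U ∧ SmoothEndOn J U ∧ SmoothEndOn K U ∧
      ∀ x ∈ U, IsQuaternionHermitianAt g I J K x ∧ Q x = quatSpan I J K x ∧
        ∀ T : EndField m M, (T = I ∨ T = J ∨ T = K) → ∀ v : TangentSpace (𝓡 m) x,
          ∃ D ∈ Q x, ∀ B : VectorField m M, DiffAt B x →
            nab (fun y => T y (B y)) x v - T x (nab B x v) = D (B x)

/-! ## Rotating symmetries and elementary deformations -/

/-- `X` is a rotating symmetry: an isometry with `L_X I = 0` and `L_X J = K`. -/
structure IsRotating (g : BilinField m M) (I J K : EndField m M) (X : VectorField m M) : Prop where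
  smooth : SmoothVector X
  killing : ∀ (x : M) (A B : VectorField m M), DiffAt A x → DiffAt B x →
    lieDerivBilin X g A B x = 0
  lie_I : ∀ (x : M) (A : VectorField m M), DiffAt A x → lieDerivEnd X I A x = 0
  lie_J : ∀ (x : M) (A : VectorField m M), DiffAt A x → lieDerivEnd X J A x = K x (A x)

/-- `α₀ = g(X, ·)`. -/
def alphaZero (g : BilinField m M) (X : VectorField m M) : CovectorField m M :=
  fun x => g x (X x)

/-- `T α₀ = -α₀(T ·)`, for `T` one of `I`, `J`, `K`. -/
def alphaOf (g : BilinField m M) (X : VectorField m M) (T : EndField m M) : CovectorField m M :=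
  fun x => -((alphaZero g X x).comp (T x))

/-- `g_α = α₀² + α_I² + α_J² + α_K²`. -/
def gAlpha (g : BilinField m M) (I J K : EndField m M) (X : VectorField m M)
    (x : M) (u v : TangentSpace (𝓡 m) x) : ℝ :=
  alphaZero g X x u * alphaZero g X x v + alphaOf g X I x u * alphaOf g X I x v
    + alphaOf g X J x u * alphaOf g X J x v + alphaOf g X K x u * alphaOf g X K x v

/-- The elementary deformation `g^N = f g + h g_α`. -/
def elemDeform (g : BilinField m M) (I J K : EndField m M) (X : VectorField m M) (f h : M → ℝ)
    (x : M) (u v : TangentSpace (𝓡 m) x) : ℝ :=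
  f x * g x u v + h x * gAlpha g I J K X x u v

/-- `μ` is a Kähler moment map for `X` with respect to `(g, ω_I)`: it is smooth and `dμ = α_I`. -/
structure IsKahlerMomentMap (g : BilinField m M) (I : EndField m M) (X : VectorField m M)
    (μ : M → ℝ) : Prop where
  smooth : ContMDiff (𝓡 m) 𝓘(ℝ, ℝ) ∞ μ
  deriv : ∀ (x : M) (v : TangentSpace (𝓡 m) x), dirDeriv μ x v = alphaOf g X I x v

end Quaternionic

/-! ## The twist construction -/

section Twist

variable {m : ℕ}
  {M : Type*} [TopologicalSpace M] [ChartedSpace (EuclideanSpace ℝ (Fin m)) M]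
  {P : Type*} [TopologicalSpace P] [ChartedSpace (EuclideanSpace ℝ (Fin (m + 1))) P]
  {W : Type*} [TopologicalSpace W] [ChartedSpace (EuclideanSpace ℝ (Fin m)) W]

/-- `X` generates a circle action: its flow is complete and periodic with a common period. -/
def GeneratesCircleAction (X : VectorField m M) : Prop :=
  ∃ τ : ℝ, 0 < τ ∧ ∀ x : M, ∃ γ : ℝ → M,
    IsMIntegralCurve γ X ∧ γ 0 = x ∧ Function.Periodic γ τ

/-- Twist data `(M, X, F, a)` with `a` nowhere zero. Invariance of `F` under `X` follows from the
other conditions. Integrality of `F` is expressed by the circle bundle in `IsTwist`. -/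
structure IsTwistData [IsManifold (𝓡 m) ∞ M] (X : VectorField m M) (F : BilinField m M)
    (a : M → ℝ) : Prop where
  circle : GeneratesCircleAction X
  smooth_F : SmoothBilin F
  alternating : ∀ (x : M) (u : TangentSpace (𝓡 m) x), F x u u = 0
  closed : IsClosedTwoForm F
  smooth_a : ContMDiff (𝓡 m) 𝓘(ℝ, ℝ) ∞ a
  ne_zero : ∀ x, a x ≠ 0
  hamiltonian : ∀ (x : M) (v : TangentSpace (𝓡 m) x), dirDeriv a x v = -F x (X x) v

/-- `pr : P → M` is a principal `S¹`-bundle with principal vector field `Y`. -/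
structure IsPrincipalCircleBundle [IsManifold (𝓡 m) ∞ M] [IsManifold (𝓡 (m + 1)) ∞ P]
    [MulAction Circle P] (pr : P → M) (Y : VectorField (m + 1) P) : Prop where
  smooth_action : ContMDiffSMul (𝓡 1) (𝓡 (m + 1)) ∞ Circle P
  free : ∀ (z : Circle) (p : P), z • p = p → z = 1
  submersion : Manifold.IsSubmersion (𝓡 (m + 1)) (𝓡 m) ∞ pr
  surjective : Function.Surjective pr
  fibres : ∀ p q : P, pr p = pr q ↔ ∃ z : Circle, z • p = q
  generator : ∀ p : P, IsMIntegralCurve (fun t : ℝ => Circle.exp t • p) Y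

/-- `θ` is a connection one-form on `P` with curvature `F`, i.e. `θ(Y) = 1` and `dθ = pr^* F`.
(These two conditions make `θ` invariant under the principal action.) -/
structure IsConnectionForm [IsManifold (𝓡 m) ∞ M] [IsManifold (𝓡 (m + 1)) ∞ P]
    (pr : P → M) (Y : VectorField (m + 1) P) (F : BilinField m M)
    (θ : CovectorField (m + 1) P) : Prop where
  smooth : SmoothCovector θ
  vertical : ∀ p, θ p (Y p) = 1
  curvature : ∀ (p : P) (A B : VectorField (m + 1) P), DiffAt A p → DiffAt B p →
    extDerivOne θ A B p =
      F (pr p) (mfderiv (𝓡 (m + 1)) (𝓡 m) pr p (A p)) (mfderiv (𝓡 (m + 1)) (𝓡 m) pr p (B p))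

/-- `X'` is the lift `X^θ + (pr^* a) Y` of `X`: it projects to `X` and `θ(X') = pr^* a`. -/
structure IsTwistLift (pr : P → M) (θ : CovectorField (m + 1) P) (X : VectorField m M) (a : M → ℝ)
    (X' : VectorField (m + 1) P) : Prop where
  projects : ∀ p, mfderiv (𝓡 (m + 1)) (𝓡 m) pr p (X' p) = X (pr p)
  vertical : ∀ p, θ p (X' p) = a (pr p)

/-- `pr : P → W` exhibits the manifold `W` as the quotient `P / ⟨X'⟩` by the flow of `X'`. -/
structure IsFlowQuotient [IsManifold (𝓡 (m + 1)) ∞ P] [IsManifold (𝓡 m) ∞ W]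
    (pr : P → W) (X' : VectorField (m + 1) P) : Prop where
  submersion : Manifold.IsSubmersion (𝓡 (m + 1)) (𝓡 m) ∞ pr
  surjective : Function.Surjective pr
  fibres : ∀ p q : P, pr p = pr q ↔
    ∃ (γ : ℝ → P) (t : ℝ), IsMIntegralCurve γ X' ∧ γ 0 = p ∧ γ t = q

/-- The double fibration `M ← P → W` exhibits `W` as a twist of `M` with twist data
`(M, X, F, a)`, where `θ` is the connection one-form on `P`. -/
structure IsTwist [IsManifold (𝓡 m) ∞ M] [IsManifold (𝓡 (m + 1)) ∞ P] [IsManifold (𝓡 m) ∞ W]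
    [MulAction Circle P] (X : VectorField m M) (F : BilinField m M) (a : M → ℝ)
    (πM : P → M) (πW : P → W) (θ : CovectorField (m + 1) P) : Prop where
  data : IsTwistData X F a
  exists_lift : ∃ Y X' : VectorField (m + 1) P,
    IsPrincipalCircleBundle πM Y ∧ IsConnectionForm πM Y F θ ∧
    IsTwistLift πM θ X a X' ∧ IsFlowQuotient πW X'

/-- The bilinear forms `b` on `M` and `bW` on `W` are `ℋ`-related, `ℋ = ker θ`. -/
def HRelatedBilin (πM : P → M) (πW : P → W) (θ : CovectorField (m + 1) P)
    (b : (x : M) → TangentSpace (𝓡 m) x → TangentSpace (𝓡 m) x → ℝ) (bW : BilinField m W) : Prop :=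
  ∀ (p : P) (u v : TangentSpace (𝓡 (m + 1)) p), θ p u = 0 → θ p v = 0 →
    bW (πW p) (mfderiv (𝓡 (m + 1)) (𝓡 m) πW p u) (mfderiv (𝓡 (m + 1)) (𝓡 m) πW p v)
      = b (πM p) (mfderiv (𝓡 (m + 1)) (𝓡 m) πM p u) (mfderiv (𝓡 (m + 1)) (𝓡 m) πM p v)

/-- The bundles of endomorphisms `Q` on `M` and `QW` on `W` are `ℋ`-related, `ℋ = ker θ`: for each
`p ∈ P`, the isomorphisms `T M ≅ ℋ ≅ T W` at `p` carry the one to the other. -/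
def HRelatedBundle (πM : P → M) (πW : P → W) (θ : CovectorField (m + 1) P)
    (Q : (x : M) → Submodule ℝ (TangentSpace (𝓡 m) x →L[ℝ] TangentSpace (𝓡 m) x))
    (QW : (w : W) → Submodule ℝ (TangentSpace (𝓡 m) w →L[ℝ] TangentSpace (𝓡 m) w)) : Prop :=
  ∀ (p : P) (L : TangentSpace (𝓡 m) (πW p) →L[ℝ] TangentSpace (𝓡 m) (πW p)),
    L ∈ QW (πW p) ↔ ∃ T ∈ Q (πM p), ∀ u v : TangentSpace (𝓡 (m + 1)) p, θ p u = 0 → θ p v = 0 →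
      mfderiv (𝓡 (m + 1)) (𝓡 m) πM p v = T (mfderiv (𝓡 (m + 1)) (𝓡 m) πM p u) →
      mfderiv (𝓡 (m + 1)) (𝓡 m) πW p v = L (mfderiv (𝓡 (m + 1)) (𝓡 m) πW p u)

end Twist

end HKQK

end

/-! The condition on `W` is local and of first order, so it can be compared with the hyperKähler
structure at one point at a time. A local section of `P → W` that is horizontal at a chosen point
parametrizes pieces of `M` and `W` by one open set of Euclidean space (`exists_twistChart`). With η
the pullback of the connection form, being ℋ-related means conjugation by `shear`, E = id - η ⊗ X/a,
and at the base point η = 0 and dη = F.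

On `M`, closedness of the three fundamental forms makes I, J, K parallel
(`QuatHerm.parallel_of_closed`), and the rotating symmetry has ∇X = L - I/2 with L skew and
commuting with I, J, K (`exists_rotJet`); hence dα₀ + ω_I = 2 g(L·, ·). Let S = Γ_W - dE - Γ_M be
the difference of the Levi-Civita connections. It is determined by its torsion (F/a) X and by its
effect on g^N (`TwistJet`, `TwistJet.unique`). As ⟨I, J, K⟩ is parallel on `M`, the bundle on `W` is
parallel exactly when every S_u normalizes ⟨I, J, K⟩ (`TwistChart.commutator_mem`,
`isQuaternionicKahler_of_normalizes`).

Necessity. If S_u normalizes the quaternions, S drops out of a cyclic sum of the metric equations,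
leaving one three-form equation for each of I, J, K. Write q = f + h g(X, X). In dimension at least
8 there is a non-null vector orthogonal to the quaternionic line of X, and testing on it and on that
line (`three_form_solution`) gives df = h dμ and, once dh = z dμ, h (dα₀ + ω_I) - (q/a) F = (2h²/f -
z)(α_J ∧ α_K - α₀ ∧ α_I). That dh is a multiple of dμ follows from d(df) = 0. The condition da = -X
⌟ F makes a f²/q a constant k (`TwistEquations.exists_const`). Then F = s (dα₀ + ω_I) + t (α_J ∧ α_K
- α₀ ∧ α_I) with s = k h/f² and ds = t dμ, and dF = 0 reduces on suitable vectors to t α_I ∧ ω_I =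
0, so t = 0 (`TwistEquations.coeff_eq_zero`). Hence h/f² is constant and 1/f is affine in μ. Zero
slope is the trivial twist, nonzero slope the first family (`TwistEquations.classification`).

Sufficiency. For the first family S is given by an explicit formula, verified by uniqueness, which
visibly normalizes the quaternions (`TwistJet.normalizes`); for the trivial twist S = 0. -/

noncomputable section

set_option linter.unusedSimpArgs false

namespace HKQK

/-! ## Quaternionic Hermitian linear algebra -/

section LinearAlgebra

variable {V : Type*} [NormedAddCommGroup V] [NormedSpace ℝ V]

/-- A nondegenerate symmetric bilinear form that is Hermitian for a quaternionic triple of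
endomorphisms. -/
structure QuatHerm (g : V →L[ℝ] V →L[ℝ] ℝ) (I J K : V →L[ℝ] V) : Prop where
  symm : ∀ u v, g u v = g v u
  nondeg : ∀ u, (∀ v, g u v = 0) → u = 0
  II : ∀ u, I (I u) = -u
  JJ : ∀ u, J (J u) = -u
  KK : ∀ u, K (K u) = -u
  IJ : ∀ u, I (J u) = K u
  JI : ∀ u, J (I u) = -K u
  gII : ∀ u v, g (I u) (I v) = g u v
  gJJ : ∀ u v, g (J u) (J v) = g u v
  gKK : ∀ u v, g (K u) (K v) = g u v

namespace QuatHerm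

variable {g : V →L[ℝ] V →L[ℝ] ℝ} {I J K : V →L[ℝ] V} (q : QuatHerm g I J K)
include q

lemma IK (u : V) : I (K u) = -J u := by rw [← q.IJ, q.II]
lemma KJ (u : V) : K (J u) = -I u := by rw [← q.IJ (J u), q.JJ, map_neg]
lemma JK (u : V) : J (K u) = I u := by rw [← neg_eq_iff_eq_neg.mpr (q.JI u), map_neg, q.JJ, neg_neg]
lemma KI (u : V) : K (I u) = J u := by rw [← q.IJ (I u), q.JI, map_neg, q.IK, neg_neg]

lemma gI (u v : V) : g u (I v) = -g (I u) v := by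
  rw [← q.gII u (I v), q.II, map_neg]
lemma gJ (u v : V) : g u (J v) = -g (J u) v := by
  rw [← q.gJJ u (J v), q.JJ, map_neg]
lemma gK (u v : V) : g u (K v) = -g (K u) v := by
  rw [← q.gKK u (K v), q.KK, map_neg]

lemma rotate : QuatHerm g J K I where
  symm := q.symm
  nondeg := q.nondeg
  II := q.JJ
  JJ := q.KK
  KK := q.II
  IJ := q.JK
  JI := q.KJ
  gII := q.gJJ
  gJJ := q.gKK
  gKK := q.gII

lemma I_skew (u v : V) : g (I u) v = -g (I v) u := by rw [q.symm (I u), q.gI]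
lemma J_skew (u v : V) : g (J u) v = -g (J v) u := by rw [q.symm (J u), q.gJ]
lemma K_skew (u v : V) : g (K u) v = -g (K v) u := by rw [q.symm (K u), q.gK]
lemma I_self (u : V) : g (I u) u = 0 := by linarith [q.I_skew u u]
lemma J_self (u : V) : g (J u) u = 0 := by linarith [q.J_skew u u]
lemma K_self (u : V) : g (K u) u = 0 := by linarith [q.K_skew u u]

end QuatHerm

/-- A closed almost Kähler form: `∇_{Iu} I = -I ∇_u I`. -/
lemma almostKahler_apply {g : V →L[ℝ] V →L[ℝ] ℝ} {I : V →L[ℝ] V}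
    (symm : ∀ u v, g u v = g v u) (nondeg : ∀ u, (∀ v, g u v = 0) → u = 0)
    (II : ∀ u, I (I u) = -u) (gII : ∀ u v, g (I u) (I v) = g u v)
    {C : V →L[ℝ] V →L[ℝ] V} (anti : ∀ u v, C u (I v) = -I (C u v))
    (skew : ∀ u v w, g (C u v) w = -g v (C u w))
    (cyc : ∀ u v w, g (C u v) w + g (C v w) u + g (C w u) v = 0) (u v : V) :
    C (I u) v = -I (C u v) := by
  have gI : ∀ u v, g u (I v) = -g (I u) v := fun u v => by
    rw [← gII u (I v), II, map_neg]
  have sk : ∀ u v w, g (C u v) w = -g (C u w) v := fun u v w => by rw [skew, symm]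
  have aI : ∀ u v w, g (C u (I v)) w = g (C u v) (I w) := fun u v w => by
    rw [anti, gI]; simp
  -- `b` measures the failure of the claim. Closedness shows that a cyclic shift of its arguments
  -- changes its sign, so three shifts give b = -b.
  set b : V → V → V → ℝ := fun u v w => g (C (I u) (I v)) w + g (C u v) w with hb
  have hb1 : ∀ u v w, b u v w = -b v w u := fun u v w => by
    have h1 := cyc u v w
    have h2 := cyc (I u) (I v) w
    have h3 : g (C (I v) w) (I u) = g (C (I v) (I w)) u := (aI _ _ _).symm
    have h4 : g (C w (I u)) (I v) = -g (C w u) v := by rw [aI, II, map_neg]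
    simp only [hb]
    linarith
  have hb0 : ∀ u v w, b u v w = 0 := fun u v w => by
    linarith [hb1 u v w, hb1 v w u, hb1 w u v]
  have key : C (I u) (I (I v)) = -C u (I v) := by
    rw [← sub_eq_zero, sub_neg_eq_add]
    refine nondeg _ fun w => ?_
    have := hb0 u (I v) w
    simpa [hb] using this
  rw [II, map_neg, neg_inj] at key
  rw [key, anti]

/-- If the covariant derivatives `a, b, c` of a quaternionic triple are all of almost Kähler type,
then `b = 0`. -/
lemma QuatHerm.parallel_aux {g : V →L[ℝ] V →L[ℝ] ℝ} {I J K : V →L[ℝ] V}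
    (q : QuatHerm g I J K) {a b c : V →L[ℝ] V →L[ℝ] V}
    (hc : ∀ u v, c u v = a u (J v) + I (b u v))
    (hc' : ∀ u v, c u v = -b u (I v) - J (a u v))
    (ha : ∀ u v, a (I u) v = -I (a u v)) (hb : ∀ u v, b (J u) v = -J (b u v))
    (hK : ∀ u v, c (K u) v = -K (c u v)) (u v : V) : b u v = 0 := by
  suffices h : ∀ v, b u (I v) = 0 by simpa [q.II] using h (I v)
  intro v
  -- The direction K u is written as I (J u) in `a` and as -J (I u) in `b`, so that the condition on
  -- `c` becomes a relation between `a` and `b` only.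
  have E1 : ∀ u v, -I (a (J u) (J v)) + K (b (I u) v) = -K (a u (J v)) - J (b u v) := by
    intro u v
    have h := hK u v
    rw [hc, hc] at h
    have h1 : a (K u) (J v) = -I (a (J u) (J v)) := by rw [← q.IJ, ha]
    have h2 : b (K u) v = J (b (I u) v) := by
      have := hb (I u) v
      rw [q.JI] at this
      simpa using congrArg Neg.neg this
    rw [h1, h2, q.IJ, map_add, q.KI] at h
    rw [h]; abel
  have E1' : ∀ u v, a (J u) (J v) = J (b (I u) v) + J (a u (J v)) - K (b u v) := by
    intro u v
    have h := congrArg I (E1 u v)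
    simp only [map_add, map_sub, map_neg, q.II, q.IK, q.IJ, neg_neg] at h
    rw [← sub_eq_zero] at h ⊢
    rw [← h]; abel
  have E2 : ∀ u v, -a u (J v) + b (I u) v = J (a (J u) (J v)) - I (b u v) := by
    intro u v
    have h := E1' (J u) v
    have h1 : b (I (J u)) v = J (b (I u) v) := by
      have := hb (I u) v
      rw [q.JI] at this
      rw [q.IJ]
      simpa using congrArg Neg.neg this
    rw [h1, q.JJ, q.JJ, hb, map_neg, map_neg, q.KJ] at h
    simp only [neg_apply] at h
    rw [← sub_eq_zero] at h ⊢
    rw [← h]; abel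
  -- The relation at J u, combined with the relation at u, is twice this identity: `b` is of almost
  -- Kähler type for I as well as for J.
  have hbI : ∀ u v, b (I u) v = -I (b u v) := by
    intro u v
    have h := E2 u v
    rw [E1'] at h
    simp only [map_add, map_sub, q.JJ, q.JK] at h
    have h2 : (2 : ℝ) • (b (I u) v + I (b u v)) = 0 := by
      rw [← sub_eq_zero] at h
      rw [← h]; module
    rw [smul_eq_zero_iff_right two_ne_zero] at h2
    exact eq_neg_of_add_eq_zero_left h2
  have haJ : ∀ u v, a (J u) v = J (a u v) := by
    intro u v
    have h := E1' u (-(J v))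
    rw [hbI] at h
    simp only [map_neg, q.JJ, q.JI, neg_neg] at h
    rw [h]; abel
  -- The two product rules for `c` (from K = IJ and K = -JI) are equated at u and at J u; the second
  -- equation, multiplied by J, is combined with the first to give 2 b u (I v) = 0.
  have h1 := hc u v
  have h2 := hc' u v
  have h3 := hc (J u) v
  have h4 := hc' (J u) v
  rw [haJ, hb, map_neg, q.IJ] at h3
  rw [haJ, hb, q.JJ] at h4
  rw [h3] at h4
  have h5 := congrArg J h4
  simp only [map_add, map_sub, map_neg, q.JJ, q.JK, neg_neg] at h5
  rw [h1] at h2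
  have h6 : (2 : ℝ) • b u (I v) = 0 := by
    have e1 := sub_eq_zero.mpr h2
    have e2 := sub_eq_zero.mpr h5
    have e3 := congrArg₂ (· + ·) e1 e2
    simp only [add_zero] at e3
    rw [← e3]; module
  exact (smul_eq_zero_iff_right (two_ne_zero (α := ℝ))).mp h6

/-- The covariant derivatives of a quaternionic triple vanish if the three fundamental forms are
closed. -/
lemma QuatHerm.parallel_of_closed {g : V →L[ℝ] V →L[ℝ] ℝ} {I J K : V →L[ℝ] V}
    (q : QuatHerm g I J K) {a b c : V →L[ℝ] V →L[ℝ] V}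
    (aI : ∀ u v, a u (I v) = -I (a u v)) (bJ : ∀ u v, b u (J v) = -J (b u v))
    (cK : ∀ u v, c u (K v) = -K (c u v))
    (hc : ∀ u v, c u v = a u (J v) + I (b u v))
    (hc' : ∀ u v, c u v = -b u (I v) - J (a u v))
    (skew_a : ∀ u v w, g (a u v) w = -g v (a u w))
    (skew_b : ∀ u v w, g (b u v) w = -g v (b u w))
    (skew_c : ∀ u v w, g (c u v) w = -g v (c u w))
    (cyc_a : ∀ u v w, g (a u v) w + g (a v w) u + g (a w u) v = 0)
    (cyc_b : ∀ u v w, g (b u v) w + g (b v w) u + g (b w u) v = 0)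
    (cyc_c : ∀ u v w, g (c u v) w + g (c v w) u + g (c w u) v = 0) (u v : V) :
    a u v = 0 ∧ b u v = 0 ∧ c u v = 0 := by
  have ha := almostKahler_apply q.symm q.nondeg q.II q.gII aI skew_a cyc_a
  have hb := almostKahler_apply q.symm q.nondeg q.JJ q.gJJ bJ skew_b cyc_b
  have hk := almostKahler_apply q.symm q.nondeg q.KK q.gKK cK skew_c cyc_c
  have b0 : ∀ u v, b u v = 0 := q.parallel_aux hc hc' ha hb hk
  have a0 : ∀ u v, a u v = 0 := by
    -- In the cyclic order K, I, J the middle derivative is `a`; the required product rules are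
    -- those of J = KI = -IK.
    refine q.rotate.rotate.parallel_aux (a := c) (b := a) (c := b) ?_ ?_ hk ha hb
    · intro u v
      rw [hc' u (I v), q.II, aI]
      simp [q.JI]
    · intro u v
      rw [hc u v, map_add, q.II, ← q.IJ v, aI]
      abel
  refine ⟨a0 u v, b0 u v, ?_⟩
  rw [hc, a0, b0, map_zero, add_zero]

end LinearAlgebra

section LinearAlgebra

variable {V : Type*} [NormedAddCommGroup V] [NormedSpace ℝ V]

/-! ## Christoffel symbols -/

-- Alternating symmetry and skewness carries the three arguments around to minus the starting value.
-- This is the uniqueness half of the fundamental theorem of Riemannian geometry.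
omit [NormedSpace ℝ V] in
lemma eq_zero_of_symm_of_skew {b : V → V → ℝ} (bsymm : ∀ u v, b u v = b v u)
    (bnondeg : ∀ u, (∀ v, b u v = 0) → u = 0) {T : V → V → V}
    (symm : ∀ u v, T u v = T v u) (skew : ∀ u v w, b (T u v) w + b v (T u w) = 0) (u v : V) :
    T u v = 0 := by
  refine bnondeg _ fun w => ?_
  have h1 := skew u v w
  have h2 := skew v w u
  have h3 := skew w u v
  rw [bsymm v, symm u w] at h1
  rw [bsymm w, symm v u] at h2
  rw [bsymm u, symm w v] at h3
  linarith

/-- Nondegeneracy makes `g` injective into the dual space, hence bijective by dimension. Each form σ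
u v is therefore represented by a unique vector, and uniqueness forces bilinearity in u and v. -/
lemma exists_trilinear_rep [FiniteDimensional ℝ V] {g : V →L[ℝ] V →L[ℝ] ℝ}
    (nondeg : ∀ u, (∀ v, g u v = 0) → u = 0) {σ : V → V → V → ℝ}
    (h₁ : ∀ v w, IsLinearMap ℝ fun u => σ u v w) (h₂ : ∀ u w, IsLinearMap ℝ fun v => σ u v w)
    (h₃ : ∀ u v, IsLinearMap ℝ fun w => σ u v w) :
    ∃ Γ : V →L[ℝ] V →L[ℝ] V, ∀ u v w, g (Γ u v) w = σ u v w := by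
  have inj : Function.Injective g.toLinearMap := by
    refine (injective_iff_map_eq_zero _).mpr fun u hu => nondeg u fun v => ?_
    exact congrArg (fun l : V →L[ℝ] ℝ => l v) hu
  have hd : Module.finrank ℝ V = Module.finrank ℝ (V →L[ℝ] ℝ) := by
    rw [← (LinearMap.toContinuousLinearMap (𝕜 := ℝ) (E := V) (F' := ℝ)).finrank_eq]
    exact Subspace.dual_finrank_eq.symm
  have surj : Function.Surjective g.toLinearMap :=
    (LinearMap.injective_iff_surjective_of_finrank_eq_finrank hd).mp inj
  choose Γ hΓ using fun u v => surj (LinearMap.toContinuousLinearMap (IsLinearMap.mk' _ (h₃ u v)))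
  have hg : ∀ u v w, g (Γ u v) w = σ u v w := fun u v w =>
    congrArg (fun l : V →L[ℝ] ℝ => l w) (hΓ u v)
  have ext : ∀ x y, (∀ w, g x w = g y w) → x = y := fun x y h =>
    inj (ContinuousLinearMap.ext h)
  let B : V →ₗ[ℝ] V →ₗ[ℝ] V := LinearMap.mk₂ ℝ Γ
    (fun u u' v => ext _ _ fun w => by simp [hg, (h₁ v w).map_add])
    (fun c u v => ext _ _ fun w => by simp [hg, (h₁ v w).map_smul])
    (fun u v v' => ext _ _ fun w => by simp [hg, (h₂ u w).map_add])
    (fun c u v => ext _ _ fun w => by simp [hg, (h₂ u w).map_smul])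
  exact ⟨LinearMap.toContinuousLinearMap
    ((LinearMap.toContinuousLinearMap (𝕜 := ℝ) (E := V) (F' := V)).toLinearMap ∘ₗ B), hg⟩

/-- The existence half of the fundamental theorem at one point: `D` plays the role of the derivative
of the metric, and the Christoffel symbol comes from Koszul's formula. -/
lemma exists_christoffel [FiniteDimensional ℝ V] {g : V →L[ℝ] V →L[ℝ] ℝ}
    (symm : ∀ u v, g u v = g v u)
    (nondeg : ∀ u, (∀ v, g u v = 0) → u = 0) {D : V → V → V → ℝ}
    (h₁ : ∀ v w, IsLinearMap ℝ fun u => D u v w) (h₂ : ∀ u w, IsLinearMap ℝ fun v => D u v w)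
    (h₃ : ∀ u v, IsLinearMap ℝ fun w => D u v w)
    (hD : ∀ u v w, D u v w = D u w v) :
    ∃ Γ : V →L[ℝ] V →L[ℝ] V, (∀ u v, Γ u v = Γ v u) ∧
      ∀ u v w, D u v w = g (Γ u v) w + g v (Γ u w) := by
  obtain ⟨Γ, hΓ⟩ := exists_trilinear_rep nondeg
    (σ := fun u v w => (D u v w + D v u w - D w u v) / 2)
    (fun v w => ⟨fun x y => by rw [(h₁ v w).map_add, (h₂ v w).map_add, (h₂ w v).map_add]; ring,
      fun c x => by
        rw [(h₁ v w).map_smul, (h₂ v w).map_smul, (h₂ w v).map_smul]; simp only [smul_eq_mul]; ring⟩)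
    (fun u w => ⟨fun x y => by rw [(h₂ u w).map_add, (h₁ u w).map_add, (h₃ w u).map_add]; ring,
      fun c x => by
        rw [(h₂ u w).map_smul, (h₁ u w).map_smul, (h₃ w u).map_smul]; simp only [smul_eq_mul]; ring⟩)
    (fun u v => ⟨fun x y => by rw [(h₃ u v).map_add, (h₃ v u).map_add, (h₁ u v).map_add]; ring,
      fun c x => by
        rw [(h₃ u v).map_smul, (h₃ v u).map_smul, (h₁ u v).map_smul]; simp only [smul_eq_mul]; ring⟩)
  refine ⟨Γ, fun u v => ?_, fun u v w => ?_⟩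
  · rw [← sub_eq_zero]
    refine nondeg _ fun w => ?_
    rw [map_sub, sub_apply, hΓ, hΓ, hD w u v]
    ring
  · rw [symm v, hΓ, hΓ, hD w u v, hD v u w, hD u v w]
    ring

/-! ## The normalizer of the quaternions -/

lemma mem_span_triple_iff {E : Type*} [AddCommGroup E] [Module ℝ E] {a b c x : E} :
    x ∈ Submodule.span ℝ {a, b, c} ↔ ∃ r s t : ℝ, x = r • a + s • b + t • c := by
  rw [Submodule.mem_span_triple]
  exact ⟨fun ⟨r, s, t, h⟩ => ⟨r, s, t, h.symm⟩, fun ⟨r, s, t, h⟩ => ⟨r, s, t, h.symm⟩⟩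

/-- An endomorphism `T` that normalizes the quaternions acts on them as an element
`p I + q J + r K`. -/
lemma QuatHerm.normalizer [Nontrivial V] {g : V →L[ℝ] V →L[ℝ] ℝ} {I J K : V →L[ℝ] V}
    (q : QuatHerm g I J K) {T : V →L[ℝ] V}
    (hI : T.comp I - I.comp T ∈ Submodule.span ℝ {I, J, K})
    (hJ : T.comp J - J.comp T ∈ Submodule.span ℝ {I, J, K}) :
    ∃ p : Fin 3 → ℝ, (∀ v, T (I v) = I (T v) + (2 * p 2) • J v - (2 * p 1) • K v) ∧
      (∀ v, T (J v) = J (T v) + (2 * p 0) • K v - (2 * p 2) • I v) ∧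
      (∀ v, T (K v) = K (T v) + (2 * p 1) • I v - (2 * p 0) • J v) := by
  obtain ⟨a₁, a₂, a₃, ha⟩ := mem_span_triple_iff.mp hI
  obtain ⟨b₁, b₂, b₃, hb⟩ := mem_span_triple_iff.mp hJ
  have hA : ∀ v, T (I v) = I (T v) + (a₁ • I v + a₂ • J v + a₃ • K v) := fun v => by
    have := congrArg (fun l : V →L[ℝ] V => l v) ha
    simp only [sub_apply, ContinuousLinearMap.comp_apply, add_apply, smul_apply] at this
    rw [← this]; abel
  have hB : ∀ v, T (J v) = J (T v) + (b₁ • I v + b₂ • J v + b₃ • K v) := fun v => by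
    have := congrArg (fun l : V →L[ℝ] V => l v) hb
    simp only [sub_apply, ContinuousLinearMap.comp_apply, add_apply, smul_apply] at this
    rw [← this]; abel
  obtain ⟨v, hv⟩ := exists_ne (0 : V)
  have cancel : ∀ (c : ℝ), c • v = 0 → c = 0 := fun c hc =>
    (smul_eq_zero.mp hc).resolve_right hv
  have half : ∀ (x : V), (2 : ℝ) • x = 0 → x = 0 := fun x hx =>
    (smul_eq_zero_iff_right (two_ne_zero (α := ℝ))).mp hx
  -- Since I² = -1, the commutator [T, I] anticommutes with I, which excludes an I-component.
  have a10 : a₁ = 0 := by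
    have h := hA (I v)
    simp only [q.II, q.JI, q.KI, q.IJ, q.IK, map_add, map_neg, map_smul, hA v] at h
    refine cancel _ (half _ ?_)
    rw [← sub_eq_zero] at h; rw [← h]; module
  have b20 : b₂ = 0 := by
    have h := hB (J v)
    simp only [q.JJ, q.JI, q.KJ, q.IJ, q.JK, map_add, map_neg, map_smul, hB v] at h
    refine cancel _ (half _ ?_)
    rw [← sub_eq_zero] at h; rw [← h]; module
  have hC : ∀ v, T (K v) = K (T v) +
      (-a₂ • v - a₃ • I v - b₁ • v - b₃ • J v) := fun v => by
    rw [← q.IJ v, hA (J v), hB v, a10, b20]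
    simp only [map_add, map_smul, q.II, q.JJ, q.IJ, q.KJ, q.IK]
    module
  -- [T, K] anticommutes with K, which excludes its scalar part -(a₂ + b₁).
  have hab : a₂ + b₁ = 0 := by
    have h := hC (K v)
    simp only [q.KK, q.IK, q.KI, q.KJ, q.JK, map_add, map_sub, map_neg, map_smul, hC v] at h
    refine cancel _ (half _ ?_)
    have h' := congrArg K h
    simp only [q.KK, q.KI, q.KJ, map_add, map_sub, map_neg, map_smul] at h'
    rw [← sub_eq_zero] at h'; rw [← neg_eq_zero, ← h']; module
  -- The halves compensate for [J, I] = -2K and its cyclic analogues.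
  refine ⟨![b₃ / 2, -a₃ / 2, a₂ / 2], fun v => ?_, fun v => ?_, fun v => ?_⟩
  · rw [hA, a10]; simp; module
  · rw [hB, b20, eq_neg_of_add_eq_zero_right hab]; simp; module
  · rw [hC, eq_neg_of_add_eq_zero_right hab]; simp; module

end LinearAlgebra

section LinearAlgebra

variable {V : Type*} [NormedAddCommGroup V] [NormedSpace ℝ V]

/-! ## The pointwise equations of a twisted elementary deformation -/

/-- `g_α` on a quaternionic Hermitian vector space with distinguished vector `X`. -/
def galpha (g : V →L[ℝ] V →L[ℝ] ℝ) (I J K : V →L[ℝ] V) (X u v : V) : ℝ :=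
  g X u * g X v + g (I X) u * g (I X) v + g (J X) u * g (J X) v + g (K X) u * g (K X) v

/-- `f g + h g_α`. -/
def deform (g : V →L[ℝ] V →L[ℝ] ℝ) (I J K : V →L[ℝ] V) (X : V) (f h : ℝ) (u v : V) : ℝ :=
  f * g u v + h * galpha g I J K X u v

/-- The covariant derivative of `f g + h g_α` for the Levi-Civita connection of `g`, where `N` is
the covariant derivative of `X`. -/
def nablaDeform (g : V →L[ℝ] V →L[ℝ] ℝ) (I J K : V →L[ℝ] V) (X : V) (h : ℝ) (N : V → V)
    (df dh : V → ℝ) (u v w : V) : ℝ :=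
  df u * g v w + dh u * galpha g I J K X v w +
    h * (g (N u) v * g X w + g X v * g (N u) w
      + g (I (N u)) v * g (I X) w + g (I X) v * g (I (N u)) w
      + g (J (N u)) v * g (J X) w + g (J X) v * g (J (N u)) w
      + g (K (N u)) v * g (K X) w + g (K X) v * g (K (N u)) w)

/-- The first-order data at a point of a hyperKähler manifold with rotating symmetry `X` and of a
twist of it; `∇X = L - I / 2`, and `S` is the difference of the two Levi-Civita connections. -/
structure TwistJet (g : V →L[ℝ] V →L[ℝ] ℝ) (I J K : V →L[ℝ] V) (X : V) (L : V →L[ℝ] V)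
    (f h a : ℝ) (df dh : V →L[ℝ] ℝ) (F : V →L[ℝ] V →L[ℝ] ℝ) (S : V →L[ℝ] V →L[ℝ] V) : Prop where
  quat : QuatHerm g I J K
  L_I : ∀ u, L (I u) = I (L u)
  L_J : ∀ u, L (J u) = J (L u)
  skew : ∀ u v, g (L u) v = -g (L v) u
  metric : ∀ u v w, deform g I J K X f h (S u v) w + deform g I J K X f h v (S u w) =
    nablaDeform g I J K X h (fun u => L u - (1 / 2 : ℝ) • I u) df dh u v w
  torsion : ∀ u v, S u v - S v u = (F u v / a) • X

namespace TwistJet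

variable {g : V →L[ℝ] V →L[ℝ] ℝ} {I J K : V →L[ℝ] V} {X : V} {L : V →L[ℝ] V}
    {f h a : ℝ} {df dh : V →L[ℝ] ℝ} {F : V →L[ℝ] V →L[ℝ] ℝ} {S : V →L[ℝ] V →L[ℝ] V}
    (t : TwistJet g I J K X L f h a df dh F S)
include t

lemma L_K (u : V) : L (K u) = K (L u) := by
  rw [← t.quat.IJ, t.L_I, t.L_J, t.quat.IJ]

lemma skew_I (u v : V) : g (I (L u)) v = g (I (L v)) u := by
  rw [t.quat.I_skew, t.quat.symm, t.skew, t.L_I]; ring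
lemma skew_J (u v : V) : g (J (L u)) v = g (J (L v)) u := by
  rw [t.quat.J_skew, t.quat.symm, t.skew, t.L_J]; ring
lemma skew_K (u v : V) : g (K (L u)) v = g (K (L v)) u := by
  rw [t.quat.K_skew, t.quat.symm, t.skew, t.L_K]; ring

set_option maxHeartbeats 1000000 in
/-- The three-form equation for `ω_I`. -/
lemma three_form_I {p : V → Fin 3 → ℝ}
    (hS : ∀ u v, S u (I v) = I (S u v) + (2 * p u 2) • J v - (2 * p u 1) • K v) {T : V → V → V → ℝ}
    (hT : ∀ u v w, T u v w = df u * g (I v) w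
      + dh u * (g X v * g (I X) w - g (I X) v * g X w + g (J X) v * g (K X) w - g (K X) v * g (J X) w)
      + (2 * h * g (L u) v - (f + h * g X X) / a * F u v - h * g (I u) v) * g (I X) w
      + h * (g (K u) v * g (K X) w + g (J u) v * g (J X) w)
      - 2 * p u 2 * (f * g (J v) w + h * (g X v * g (J X) w - g (J X) v * g X w
          + g (K X) v * g (I X) w - g (I X) v * g (K X) w))
      + 2 * p u 1 * (f * g (K v) w + h * (g X v * g (K X) w - g (K X) v * g X w
          + g (I X) v * g (J X) w - g (J X) v * g (I X) w))) (u v w : V) :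
    T u v w + T v w u + T w u v = 0 := by
  have q := t.quat
  -- In the cyclic sum of these three equations `hS` moves I through S, and the torsion exchanges
  -- the arguments of S, so every occurrence of S cancels. What remains is the exterior derivative
  -- of the deformed ω_I with its curvature correction from the twist.
  have h1 := t.metric u (I v) w
  have h2 := t.metric v (I w) u
  have h3 := t.metric w (I u) v
  have s1 : S v u = S u v - (F u v / a) • X := by rw [← t.torsion]; abel
  have s2 : S w v = S v w - (F v w / a) • X := by rw [← t.torsion]; abel
  have s3 : S u w = S w u - (F w u / a) • X := by rw [← t.torsion]; abel
  simp only [hS, s1, s2, s3, deform, nablaDeform, galpha] at h1 h2 h3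
  simp only [hT]
  have r : ∀ x y z, g (I (S x y)) z = -g (I z) (S x y) := fun x y z => by rw [q.I_skew]
  simp only [map_add, map_sub, map_smul, map_neg, add_apply, sub_apply, smul_apply, smul_eq_mul,
    neg_apply, q.II, q.JJ, q.KK, q.IJ, q.JI, q.IK, q.KI, q.JK, q.KJ, r, q.gI, q.gJ, q.gK] at h1 h2 h3 ⊢
  simp only [q.I_skew v u, q.I_skew w v, q.I_skew u w, q.J_skew v u, q.J_skew w v, q.J_skew u w,
    q.K_skew v u, q.K_skew w v, q.K_skew u w, q.symm v u, q.symm w v, q.symm u w,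
    t.skew v u, t.skew w v, t.skew u w, t.skew_I v u, t.skew_I w v, t.skew_I u w,
    t.skew_J v u, t.skew_J w v, t.skew_J u w, t.skew_K v u, t.skew_K w v, t.skew_K u w,
    q.I_skew u X, q.I_skew v X, q.I_skew w X, q.I_self X, q.J_self X, q.K_self X] at h1 h2 h3 ⊢
  -- Opaque functions replace the coerced linear maps, so that the concluding identity is one of
  -- polynomials in plain atoms.
  obtain ⟨b, hb⟩ : ∃ b : V → V → ℝ, ∀ x y, g x y = b x y := ⟨_, fun _ _ => rfl⟩
  obtain ⟨i, hi⟩ : ∃ i : V → V, ∀ x, I x = i x := ⟨_, fun _ => rfl⟩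
  obtain ⟨j, hj⟩ : ∃ j : V → V, ∀ x, J x = j x := ⟨_, fun _ => rfl⟩
  obtain ⟨k, hk⟩ : ∃ k : V → V, ∀ x, K x = k x := ⟨_, fun _ => rfl⟩
  obtain ⟨l, hl⟩ : ∃ l : V → V, ∀ x, L x = l x := ⟨_, fun _ => rfl⟩
  obtain ⟨s, hs⟩ : ∃ s : V → V → V, ∀ x y, S x y = s x y := ⟨_, fun _ _ => rfl⟩
  obtain ⟨F', hF⟩ : ∃ b : V → V → ℝ, ∀ x y, F x y = b x y := ⟨_, fun _ _ => rfl⟩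
  obtain ⟨df', hdf⟩ : ∃ b : V → ℝ, ∀ x, df x = b x := ⟨_, fun _ => rfl⟩
  obtain ⟨dh', hdh⟩ : ∃ b : V → ℝ, ∀ x, dh x = b x := ⟨_, fun _ => rfl⟩
  simp only [hb, hi, hj, hk, hl, hs, hF, hdf, hdh] at h1 h2 h3 ⊢
  linear_combination -h1 - h2 - h3

set_option maxHeartbeats 1000000 in
/-- The three-form equation for `ω_J`. -/
lemma three_form_J {p : V → Fin 3 → ℝ}
    (hS : ∀ u v, S u (J v) = J (S u v) + (2 * p u 0) • K v - (2 * p u 2) • I v) {T : V → V → V → ℝ}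
    (hT : ∀ u v w, T u v w = df u * g (J v) w
      + dh u * (g X v * g (J X) w - g (J X) v * g X w + g (K X) v * g (I X) w - g (I X) v * g (K X) w)
      + (2 * h * g (L u) v - (f + h * g X X) / a * F u v - h * g (I u) v) * g (J X) w
      + h * (-(g (K u) v * g X w) - g (J u) v * g (I X) w)
      - 2 * p u 0 * (f * g (K v) w + h * (g X v * g (K X) w - g (K X) v * g X w
          + g (I X) v * g (J X) w - g (J X) v * g (I X) w))
      + 2 * p u 2 * (f * g (I v) w + h * (g X v * g (I X) w - g (I X) v * g X w
          + g (J X) v * g (K X) w - g (K X) v * g (J X) w))) (u v w : V) :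
    T u v w + T v w u + T w u v = 0 := by
  have q := t.quat
  have h1 := t.metric u (J v) w
  have h2 := t.metric v (J w) u
  have h3 := t.metric w (J u) v
  have s1 : S v u = S u v - (F u v / a) • X := by rw [← t.torsion]; abel
  have s2 : S w v = S v w - (F v w / a) • X := by rw [← t.torsion]; abel
  have s3 : S u w = S w u - (F w u / a) • X := by rw [← t.torsion]; abel
  simp only [hS, s1, s2, s3, deform, nablaDeform, galpha] at h1 h2 h3
  simp only [hT]
  have r : ∀ x y z, g (J (S x y)) z = -g (J z) (S x y) := fun x y z => by rw [q.J_skew]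
  simp only [map_add, map_sub, map_smul, map_neg, add_apply, sub_apply, smul_apply, smul_eq_mul,
    neg_apply, q.II, q.JJ, q.KK, q.IJ, q.JI, q.IK, q.KI, q.JK, q.KJ, r, q.gI, q.gJ, q.gK] at h1 h2 h3 ⊢
  simp only [q.I_skew v u, q.I_skew w v, q.I_skew u w, q.J_skew v u, q.J_skew w v, q.J_skew u w,
    q.K_skew v u, q.K_skew w v, q.K_skew u w, q.symm v u, q.symm w v, q.symm u w,
    t.skew v u, t.skew w v, t.skew u w, t.skew_I v u, t.skew_I w v, t.skew_I u w,
    t.skew_J v u, t.skew_J w v, t.skew_J u w, t.skew_K v u, t.skew_K w v, t.skew_K u w,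
    q.J_skew u X, q.J_skew v X, q.J_skew w X, q.I_self X, q.J_self X, q.K_self X] at h1 h2 h3 ⊢
  obtain ⟨b, hb⟩ : ∃ b : V → V → ℝ, ∀ x y, g x y = b x y := ⟨_, fun _ _ => rfl⟩
  obtain ⟨i, hi⟩ : ∃ i : V → V, ∀ x, I x = i x := ⟨_, fun _ => rfl⟩
  obtain ⟨j, hj⟩ : ∃ j : V → V, ∀ x, J x = j x := ⟨_, fun _ => rfl⟩
  obtain ⟨k, hk⟩ : ∃ k : V → V, ∀ x, K x = k x := ⟨_, fun _ => rfl⟩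
  obtain ⟨l, hl⟩ : ∃ l : V → V, ∀ x, L x = l x := ⟨_, fun _ => rfl⟩
  obtain ⟨s, hs⟩ : ∃ s : V → V → V, ∀ x y, S x y = s x y := ⟨_, fun _ _ => rfl⟩
  obtain ⟨F', hF⟩ : ∃ b : V → V → ℝ, ∀ x y, F x y = b x y := ⟨_, fun _ _ => rfl⟩
  obtain ⟨df', hdf⟩ : ∃ b : V → ℝ, ∀ x, df x = b x := ⟨_, fun _ => rfl⟩
  obtain ⟨dh', hdh⟩ : ∃ b : V → ℝ, ∀ x, dh x = b x := ⟨_, fun _ => rfl⟩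
  simp only [hb, hi, hj, hk, hl, hs, hF, hdf, hdh] at h1 h2 h3 ⊢
  linear_combination -h1 - h2 - h3

set_option maxHeartbeats 1000000 in
/-- The three-form equation for `ω_K`. -/
lemma three_form_K {p : V → Fin 3 → ℝ}
    (hS : ∀ u v, S u (K v) = K (S u v) + (2 * p u 1) • I v - (2 * p u 0) • J v) {T : V → V → V → ℝ}
    (hT : ∀ u v w, T u v w = df u * g (K v) w
      + dh u * (g X v * g (K X) w - g (K X) v * g X w + g (I X) v * g (J X) w - g (J X) v * g (I X) w)
      + (2 * h * g (L u) v - (f + h * g X X) / a * F u v - h * g (I u) v) * g (K X) w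
      + h * (g (J u) v * g X w - g (K u) v * g (I X) w)
      - 2 * p u 1 * (f * g (I v) w + h * (g X v * g (I X) w - g (I X) v * g X w
          + g (J X) v * g (K X) w - g (K X) v * g (J X) w))
      + 2 * p u 0 * (f * g (J v) w + h * (g X v * g (J X) w - g (J X) v * g X w
          + g (K X) v * g (I X) w - g (I X) v * g (K X) w))) (u v w : V) :
    T u v w + T v w u + T w u v = 0 := by
  have q := t.quat
  have h1 := t.metric u (K v) w
  have h2 := t.metric v (K w) u
  have h3 := t.metric w (K u) v
  have s1 : S v u = S u v - (F u v / a) • X := by rw [← t.torsion]; abel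
  have s2 : S w v = S v w - (F v w / a) • X := by rw [← t.torsion]; abel
  have s3 : S u w = S w u - (F w u / a) • X := by rw [← t.torsion]; abel
  simp only [hS, s1, s2, s3, deform, nablaDeform, galpha] at h1 h2 h3
  simp only [hT]
  have r : ∀ x y z, g (K (S x y)) z = -g (K z) (S x y) := fun x y z => by rw [q.K_skew]
  simp only [map_add, map_sub, map_smul, map_neg, add_apply, sub_apply, smul_apply, smul_eq_mul,
    neg_apply, q.II, q.JJ, q.KK, q.IJ, q.JI, q.IK, q.KI, q.JK, q.KJ, r, q.gI, q.gJ, q.gK] at h1 h2 h3 ⊢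
  simp only [q.I_skew v u, q.I_skew w v, q.I_skew u w, q.J_skew v u, q.J_skew w v, q.J_skew u w,
    q.K_skew v u, q.K_skew w v, q.K_skew u w, q.symm v u, q.symm w v, q.symm u w,
    t.skew v u, t.skew w v, t.skew u w, t.skew_I v u, t.skew_I w v, t.skew_I u w,
    t.skew_J v u, t.skew_J w v, t.skew_J u w, t.skew_K v u, t.skew_K w v, t.skew_K u w,
    q.K_skew u X, q.K_skew v X, q.K_skew w X, q.I_self X, q.J_self X, q.K_self X] at h1 h2 h3 ⊢
  obtain ⟨b, hb⟩ : ∃ b : V → V → ℝ, ∀ x y, g x y = b x y := ⟨_, fun _ _ => rfl⟩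
  obtain ⟨i, hi⟩ : ∃ i : V → V, ∀ x, I x = i x := ⟨_, fun _ => rfl⟩
  obtain ⟨j, hj⟩ : ∃ j : V → V, ∀ x, J x = j x := ⟨_, fun _ => rfl⟩
  obtain ⟨k, hk⟩ : ∃ k : V → V, ∀ x, K x = k x := ⟨_, fun _ => rfl⟩
  obtain ⟨l, hl⟩ : ∃ l : V → V, ∀ x, L x = l x := ⟨_, fun _ => rfl⟩
  obtain ⟨s, hs⟩ : ∃ s : V → V → V, ∀ x y, S x y = s x y := ⟨_, fun _ _ => rfl⟩
  obtain ⟨F', hF⟩ : ∃ b : V → V → ℝ, ∀ x y, F x y = b x y := ⟨_, fun _ _ => rfl⟩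
  obtain ⟨df', hdf⟩ : ∃ b : V → ℝ, ∀ x, df x = b x := ⟨_, fun _ => rfl⟩
  obtain ⟨dh', hdh⟩ : ∃ b : V → ℝ, ∀ x, dh x = b x := ⟨_, fun _ => rfl⟩
  simp only [hb, hi, hj, hk, hl, hs, hF, hdf, hdh] at h1 h2 h3 ⊢
  linear_combination -h1 - h2 - h3

end TwistJet
end LinearAlgebra

/-! ### Solving the three-form equations on the quaternionic line of X and its complement -/

section LinearAlgebra

variable {V : Type*} [NormedAddCommGroup V] [NormedSpace ℝ V]

/-- `v` is orthogonal to the quaternionic line spanned by `X`. -/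
structure QuatPerp (g : V →L[ℝ] V →L[ℝ] ℝ) (I J K : V →L[ℝ] V) (X v : V) : Prop where
  r : g X v = 0
  i : g (I X) v = 0
  j : g (J X) v = 0
  k : g (K X) v = 0

section
variable {g : V →L[ℝ] V →L[ℝ] ℝ} {I J K : V →L[ℝ] V} {X v : V}

lemma QuatPerp.r' (q : QuatHerm g I J K) (h : QuatPerp g I J K X v) : g v X = 0 := by
  rw [q.symm, h.r]
lemma QuatPerp.i' (q : QuatHerm g I J K) (h : QuatPerp g I J K X v) : g (I v) X = 0 := by
  rw [q.I_skew, h.i, neg_zero]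
lemma QuatPerp.j' (q : QuatHerm g I J K) (h : QuatPerp g I J K X v) : g (J v) X = 0 := by
  rw [q.J_skew, h.j, neg_zero]
lemma QuatPerp.k' (q : QuatHerm g I J K) (h : QuatPerp g I J K X v) : g (K v) X = 0 := by
  rw [q.K_skew, h.k, neg_zero]
lemma QuatPerp.mapI (q : QuatHerm g I J K) (h : QuatPerp g I J K X v) : QuatPerp g I J K X (I v) := by
  constructor <;> simp [q.gI, q.II, q.IJ, q.IK, h.r, h.i, h.j, h.k]
lemma QuatPerp.mapJ (q : QuatHerm g I J K) (h : QuatPerp g I J K X v) : QuatPerp g I J K X (J v) := by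
  constructor <;> simp [q.gJ, q.JI, q.JJ, q.JK, h.r, h.i, h.j, h.k]
lemma QuatPerp.mapK (q : QuatHerm g I J K) (h : QuatPerp g I J K X v) : QuatPerp g I J K X (K v) := by
  constructor <;> simp [q.gK, q.KI, q.KJ, q.KK, h.r, h.i, h.j, h.k]
end

/-- The solution of the three three-form equations. -/
lemma three_form_solution {g : V →L[ℝ] V →L[ℝ] ℝ} {I J K : V →L[ℝ] V} (q : QuatHerm g I J K)
    {X e : V} (hn : g X X ≠ 0) (he : QuatPerp g I J K X e) (hee : g e e ≠ 0)
    {f h : ℝ} (hf : f ≠ 0) (hq : f + h * g X X ≠ 0) {df dh : V →L[ℝ] ℝ}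
    {p : V → Fin 3 → ℝ} {Φ : V →L[ℝ] V →L[ℝ] ℝ}
    (hΦ : ∀ u v, Φ u v = -Φ v u)
    {TI TJ TK : V → V → V → ℝ}
    (hTI : ∀ u v w, TI u v w = df u * g (I v) w
      + dh u * (g X v * g (I X) w - g (I X) v * g X w + g (J X) v * g (K X) w - g (K X) v * g (J X) w)
      + (Φ u v - h * g (I u) v) * g (I X) w
      + h * (g (K u) v * g (K X) w + g (J u) v * g (J X) w)
      - 2 * p u 2 * (f * g (J v) w + h * (g X v * g (J X) w - g (J X) v * g X w
          + g (K X) v * g (I X) w - g (I X) v * g (K X) w))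
      + 2 * p u 1 * (f * g (K v) w + h * (g X v * g (K X) w - g (K X) v * g X w
          + g (I X) v * g (J X) w - g (J X) v * g (I X) w)))
    (hTJ : ∀ u v w, TJ u v w = df u * g (J v) w
      + dh u * (g X v * g (J X) w - g (J X) v * g X w + g (K X) v * g (I X) w - g (I X) v * g (K X) w)
      + (Φ u v - h * g (I u) v) * g (J X) w
      + h * (-(g (K u) v * g X w) - g (J u) v * g (I X) w)
      - 2 * p u 0 * (f * g (K v) w + h * (g X v * g (K X) w - g (K X) v * g X w
          + g (I X) v * g (J X) w - g (J X) v * g (I X) w))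
      + 2 * p u 2 * (f * g (I v) w + h * (g X v * g (I X) w - g (I X) v * g X w
          + g (J X) v * g (K X) w - g (K X) v * g (J X) w)))
    (hTK : ∀ u v w, TK u v w = df u * g (K v) w
      + dh u * (g X v * g (K X) w - g (K X) v * g X w + g (I X) v * g (J X) w - g (J X) v * g (I X) w)
      + (Φ u v - h * g (I u) v) * g (K X) w
      + h * (g (J u) v * g X w - g (K u) v * g (I X) w)
      - 2 * p u 1 * (f * g (I v) w + h * (g X v * g (I X) w - g (I X) v * g X w
          + g (J X) v * g (K X) w - g (K X) v * g (J X) w))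
      + 2 * p u 0 * (f * g (J v) w + h * (g X v * g (J X) w - g (J X) v * g X w
          + g (K X) v * g (I X) w - g (I X) v * g (K X) w)))
    (EI : ∀ u v w, TI u v w + TI v w u + TI w u v = 0)
    (EJ : ∀ u v w, TJ u v w + TJ v w u + TJ w u v = 0)
    (EK : ∀ u v w, TK u v w + TK v w u + TK w u v = 0) :
    (∀ u, df u = h * g (I X) u) ∧ ∀ z : ℝ, (∀ u, dh u = z * g (I X) u) → ∀ u v,
      Φ u v = (2 * h ^ 2 / f - z) * (g (J X) u * g (K X) v - g (K X) u * g (J X) v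
        - (g X u * g (I X) v - g (I X) u * g X v)) := by
  have hqn : g X X * (f + h * g X X) ≠ 0 := mul_ne_zero hn hq
  have alt : ∀ u, Φ u u = 0 := fun u => by linarith [hΦ u u]
  have cancel : ∀ {b c : ℝ}, b ≠ 0 → b * c = 0 → c = 0 := fun hb hc =>
    (mul_eq_zero.mp hc).resolve_left hb
  -- the equations on one vector orthogonal to the quaternionic span of `X` and two in the span
  have H1 : ∀ {w}, QuatPerp g I J K X w →
      (df w = -dh w * g X X ∧ p w 0 = 0 ∧ p w 1 = 0 ∧ p w 2 = 0) ∧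
      (Φ X w = 0 ∧ Φ (I X) w = 0 ∧ Φ (J X) w = 0 ∧ Φ (K X) w = 0) := by
    intro w hw
    have a1 := EI w (J X) (K X)
    have a2 := EI w X (J X)
    have a3 := EI w X (K X)
    have a4 := EJ w X (K X)
    have a5 := EI w X (I X)
    have a6 := EI w (I X) (J X)
    have a7 := EI w (I X) (K X)
    have a8 := EJ w (J X) (I X)
    simp only [hTI, hTJ, q.II, q.JJ, q.KK, q.IJ, q.JI, q.IK, q.KI, q.JK, q.KJ, q.gI, q.gJ, q.gK,
    q.I_self, q.J_self, q.K_self, map_neg, neg_apply, neg_zero, neg_neg, mul_zero, zero_mul, add_zero,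
    zero_add, sub_zero, zero_sub,
      hw.r, hw.i, hw.j, hw.k, hw.r' q, hw.i' q, hw.j' q, hw.k' q] at a1 a2 a3 a4 a5 a6 a7 a8
    have b2 : p w 2 = 0 := cancel hqn (by linarith)
    have b1 : p w 1 = 0 := cancel hqn (by linarith)
    have b0 : p w 0 = 0 := cancel hqn (by linarith)
    rw [b2] at a7
    rw [b1] at a6
    rw [b0] at a8
    refine ⟨⟨?_, b0, b1, b2⟩, ?_, ?_, ?_, ?_⟩
    · exact sub_eq_zero.mp (cancel hn (by linarith))
    · rw [hΦ, neg_eq_zero]; exact cancel hn (by linarith)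
    all_goals exact cancel hn (by linarith)
  -- the equations on three orthogonal vectors
  have H2 : ∀ {e'}, QuatPerp g I J K X e' → g e' e' ≠ 0 → df (J e') = 0 := by
    intro w hw hww
    have a := EI (J w) w (I w)
    simp only [hTI, q.II, q.JJ, q.KK, q.IJ, q.JI, q.IK, q.KI, q.JK, q.KJ, q.gI, q.gJ, q.gK,
    q.I_self, q.J_self, q.K_self, map_neg, neg_apply, neg_zero, neg_neg, mul_zero, zero_mul, add_zero,
    zero_add, sub_zero, zero_sub,
      hw.r, hw.i, hw.j, hw.k, hw.r' q, hw.i' q, hw.j' q, hw.k' q, (H1 (hw.mapJ q)).1.2, (H1 (hw.mapI q)).1.2, (H1 hw).1.2] at a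
    exact cancel hww (by linarith)
  -- `H2` is applied to J e, and below to K e, because J (J e) = -e and J (K e) = I e.
  have dfe : df e = 0 := by
    have := H2 (he.mapJ q) (by rwa [q.gJJ])
    rwa [q.JJ, map_neg, neg_eq_zero] at this
  have dfIe : df (I e) = 0 := by
    have := H2 (he.mapK q) (by rwa [q.gKK])
    rwa [q.JK] at this
  -- On the triple w, e, I e only the term df w · g(e, e) survives; no orthogonality between w and e
  -- is needed, since df already vanishes on e and I e.
  have H3 : ∀ {w}, QuatPerp g I J K X w → df w = 0 ∧ dh w = 0 := by
    intro w hw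
    have a := EI w e (I e)
    simp only [hTI, q.II, q.JJ, q.KK, q.IJ, q.JI, q.IK, q.KI, q.JK, q.KJ, q.gI, q.gJ, q.gK,
    q.I_self, q.J_self, q.K_self, map_neg, neg_apply, neg_zero, neg_neg, mul_zero, zero_mul, add_zero,
    zero_add, sub_zero, zero_sub,
      hw.r, hw.i, hw.j, hw.k, hw.r' q, hw.i' q, hw.j' q, hw.k' q, he.r, he.i, he.j, he.k, he.r' q, he.i' q, he.j' q, he.k' q, (H1 (he.mapI q)).1.2, (H1 hw).1.2, (H1 he).1.2] at a
    rw [dfe, dfIe] at a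
    have b : df w = 0 := cancel hee (by linarith)
    have c := (H1 hw).1.1
    rw [b] at c
    exact ⟨b, cancel hn (by linarith)⟩
  -- the equations on one vector in the span and two orthogonal ones
  have c1 := EI X e (I e)
  have c2 := EI (J X) e (I e)
  have c3 := EI (K X) e (I e)
  have c4 := EJ (I X) e (J e)
  have c5 := EI X e (J e)
  have c6 := EI (J X) e (J e)
  have c7 := EI (K X) e (J e)
  have c8 := EJ (I X) e (I e)
  have c9 := EI X e (K e)
  have c10 := EI (J X) e (K e)
  have c11 := EI (K X) e (K e)
  have c12 := EK (I X) e (I e)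
  have c13 := EJ X e (K e)
  have c14 := EJ (I X) e (K e)
  have c15 := EJ (K X) e (K e)
  have c16 := EK (J X) e (J e)
  simp only [hTI, hTJ, hTK, q.II, q.JJ, q.KK, q.IJ, q.JI, q.IK, q.KI, q.JK, q.KJ, q.gI, q.gJ, q.gK,
    q.I_self, q.J_self, q.K_self, map_neg, neg_apply, neg_zero, neg_neg, mul_zero, zero_mul, add_zero,
    zero_add, sub_zero, zero_sub,
    he.r, he.i, he.j, he.k, he.r' q, he.i' q, he.j' q, he.k' q] at c1 c2 c3 c4 c5 c6 c7 c8 c9 c10 c11 c12 c13 c14 c15 c16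
  have hfe : f * g e e ≠ 0 := mul_ne_zero hf hee
  have dfX : df X = 0 := cancel hee (by linarith)
  have dfJ : df (J X) = 0 := cancel hee (by linarith)
  have dfK : df (K X) = 0 := cancel hee (by linarith)
  have dfI : df (I X) = h * g X X := sub_eq_zero.mp (cancel hee (by linarith))
  have kX : p X 2 = 0 := cancel hfe (by linarith)
  have kI : p (I X) 2 = 0 := cancel hfe (by linarith)
  have kJ : 2 * f * p (J X) 2 = h * g X X := sub_eq_zero.mp (cancel hee (by linarith))
  have kK : p (K X) 2 = 0 := cancel hfe (by linarith)
  have jX : p X 1 = 0 := cancel hfe (by linarith)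
  have jI : p (I X) 1 = 0 := cancel hfe (by linarith)
  have jJ : p (J X) 1 = 0 := cancel hfe (by linarith)
  have jK : 2 * f * p (K X) 1 = -(h * g X X) :=
    eq_neg_of_add_eq_zero_left (cancel hee (by linarith))
  have iX : 2 * f * p X 0 = -(h * g X X) :=
    eq_neg_of_add_eq_zero_left (cancel hee (by linarith))
  have iI : p (I X) 0 = 0 := cancel hfe (by linarith)
  have iJ : p (J X) 0 = 0 := cancel hfe (by linarith)
  have iK : p (K X) 0 = 0 := cancel hfe (by linarith)
  -- The first argument I X isolates Φ v w: its coefficient is g(I X, I X), and the term with df (I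
  -- X) = h g(X, X) cancels the explicit h-term.
  have Φperp : ∀ {v w}, QuatPerp g I J K X v → QuatPerp g I J K X w → Φ v w = 0 := by
    intro v w hv hw
    have a := EI (I X) v w
    simp only [hTI, q.II, q.JJ, q.KK, q.IJ, q.JI, q.IK, q.KI, q.JK, q.KJ, q.gI, q.gJ, q.gK,
    q.I_self, q.J_self, q.K_self, map_neg, neg_apply, neg_zero, neg_neg, mul_zero, zero_mul, add_zero,
    zero_add, sub_zero, zero_sub,
      hv.r, hv.i, hv.j, hv.k, hv.r' q, hv.i' q, hv.j' q, hv.k' q, hw.r, hw.i, hw.j, hw.k, hw.r' q, hw.i' q, hw.j' q, hw.k' q, dfI, kI, jI] at a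
    exact cancel hn (by linarith)
  -- Orthogonal decomposition: X, I X, J X, K X are mutually orthogonal, all with the same nonzero
  -- square g(X, X).
  have dec : ∀ u, ∃ w, QuatPerp g I J K X w ∧ u = (g X u / g X X) • X + (g (I X) u / g X X) • I X
      + (g (J X) u / g X X) • J X + (g (K X) u / g X X) • K X + w := by
    intro u
    refine ⟨u - ((g X u / g X X) • X + (g (I X) u / g X X) • I X
      + (g (J X) u / g X X) • J X + (g (K X) u / g X X) • K X), ?_, by abel⟩
    constructor <;>
    · simp only [map_sub, map_add, map_smul, smul_eq_mul, q.II, q.JJ, q.KK, q.IJ, q.JI, q.IK, q.KI, q.JK, q.KJ, q.gI, q.gJ, q.gK,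
    q.I_self, q.J_self, q.K_self, map_neg, neg_apply, neg_zero, neg_neg, mul_zero, zero_mul, add_zero,
    zero_add, sub_zero, zero_sub]
      field_simp
      ring
  refine ⟨fun u => ?_, fun z hz u v => ?_⟩
  · obtain ⟨w, hw, hu⟩ := dec u
    have := congrArg df hu
    simp only [map_add, map_smul, smul_eq_mul, dfX, dfI, dfJ, dfK, (H3 hw).1] at this
    rw [this]
    field_simp
    ring
  -- Triples inside the quaternionic line determine Φ there. The nonzero values of `p` found above
  -- are multiples of h/f, and these produce the term 2h²/f.
  · have d1 := EI (I X) (J X) (K X)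
    have d2 := EJ X (I X) (J X)
    have d3 := EI X (I X) (J X)
    have d4 := EI X (I X) (K X)
    have d5 := EJ (J X) (K X) (I X)
    have d6 := EK (I X) (J X) (K X)
    simp only [hTI, hTJ, hTK, hz, q.II, q.JJ, q.KK, q.IJ, q.JI, q.IK, q.KI, q.JK, q.KJ, q.gI, q.gJ, q.gK,
    q.I_self, q.J_self, q.K_self, map_neg, neg_apply, neg_zero, neg_neg, mul_zero, zero_mul, add_zero,
    zero_add, sub_zero, zero_sub,
      dfX, dfI, dfJ, dfK, kX, kI, kK, jX, jI, jJ, iI, iJ, iK] at d1 d2 d3 d4 d5 d6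
    obtain ⟨x, hx, hu⟩ := dec u
    obtain ⟨y, hy, hv⟩ := dec v
    have e1 : Φ (J X) (K X) = (2 * h ^ 2 / f - z) * (g X X) ^ 2 := by
      have : g X X * (f * Φ (J X) (K X) - (2 * h ^ 2 - f * z) * (g X X) ^ 2) = 0 := by
        linear_combination f * d1 + (g X X * (f + h * g X X)) * (kJ - jK)
      have := cancel hn this
      field_simp
      linear_combination this
    have e2 : Φ X (I X) = -(2 * h ^ 2 / f - z) * (g X X) ^ 2 := by
      have : g X X * (f * Φ X (I X) + (2 * h ^ 2 - f * z) * (g X X) ^ 2) = 0 := by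
        linear_combination f * d2 + (g X X * (f + h * g X X)) * (iX - kJ)
      have := cancel hn this
      field_simp
      linear_combination this
    have e3 : Φ (J X) X = 0 := cancel hn (by linarith)
    have e4 : Φ (K X) X = 0 := cancel hn (by linarith)
    have e5 : Φ (K X) (I X) = 0 := cancel hn (by linarith)
    have e6 : Φ (I X) (J X) = 0 := cancel hn (by linarith)
    rw [congrArg₂ (fun a b => Φ a b) hu hv]
    simp only [map_add, map_smul, add_apply, smul_apply, smul_eq_mul, alt, (H1 hy).2, Φperp hx hy,
      hΦ x X, hΦ x (I X), hΦ x (J X), hΦ x (K X), (H1 hx).2, hΦ (I X) X, hΦ X (J X), hΦ X (K X),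
      hΦ (J X) (I X), hΦ (I X) (K X), hΦ (K X) (J X), e1, e2, e3, e4, e5, e6]
    field_simp
    ring

end LinearAlgebra

/-! ### Jets of quaternionic Kähler twists: determination and verification at a point -/

section LinearAlgebra

variable {V : Type*} [NormedAddCommGroup V] [NormedSpace ℝ V]

namespace TwistJet

variable {g : V →L[ℝ] V →L[ℝ] ℝ} {I J K : V →L[ℝ] V} {X : V} {L : V →L[ℝ] V}
    {f h a : ℝ} {df dh : V →L[ℝ] ℝ} {F : V →L[ℝ] V →L[ℝ] ℝ} {S : V →L[ℝ] V →L[ℝ] V}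
    (t : TwistJet g I J K X L f h a df dh F S)
include t

/-- If the two Levi-Civita connections differ by endomorphisms that normalize the quaternions, the
deformation and the twist are determined to first order. -/
lemma solution [Nontrivial V] (hS : ∀ u, ∀ T ∈ Submodule.span ℝ {I, J, K},
      (S u).comp T - T.comp (S u) ∈ Submodule.span ℝ {I, J, K})
    (hn : g X X ≠ 0) {e : V} (he : QuatPerp g I J K X e) (hee : g e e ≠ 0)
    (hf : f ≠ 0) (hq : f + h * g X X ≠ 0) (alt : ∀ u v, F u v = -F v u) :
    (∀ u, df u = h * g (I X) u) ∧ ∀ z : ℝ, (∀ u, dh u = z * g (I X) u) → ∀ u v,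
      2 * h * g (L u) v - (f + h * g X X) / a * F u v =
        (2 * h ^ 2 / f - z) * (g (J X) u * g (K X) v - g (K X) u * g (J X) v
        - (g X u * g (I X) v - g (I X) u * g X v)) := by
  choose p h1 h2 h3 using fun u => t.quat.normalizer
    (hS u I (Submodule.subset_span (by simp))) (hS u J (Submodule.subset_span (by simp)))
  -- `F` and `L` enter the three-form equations only through this combination.
  let Φ : V →L[ℝ] V →L[ℝ] ℝ := (2 * h) • g.comp L - ((f + h * g X X) / a) • F
  have hΦ : ∀ u v, Φ u v = 2 * h * g (L u) v - (f + h * g X X) / a * F u v := fun u v => by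
    simp [Φ]
  obtain ⟨r1, r2⟩ := three_form_solution t.quat hn he hee hf hq (df := df) (dh := dh) (p := p)
    (Φ := Φ) (fun u v => by rw [hΦ, hΦ, t.skew, alt]; ring) (fun u v w => rfl) (fun u v w => rfl)
    (fun u v w => rfl) (t.three_form_I h1 fun u v w => by rw [hΦ])
    (t.three_form_J h2 fun u v w => by rw [hΦ]) (t.three_form_K h3 fun u v w => by rw [hΦ])
  exact ⟨r1, fun z hz u v => by rw [← r2 z hz, hΦ]⟩

/-- The difference of the connections is determined by its symmetries. -/
lemma unique (hd : ∀ u, (∀ v, deform g I J K X f h u v = 0) → u = 0) {S' : V → V → V}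
    (metric : ∀ u v w, deform g I J K X f h (S' u v) w + deform g I J K X f h v (S' u w) =
      nablaDeform g I J K X h (fun u => L u - (1 / 2 : ℝ) • I u) df dh u v w)
    (torsion : ∀ u v, S' u v - S' v u = (F u v / a) • X) (u v : V) : S u v = S' u v := by
  have sub : ∀ x y z, deform g I J K X f h (x - y) z =
      deform g I J K X f h x z - deform g I J K X f h y z := fun x y z => by
    simp only [deform, galpha, map_sub, sub_apply]; ring
  have symm : ∀ x y, deform g I J K X f h x y = deform g I J K X f h y x := fun x y => by
    simp only [deform, galpha, t.quat.symm x y]; ring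
  rw [← sub_eq_zero]
  refine eq_zero_of_symm_of_skew (T := fun u v => S u v - S' u v) symm hd
    (fun u v => ?_) (fun u v w => ?_) u v
  · have := t.torsion u v
    rw [← torsion u v, ← sub_eq_zero] at this
    rw [← sub_eq_zero, ← this]; abel
  · rw [symm v, sub, sub, symm _ v, symm _ v]
    linarith [t.metric u v w, metric u v w]

/-- For a constant multiple of the hyperKähler metric and a flat twist, the connections agree. -/
lemma eq_zero_of_trivial (hd : ∀ u, (∀ v, deform g I J K X f h u v = 0) → u = 0)
    (hh : h = 0) (hdf : ∀ u, df u = 0) (hdh : ∀ u, dh u = 0) (hF : ∀ u v, F u v = 0) (u v : V) :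
    S u v = 0 :=
  t.unique hd (S' := fun _ _ => 0)
    (fun u v w => by simp [deform, galpha, nablaDeform, hdf, hdh, hh])
    (fun u v => by simp [hF]) u v

-- Here ν stands for μ - c and l for the scale of the metric. The jet equations have only one
-- solution, so it suffices to exhibit one and compute its commutators with I, J, K.
set_option maxHeartbeats 1000000 in
lemma normalizes (hd : ∀ u, (∀ v, deform g I J K X f h u v = 0) → u = 0) {l k ν : ℝ}
    (hν : ν ≠ 0) (hk : k ≠ 0) (hnν : g X X - ν ≠ 0)
    (hf : f = -(l / ν)) (hh : h = l / ν ^ 2) (hdf : ∀ u, df u = l / ν ^ 2 * g (I X) u)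
    (hdh : ∀ u, dh u = -(2 * l / ν ^ 3) * g (I X) u) (hF : ∀ u v, F u v = 2 * k * g (L u) v)
    (ha : a = k * (g X X - ν)) (u : V) (T : V →L[ℝ] V) (hT : T ∈ Submodule.span ℝ {I, J, K}) :
    (S u).comp T - T.comp (S u) ∈ Submodule.span ℝ {I, J, K} := by
  have q := t.quat
  -- The first bracket is symmetric in u and v; the skew part of the second is g(Lu, v) X, which is
  -- the torsion because F/a = 2 g(L·, ·)/(g(X, X) - ν). As endomorphisms in v, all terms commute
  -- with I, J, K except (1/(2ν)) (α₀(u) I + α_K(u) J - α_J(u) K).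
  have hS : ∀ u v, S u v = -(1 / (2 * ν)) • (g (I X) u • v + g (I X) v • u - g X v • I u - g X u • I v
      + g (J X) v • K u + g (J X) u • K v - g (K X) v • J u - g (K X) u • J v)
      + (1 / (g X X - ν)) • (g (L u) v • X + g (I (L u)) v • I X + g (J (L u)) v • J X
      + g (K (L u)) v • K X) := by
    refine t.unique hd (fun u v w => ?_) (fun u v => ?_)
    · simp only [deform, galpha, nablaDeform, hdf, hdh]
      simp only [map_add, map_sub, map_smul, map_neg, add_apply, sub_apply, smul_apply, smul_eq_mul,
        neg_apply, q.II, q.JJ, q.KK, q.IJ, q.JI, q.IK, q.KI, q.JK, q.KJ, q.gI, q.gJ, q.gK]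
      simp only [q.symm w v, q.I_skew w v, q.J_skew w v, q.K_skew w v, q.symm v u, q.I_skew v u,
        q.J_skew v u, q.K_skew v u, q.symm w u, q.I_skew w u,
        q.J_skew w u, q.K_skew w u, q.symm v X, q.I_skew v X, q.J_skew v X, q.K_skew v X, 
        q.symm u X, q.I_skew u X, q.J_skew u X, q.K_skew u X, q.symm w X, q.I_skew w X, q.J_skew w X,
        q.K_skew w X, q.I_self X, q.J_self X, q.K_self X]
      rw [hf, hh]
      obtain ⟨b, hb⟩ : ∃ b : V → V → ℝ, ∀ x y, g x y = b x y := ⟨_, fun _ _ => rfl⟩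
      obtain ⟨i, hi⟩ : ∃ i : V → V, ∀ x, I x = i x := ⟨_, fun _ => rfl⟩
      obtain ⟨j, hj⟩ : ∃ j : V → V, ∀ x, J x = j x := ⟨_, fun _ => rfl⟩
      obtain ⟨k, hk⟩ : ∃ k : V → V, ∀ x, K x = k x := ⟨_, fun _ => rfl⟩
      obtain ⟨l, hl⟩ : ∃ l : V → V, ∀ x, L x = l x := ⟨_, fun _ => rfl⟩
      simp only [hb, hi, hj, hk, hl] at hnν ⊢
      field_simp
      ring
    · rw [hF, ha, t.skew v u, t.skew_I v u, t.skew_J v u, t.skew_K v u,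
        show 2 * k * g (L u) v / (k * (g X X - ν)) = 2 * g (L u) v * (1 / (g X X - ν)) by
          field_simp]
      module
  -- The coefficients supplied below are those of the commutators of (1/(2ν)) (α₀(u) I + α_K(u) J -
  -- α_J(u) K) with I, J, K.
  have key : ∀ T ∈ ({I, J, K} : Set (V →L[ℝ] V)),
      (S u).comp T - T.comp (S u) ∈ Submodule.span ℝ {I, J, K} := by
    rintro T (hT | hT | hT) <;> rw [hT]
    · refine mem_span_triple_iff.mpr ⟨0, -(1 / ν) * g (J X) u, -(1 / ν) * g (K X) u, ?_⟩
      ext v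
      simp only [ContinuousLinearMap.comp_apply, add_apply, sub_apply, smul_apply, hS, map_add,
        map_sub, map_smul, map_neg, neg_apply, q.II, q.JJ, q.KK, q.IJ, q.JI, q.IK, q.KI, q.JK,
        q.KJ, q.gI, q.gJ, q.gK, zero_smul, zero_apply]
      module
    · refine mem_span_triple_iff.mpr ⟨1 / ν * g (J X) u, 0, 1 / ν * g X u, ?_⟩
      ext v
      simp only [ContinuousLinearMap.comp_apply, add_apply, sub_apply, smul_apply, hS, map_add,
        map_sub, map_smul, map_neg, neg_apply, q.II, q.JJ, q.KK, q.IJ, q.JI, q.IK, q.KI, q.JK,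
        q.KJ, q.gI, q.gJ, q.gK, zero_smul, zero_apply]
      module
    · refine mem_span_triple_iff.mpr ⟨1 / ν * g (K X) u, -(1 / ν) * g X u, 0, ?_⟩
      ext v
      simp only [ContinuousLinearMap.comp_apply, add_apply, sub_apply, smul_apply, hS, map_add,
        map_sub, map_smul, map_neg, neg_apply, q.II, q.JJ, q.KK, q.IJ, q.JI, q.IK, q.KI, q.JK,
        q.KJ, q.gI, q.gJ, q.gK, zero_smul, zero_apply]
      module
  induction hT using Submodule.span_induction with
  | mem T hT => exact key T hT
  | zero => simp
  | add T T' _ _ h1 h2 =>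
    rw [ContinuousLinearMap.comp_add, ContinuousLinearMap.add_comp, add_sub_add_comm]
    exact add_mem h1 h2
  | smul c T _ h1 =>
    rw [ContinuousLinearMap.comp_smul, ContinuousLinearMap.smul_comp, ← smul_sub]
    exact Submodule.smul_mem _ c h1

end TwistJet
end LinearAlgebra

section LinearAlgebra

variable {V : Type*} [NormedAddCommGroup V] [NormedSpace ℝ V]

/-! ## Sections of a parallel bundle of quaternions -/

section FiniteDimensional

variable [FiniteDimensional ℝ V]

/-- The trace on continuous endomorphisms of a finite-dimensional space. -/
def clmTrace (V : Type*) [NormedAddCommGroup V] [NormedSpace ℝ V] [FiniteDimensional ℝ V] :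
    (V →L[ℝ] V) →L[ℝ] ℝ :=
  LinearMap.toContinuousLinearMap
    ((LinearMap.trace ℝ V).comp (ContinuousLinearMap.coeLM ℝ : (V →L[ℝ] V) →ₗ[ℝ] V →ₗ[ℝ] V))

lemma clmTrace_comp_comm (A B : V →L[ℝ] V) : clmTrace V (A.comp B) = clmTrace V (B.comp A) :=
  LinearMap.trace_mul_comm ℝ (A : V →ₗ[ℝ] V) (B : V →ₗ[ℝ] V)

lemma clmTrace_id : clmTrace V (ContinuousLinearMap.id ℝ V) = Module.finrank ℝ V :=
  LinearMap.trace_id ℝ V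

namespace QuatHerm

variable {g : V →L[ℝ] V →L[ℝ] ℝ} {I J K : V →L[ℝ] V} (q : QuatHerm g I J K)
include q

lemma clmTrace_comp_self : clmTrace V (I.comp I) = -Module.finrank ℝ V := by
  rw [← clmTrace_id, ← map_neg]
  congr 1
  ext v
  simp [q.II]

lemma clmTrace_comp_other : clmTrace V (I.comp J) = 0 ∧ clmTrace V (J.comp I) = 0 := by
  have h1 : clmTrace V (J.comp I) = -clmTrace V (I.comp J) := by
    rw [← map_neg]
    congr 1
    ext v
    simp [q.IJ, q.JI]
  have h2 := clmTrace_comp_comm I J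
  constructor <;> linarith

/-- I, J, K are orthogonal for the trace form, each with square -dim V. Coefficients expressed by
traces depend differentiably on R, which is what makes it possible to differentiate a section of the
span. -/
lemma eq_of_mem_span [Nontrivial V] {R : V →L[ℝ] V} (hR : R ∈ Submodule.span ℝ {I, J, K}) :
    R = (-(clmTrace V (R.comp I) / Module.finrank ℝ V)) • I
      + (-(clmTrace V (R.comp J) / Module.finrank ℝ V)) • J
      + (-(clmTrace V (R.comp K) / Module.finrank ℝ V)) • K := by
  obtain ⟨r, s, t, rfl⟩ := mem_span_triple_iff.mp hR
  have hm : (Module.finrank ℝ V : ℝ) ≠ 0 := Nat.cast_ne_zero.mpr Module.finrank_pos.ne'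
  simp only [ContinuousLinearMap.add_comp, ContinuousLinearMap.smul_comp, map_add, map_smul,
    q.clmTrace_comp_self, q.rotate.clmTrace_comp_self, q.rotate.rotate.clmTrace_comp_self,
    q.clmTrace_comp_other.1, q.clmTrace_comp_other.2, q.rotate.clmTrace_comp_other.1,
    q.rotate.clmTrace_comp_other.2, q.rotate.rotate.clmTrace_comp_other.1,
    q.rotate.rotate.clmTrace_comp_other.2, smul_eq_mul]
  congr 2
  · congr 1; field_simp; ring
  · congr 1; field_simp; ring
  · field_simp; ring

end QuatHerm

/-- Covariant derivatives of sections of a bundle conjugate to a parallel bundle of quaternions: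
modulo the bundle they are given by the difference tensor of the connections. -/
lemma fderiv_add_commutator_sub_mem [Nontrivial V] {g : V → V →L[ℝ] V →L[ℝ] ℝ}
    {I J K E T : V → V →L[ℝ] V} {v₀ : V}
    (quat : ∀ᶠ v in nhds v₀, QuatHerm (g v) (I v) (J v) (K v))
    (hI : DifferentiableAt ℝ I v₀) (hJ : DifferentiableAt ℝ J v₀) (hK : DifferentiableAt ℝ K v₀)
    (hE : DifferentiableAt ℝ E v₀) (hT : DifferentiableAt ℝ T v₀)
    (hE₀ : E v₀ = ContinuousLinearMap.id ℝ V) {Γ : V → V →L[ℝ] V}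
    (dI : ∀ u, fderiv ℝ I v₀ u = (I v₀).comp (Γ u) - (Γ u).comp (I v₀))
    (dJ : ∀ u, fderiv ℝ J v₀ u = (J v₀).comp (Γ u) - (Γ u).comp (J v₀))
    (dK : ∀ u, fderiv ℝ K v₀ u = (K v₀).comp (Γ u) - (Γ u).comp (K v₀))
    (mem : ∀ᶠ v in nhds v₀, ∃ R ∈ Submodule.span ℝ {I v, J v, K v},
      (E v).comp (T v) = R.comp (E v))
    (Γ' : V → V →L[ℝ] V) (u : V) :
    fderiv ℝ T v₀ u + ((Γ' u).comp (T v₀) - (T v₀).comp (Γ' u))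
      - ((Γ' u - fderiv ℝ E v₀ u - Γ u).comp (T v₀) - (T v₀).comp (Γ' u - fderiv ℝ E v₀ u - Γ u))
      ∈ Submodule.span ℝ {I v₀, J v₀, K v₀} := by
  have hu : IsUnit (E v₀) := by rw [hE₀]; exact isUnit_one
  -- Conjugation by E turns T into a section of ⟨I, J, K⟩. Inversion in the ring of endomorphisms is
  -- differentiable at units, and E is a unit near v₀.
  let R : V → V →L[ℝ] V := fun v => ((E v).comp (T v)).comp (Ring.inverse (E v))
  have hR : DifferentiableAt ℝ R v₀ := by
    have hinv : DifferentiableAt ℝ (fun v => Ring.inverse (E v)) v₀ :=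
      DifferentiableAt.comp v₀ (g := Ring.inverse) (differentiableAt_inverse hu) hE
    exact (hE.clm_comp hT).clm_comp hinv
  have hRE : ∀ᶠ v in nhds v₀, R v ∈ Submodule.span ℝ {I v, J v, K v} ∧
      (E v).comp (T v) = (R v).comp (E v) := by
    have hunit : ∀ᶠ v in nhds v₀, IsUnit (E v) :=
      hE.continuousAt.eventually_mem (Units.isOpen.mem_nhds hu)
    filter_upwards [mem, hunit] with v ⟨R', hR', h⟩ hv
    have h1 : R v = R' := by
      change E v * T v * Ring.inverse (E v) = R'
      rw [show E v * T v = R' * E v from h, mul_assoc, Ring.mul_inverse_cancel _ hv, mul_one]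
    rw [h1]
    exact ⟨hR', h⟩
  let c : (V → V →L[ℝ] V) → V → ℝ := fun A v =>
    -(clmTrace V ((R v).comp (A v)) / Module.finrank ℝ V)
  have hc : ∀ A, DifferentiableAt ℝ A v₀ → DifferentiableAt ℝ (c A) v₀ := fun A hA => by
    have h : DifferentiableAt ℝ (fun v => clmTrace V ((R v).comp (A v))) v₀ :=
      (clmTrace V).differentiableAt.comp v₀ (hR.clm_comp hA)
    simpa only [c, div_eq_mul_inv] using (h.mul_const _).fun_neg
  have hsum : R =ᶠ[nhds v₀] fun v => c I v • I v + c J v • J v + c K v • K v := by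
    filter_upwards [quat, hRE] with v q hv using q.eq_of_mem_span hv.1
  have hprod : (fun v => (E v).comp (T v)) =ᶠ[nhds v₀] fun v => (R v).comp (E v) := by
    filter_upwards [hRE] with v hv using hv.2
  have dR : fderiv ℝ R v₀ u = c I v₀ • fderiv ℝ I v₀ u + c J v₀ • fderiv ℝ J v₀ u
      + c K v₀ • fderiv ℝ K v₀ u + (fderiv ℝ (c I) v₀ u • I v₀ + fderiv ℝ (c J) v₀ u • J v₀
      + fderiv ℝ (c K) v₀ u • K v₀) := by
    have hs := ((((hc I hI).hasFDerivAt.smul hI.hasFDerivAt).add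
      ((hc J hJ).hasFDerivAt.smul hJ.hasFDerivAt)).add
      ((hc K hK).hasFDerivAt.smul hK.hasFDerivAt)).congr_of_eventuallyEq hsum
    rw [hs.fderiv]
    simp only [add_apply, smul_apply, ContinuousLinearMap.smulRight_apply]
    abel
  -- The product rule for E T = R E, at the point where E is the identity.
  have dET : (fderiv ℝ E v₀ u).comp (T v₀) + fderiv ℝ T v₀ u
      = fderiv ℝ R v₀ u + (R v₀).comp (fderiv ℝ E v₀ u) := by
    have h1 := hprod.fderiv_eq (𝕜 := ℝ)
    rw [(hE.hasFDerivAt.clm_comp hT.hasFDerivAt).fderiv,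
      (hR.hasFDerivAt.clm_comp hE.hasFDerivAt).fderiv] at h1
    have h2 := congrArg (fun A : V →L[ℝ] V →L[ℝ] V => A u) h1
    simp only [add_apply, ContinuousLinearMap.comp_apply, ContinuousLinearMap.compL_apply,
      ContinuousLinearMap.flip_apply, hE₀, ContinuousLinearMap.comp_id,
      ContinuousLinearMap.id_comp] at h2
    rw [add_comm, h2, add_comm]
  have hRT : R v₀ = T v₀ := by
    have := hRE.self_of_nhds.2
    rw [hE₀, ContinuousLinearMap.id_comp, ContinuousLinearMap.comp_id] at this
    exact this.symm
  have hT₀ : T v₀ = c I v₀ • I v₀ + c J v₀ • J v₀ + c K v₀ • K v₀ := by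
    rw [← hRT]; exact hsum.self_of_nhds
  refine mem_span_triple_iff.mpr
    ⟨fderiv ℝ (c I) v₀ u, fderiv ℝ (c J) v₀ u, fderiv ℝ (c K) v₀ u, ?_⟩
  -- The derivatives [I, Γ], [J, Γ], [K, Γ] add up to [T, Γ] and cancel against the Γ in the
  -- difference tensor, `Γ'` cancels identically, and only the derivatives of the coefficients
  -- remain.
  rw [dR, dI, dJ, dK, hRT] at dET
  rw [← sub_eq_zero] at dET ⊢
  rw [← dET]
  simp only [ContinuousLinearMap.sub_comp, ContinuousLinearMap.comp_sub]
  rw [show (Γ u).comp (T v₀) = c I v₀ • (Γ u).comp (I v₀) + c J v₀ • (Γ u).comp (J v₀)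
      + c K v₀ • (Γ u).comp (K v₀) by
        rw [hT₀]; simp only [ContinuousLinearMap.comp_add, ContinuousLinearMap.comp_smul],
    show (T v₀).comp (Γ u) = c I v₀ • (I v₀).comp (Γ u) + c J v₀ • (J v₀).comp (Γ u)
      + c K v₀ • (K v₀).comp (Γ u) by
        rw [hT₀]; simp only [ContinuousLinearMap.add_comp, ContinuousLinearMap.smul_comp]]
  module

end FiniteDimensional
end LinearAlgebra

/-! ## Tensors in local parametrizations -/

section Param

variable {m n : ℕ} {N : Type*} [TopologicalSpace N] [ChartedSpace (EuclideanSpace ℝ (Fin m)) N]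

/-- The derivative of a map from a Euclidean space to a manifold, as a map of Euclidean spaces. -/
def pder (κ : EuclideanSpace ℝ (Fin n) → N) (v : EuclideanSpace ℝ (Fin n)) :
    EuclideanSpace ℝ (Fin n) →L[ℝ] EuclideanSpace ℝ (Fin m) :=
  mfderiv (𝓡 n) (𝓡 m) κ v

/-- The pullback of a field of linear forms. -/
def pullCov (κ : EuclideanSpace ℝ (Fin n) → N) (α : CovectorField m N)
    (v : EuclideanSpace ℝ (Fin n)) : EuclideanSpace ℝ (Fin n) →L[ℝ] ℝ :=
  ContinuousLinearMap.comp (M₂ := EuclideanSpace ℝ (Fin m)) (α (κ v)) (pder κ v)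

/-- The pullback of a field of bilinear forms. -/
def pullBilin (κ : EuclideanSpace ℝ (Fin n) → N) (b : BilinField m N)
    (v : EuclideanSpace ℝ (Fin n)) :
    EuclideanSpace ℝ (Fin n) →L[ℝ] EuclideanSpace ℝ (Fin n) →L[ℝ] ℝ :=
  ContinuousLinearMap.bilinearComp (E := EuclideanSpace ℝ (Fin m))
    (F := EuclideanSpace ℝ (Fin m)) (b (κ v)) (pder κ v) (pder κ v)

/-- The pullback of a vector field by a local diffeomorphism. -/
def pullVec (κ : EuclideanSpace ℝ (Fin m) → N) (A : VectorField m N)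
    (v : EuclideanSpace ℝ (Fin m)) : EuclideanSpace ℝ (Fin m) :=
  (pder κ v).inverse (A (κ v))

/-- The pullback of a field of endomorphisms by a local diffeomorphism. -/
def pullEnd (κ : EuclideanSpace ℝ (Fin m) → N) (T : EndField m N)
    (v : EuclideanSpace ℝ (Fin m)) : EuclideanSpace ℝ (Fin m) →L[ℝ] EuclideanSpace ℝ (Fin m) :=
  (pder κ v).inverse.comp
    (ContinuousLinearMap.comp (M₂ := EuclideanSpace ℝ (Fin m)) (T (κ v)) (pder κ v))

/-- `κ` is a smooth map with invertible derivative on the open set `U`. -/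
structure IsParam (κ : EuclideanSpace ℝ (Fin m) → N) (U : Set (EuclideanSpace ℝ (Fin m))) :
    Prop where
  isOpen : IsOpen U
  contMDiff : ContMDiffOn (𝓡 m) (𝓡 m) ∞ κ U
  invertible : ∀ v ∈ U, (pder (m := m) κ v).IsInvertible

lemma pullBilin_apply (κ : EuclideanSpace ℝ (Fin n) → N) (b : BilinField m N)
    (v u w : EuclideanSpace ℝ (Fin n)) :
    pullBilin κ b v u w = b (κ v) (pder κ v u) (pder κ v w) := rfl

lemma dirDeriv_comp {κ : EuclideanSpace ℝ (Fin n) → N} {v : EuclideanSpace ℝ (Fin n)} {φ : N → ℝ}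
    (hκ : MDifferentiableAt (𝓡 n) (𝓡 m) κ v) (hφ : MDifferentiableAt (𝓡 m) 𝓘(ℝ, ℝ) φ (κ v))
    (u : EuclideanSpace ℝ (Fin n)) :
    dirDeriv φ (κ v) (pder (m := m) κ v u) = fderiv ℝ (fun v => φ (κ v)) v u := by
  have h := mfderiv_comp (I := 𝓡 n) (I' := 𝓡 m) (I'' := 𝓘(ℝ, ℝ)) v hφ hκ
  have h2 := congrArg (fun l => l u) h
  rw [mfderiv_eq_fderiv] at h2
  exact h2.symm

variable [IsManifold (𝓡 m) ∞ N]

lemma contMDiffOn_pder {κ : EuclideanSpace ℝ (Fin n) → N} {U : Set (EuclideanSpace ℝ (Fin n))}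
    (hU : IsOpen U) (hκ : ContMDiffOn (𝓡 n) (𝓡 m) ∞ κ U) {s : EuclideanSpace ℝ (Fin n) →
      EuclideanSpace ℝ (Fin n)} (hs : ContDiffOn ℝ ∞ s U) :
    ContMDiffOn (𝓡 n) (𝓡 m).tangent ∞ (fun v => TotalSpace.mk' (EuclideanSpace ℝ (Fin m))
      (E := fun y : N => TangentSpace (𝓡 m) y) (κ v) (pder (m := m) κ v (s v))) U := by
  intro v hv
  have h1 : ContMDiffAt (𝓡 n) (𝓡 m) ∞ κ v := (hκ v hv).contMDiffAt (hU.mem_nhds hv)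
  have h2 := h1.mfderiv_const (m := ∞) (by simp)
  refine (ContMDiffAt.clm_apply_of_inCoordinates (IB₁ := 𝓡 n) (IB₂ := 𝓡 m) (b₁ := id) (b₂ := κ)
    (E₁ := fun y : EuclideanSpace ℝ (Fin n) => TangentSpace (𝓡 n) y)
    (E₂ := fun y : N => TangentSpace (𝓡 m) y) (ϕ := fun v => mfderiv (𝓡 n) (𝓡 m) κ v) (v := s)
    h2 ?_ h1).contMDiffWithinAt
  exact contMDiffAt_vectorSpace_iff_contDiffAt.mpr ((hs v hv).contDiffAt (hU.mem_nhds hv))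

lemma contDiffOn_bilin_apply {κ : EuclideanSpace ℝ (Fin n) → N} {b : BilinField m N}
    (hb : SmoothBilin b) {U : Set (EuclideanSpace ℝ (Fin n))}
    (hκ : ContMDiffOn (𝓡 n) (𝓡 m) ∞ κ U) {s t : (v : EuclideanSpace ℝ (Fin n)) →
      TangentSpace (𝓡 m) (κ v)}
    (hs : ContMDiffOn (𝓡 n) (𝓡 m).tangent ∞ (fun v => TotalSpace.mk' (EuclideanSpace ℝ (Fin m))
      (E := fun y : N => TangentSpace (𝓡 m) y) (κ v) (s v)) U)
    (ht : ContMDiffOn (𝓡 n) (𝓡 m).tangent ∞ (fun v => TotalSpace.mk' (EuclideanSpace ℝ (Fin m))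
      (E := fun y : N => TangentSpace (𝓡 m) y) (κ v) (t v)) U) :
    ContDiffOn ℝ ∞ (fun v => b (κ v) (s v) (t v)) U := by
  intro v hv
  have : ContMDiffWithinAt (𝓡 n) ((𝓡 m).prod 𝓘(ℝ, ℝ)) ∞
      (fun v => TotalSpace.mk' ℝ (E := Bundle.Trivial N ℝ) (κ v) (b (κ v) (s v) (t v))) U v := by
    apply ContMDiffWithinAt.clm_bundle_apply₂ (F₁ := EuclideanSpace ℝ (Fin m))
      (F₂ := EuclideanSpace ℝ (Fin m)) (E₁ := fun y : N => TangentSpace (𝓡 m) y)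
      (E₂ := fun y : N => TangentSpace (𝓡 m) y)
    · exact ContMDiffAt.comp_contMDiffWithinAt v hb.contMDiffAt (hκ v hv)
    · exact hs v hv
    · exact ht v hv
  simp only [contMDiffWithinAt_totalSpace] at this
  exact this.2.contDiffWithinAt

lemma contDiffOn_pullBilin {κ : EuclideanSpace ℝ (Fin n) → N} {b : BilinField m N}
    (hb : SmoothBilin b) {U : Set (EuclideanSpace ℝ (Fin n))} (hU : IsOpen U)
    (hκ : ContMDiffOn (𝓡 n) (𝓡 m) ∞ κ U) : ContDiffOn ℝ ∞ (pullBilin κ b) U :=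
  contDiffOn_clm_apply.mpr fun u => contDiffOn_clm_apply.mpr fun w =>
    contDiffOn_bilin_apply hb hκ (contMDiffOn_pder hU hκ (contDiffOn_const (c := u)))
      (contMDiffOn_pder hU hκ (contDiffOn_const (c := w)))

lemma contDiffOn_pullCov {κ : EuclideanSpace ℝ (Fin n) → N} {α : CovectorField m N}
    (hα : SmoothCovector α) {U : Set (EuclideanSpace ℝ (Fin n))} (hU : IsOpen U)
    (hκ : ContMDiffOn (𝓡 n) (𝓡 m) ∞ κ U) : ContDiffOn ℝ ∞ (pullCov κ α) U := by
  refine contDiffOn_clm_apply.mpr fun u v hv => ?_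
  have : ContMDiffWithinAt (𝓡 n) ((𝓡 m).prod 𝓘(ℝ, ℝ)) ∞
      (fun v => TotalSpace.mk' ℝ (E := Bundle.Trivial N ℝ) (κ v) (α (κ v) (pder (m := m) κ v u))) U v := by
    apply ContMDiffWithinAt.clm_bundle_apply (F₁ := EuclideanSpace ℝ (Fin m))
      (E₁ := fun y : N => TangentSpace (𝓡 m) y)
    · exact ContMDiffAt.comp_contMDiffWithinAt v hα.contMDiffAt (hκ v hv)
    · exact contMDiffOn_pder hU hκ (contDiffOn_const (c := u)) v hv
  simp only [contMDiffWithinAt_totalSpace] at this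
  exact this.2.contDiffWithinAt

lemma contDiffOn_pullBilin_fundForm {κ : EuclideanSpace ℝ (Fin n) → N} {b : BilinField m N}
    (hb : SmoothBilin b) {T : EndField m N} {U₁ : Set N} (hT : SmoothEndOn T U₁)
    {U : Set (EuclideanSpace ℝ (Fin n))} (hU : IsOpen U)
    (hκ : ContMDiffOn (𝓡 n) (𝓡 m) ∞ κ U) (hU₁ : Set.MapsTo κ U U₁) :
    ContDiffOn ℝ ∞ (pullBilin κ (fundForm b T)) U := by
  refine contDiffOn_clm_apply.mpr fun u => contDiffOn_clm_apply.mpr fun w =>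
    contDiffOn_bilin_apply hb hκ (s := fun v => T (κ v) (pder (m := m) κ v u)) ?_
      (contMDiffOn_pder hU hκ (contDiffOn_const (c := w)))
  exact ContMDiffOn.clm_bundle_apply (F₁ := EuclideanSpace ℝ (Fin m))
    (E₁ := fun y : N => TangentSpace (𝓡 m) y) (F₂ := EuclideanSpace ℝ (Fin m))
    (E₂ := fun y : N => TangentSpace (𝓡 m) y) (ϕ := fun v => T (κ v)) (hT.comp hκ hU₁)
    (contMDiffOn_pder hU hκ (contDiffOn_const (c := u)))

end Param

section Calculus

variable {V : Type*} [NormedAddCommGroup V] [NormedSpace ℝ V] {v : V}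

lemma fderiv_cov_apply {α : V → V →L[ℝ] ℝ} {A : V → V} (hα : DifferentiableAt ℝ α v)
    (hA : DifferentiableAt ℝ A v) (u : V) :
    fderiv ℝ (fun v => α v (A v)) v u = fderiv ℝ α v u (A v) + α v (fderiv ℝ A v u) := by
  rw [(hα.hasFDerivAt.clm_apply hA.hasFDerivAt).fderiv]
  simp [add_comm]

lemma fderiv_bilin_apply {b : V → V →L[ℝ] V →L[ℝ] ℝ} {A B : V → V} (hb : DifferentiableAt ℝ b v)
    (hA : DifferentiableAt ℝ A v) (hB : DifferentiableAt ℝ B v) (u : V) :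
    fderiv ℝ (fun v => b v (A v) (B v)) v u = fderiv ℝ b v u (A v) (B v)
      + b v (fderiv ℝ A v u) (B v) + b v (A v) (fderiv ℝ B v u) := by
  rw [((hb.hasFDerivAt.clm_apply hA.hasFDerivAt).clm_apply hB.hasFDerivAt).fderiv]
  simp
  ring

lemma fderiv_end_apply {T : V → V →L[ℝ] V} {A : V → V} (hT : DifferentiableAt ℝ T v)
    (hA : DifferentiableAt ℝ A v) (u : V) :
    fderiv ℝ (fun v => T v (A v)) v u = fderiv ℝ T v u (A v) + T v (fderiv ℝ A v u) := by
  rw [(hT.hasFDerivAt.clm_apply hA.hasFDerivAt).fderiv]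
  simp [add_comm]

end Calculus

lemma two_le_infty : (2 : WithTop ℕ∞) ≤ ∞ := WithTop.coe_le_coe.mpr (le_top : (2 : ℕ∞) ≤ ⊤)

lemma three_le_infty : (3 : WithTop ℕ∞) ≤ ∞ := WithTop.coe_le_coe.mpr (le_top : (3 : ℕ∞) ≤ ⊤)

lemma DiffAt.end_apply {m : ℕ} {N : Type*} [TopologicalSpace N]
    [ChartedSpace (EuclideanSpace ℝ (Fin m)) N] [IsManifold (𝓡 m) ∞ N] {T : EndField m N}
    (hT : SmoothEndOn T Set.univ) {A : VectorField m N} {x : N} (hA : DiffAt A x) :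
    DiffAt (fun y => T y (A y)) x :=
  MDifferentiableAt.clm_bundle_apply (F₁ := EuclideanSpace ℝ (Fin m))
    (F₂ := EuclideanSpace ℝ (Fin m)) (b := id)
    (E₁ := fun y : N => TangentSpace (𝓡 m) y) (E₂ := fun y : N => TangentSpace (𝓡 m) y)
    ((contMDiffOn_univ.mp hT).mdifferentiable (by simp) _) hA

/-- The linear forms `α` have differentiable values on differentiable vector fields. -/
def CovDiffAt {m : ℕ} {N : Type*} [TopologicalSpace N]
    [ChartedSpace (EuclideanSpace ℝ (Fin m)) N] [IsManifold (𝓡 m) ∞ N] (α : CovectorField m N)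
    (x : N) : Prop :=
  ∀ A : VectorField m N, DiffAt A x → MDifferentiableAt (𝓡 m) 𝓘(ℝ, ℝ) (fun y => α y (A y)) x

/-- The bilinear forms `b` have differentiable values on differentiable vector fields. -/
def BilinDiffAt {m : ℕ} {N : Type*} [TopologicalSpace N]
    [ChartedSpace (EuclideanSpace ℝ (Fin m)) N] [IsManifold (𝓡 m) ∞ N] (b : BilinField m N)
    (x : N) : Prop :=
  ∀ A B : VectorField m N, DiffAt A x → DiffAt B x →
    MDifferentiableAt (𝓡 m) 𝓘(ℝ, ℝ) (fun y => b y (A y) (B y)) x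

lemma SmoothCovector.covDiffAt {m : ℕ} {N : Type*} [TopologicalSpace N]
    [ChartedSpace (EuclideanSpace ℝ (Fin m)) N] [IsManifold (𝓡 m) ∞ N] {α : CovectorField m N}
    (hα : SmoothCovector α) (x : N) : CovDiffAt α x := fun A hA => by
  have h : MDifferentiableAt (𝓡 m) ((𝓡 m).prod 𝓘(ℝ, ℝ))
      (fun y => TotalSpace.mk' ℝ (E := Bundle.Trivial N ℝ) y (α y (A y))) x :=
    MDifferentiableAt.clm_bundle_apply (F₁ := EuclideanSpace ℝ (Fin m)) (F₂ := ℝ) (b := id)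
      (E₁ := fun y : N => TangentSpace (𝓡 m) y) (E₂ := Bundle.Trivial N ℝ)
      (hα.mdifferentiable (by simp) _) hA
  rw [mdifferentiableAt_totalSpace] at h
  exact h.2

lemma SmoothBilin.bilinDiffAt {m : ℕ} {N : Type*} [TopologicalSpace N]
    [ChartedSpace (EuclideanSpace ℝ (Fin m)) N] [IsManifold (𝓡 m) ∞ N] {b : BilinField m N}
    (hb : SmoothBilin b) (x : N) : BilinDiffAt b x := fun A B hA hB => by
  have h : MDifferentiableAt (𝓡 m) ((𝓡 m).prod 𝓘(ℝ, ℝ))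
      (fun y => TotalSpace.mk' ℝ (E := Bundle.Trivial N ℝ) y (b y (A y) (B y))) x :=
    MDifferentiableAt.clm_bundle_apply₂ (F₁ := EuclideanSpace ℝ (Fin m))
      (F₂ := EuclideanSpace ℝ (Fin m)) (F₃ := ℝ) (b := id)
      (E₁ := fun y : N => TangentSpace (𝓡 m) y) (E₂ := fun y : N => TangentSpace (𝓡 m) y)
      (E₃ := Bundle.Trivial N ℝ) (hb.mdifferentiable (by simp) _) hA hB
  rw [mdifferentiableAt_totalSpace] at h
  exact h.2

/-! ### Cartan calculus in a parametrization -/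

namespace IsParam

variable {m : ℕ} {N : Type*} [TopologicalSpace N] [ChartedSpace (EuclideanSpace ℝ (Fin m)) N]
  {κ : EuclideanSpace ℝ (Fin m) → N} {U : Set (EuclideanSpace ℝ (Fin m))} (c : IsParam κ U)
  {v : EuclideanSpace ℝ (Fin m)} (hv : v ∈ U)
include c hv

lemma pder_pullVec (A : VectorField m N) : pder κ v (pullVec κ A v) = A (κ v) :=
  (c.invertible v hv).self_apply_inverse _

lemma cov_eq (α : CovectorField m N) (A : VectorField m N) :
    α (κ v) (A (κ v)) = pullCov κ α v (pullVec κ A v) :=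
  (congrArg (α (κ v)) (c.pder_pullVec hv A)).symm

lemma bilin_eq (b : BilinField m N) (A B : VectorField m N) :
    b (κ v) (A (κ v)) (B (κ v)) = pullBilin κ b v (pullVec κ A v) (pullVec κ B v) :=
  (congrArg₂ (fun x y => b (κ v) x y) (c.pder_pullVec hv A) (c.pder_pullVec hv B)).symm

lemma pullEnd_pullVec (T : EndField m N) (A : VectorField m N) :
    pullEnd κ T v (pullVec κ A v) = pullVec κ (fun y => T y (A y)) v := by
  change (pder κ v).inverse (T (κ v) (pder κ v (pullVec κ A v))) = _
  rw [c.pder_pullVec hv]; rfl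

lemma pder_pullEnd (T : EndField m N) (u : EuclideanSpace ℝ (Fin m)) :
    pder κ v (pullEnd κ T v u) = T (κ v) (pder κ v u) :=
  (c.invertible v hv).self_apply_inverse _

lemma contMDiffAt : ContMDiffAt (𝓡 m) (𝓡 m) ∞ κ v :=
  (c.contMDiff v hv).contMDiffAt (c.isOpen.mem_nhds hv)

lemma mdifferentiableAt : MDifferentiableAt (𝓡 m) (𝓡 m) κ v :=
  (c.contMDiffAt hv).mdifferentiableAt (by simp)

variable [IsManifold (𝓡 m) ∞ N]

lemma differentiableAt_pullVec {A : VectorField m N} (hA : DiffAt A (κ v)) :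
    DifferentiableAt ℝ (pullVec κ A) v := by
  have : IsManifold (𝓡 m) 1 N := IsManifold.of_le (n := ∞) (by simp)
  have : IsManifold (𝓡 m) 2 N := IsManifold.of_le (n := ∞) two_le_infty
  have h := MDifferentiableAt.mpullback_vectorField (I := 𝓡 m) (I' := 𝓡 m) (n := ∞) hA
    (c.contMDiffAt hv) (c.invertible v hv) two_le_infty
  rw [mdifferentiableAt_totalSpace] at h
  have h2 := h.2.differentiableAt
  convert! h2 using 1
  ext1 y
  simp
  rfl


/-- A tangent vector extends to a field differentiable at its base point, so identities stated for
vector fields yield identities for arbitrary vectors in the parametrization. -/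
lemma exists_pullVec_eq (u : EuclideanSpace ℝ (Fin m)) :
    ∃ A : VectorField m N, DiffAt A (κ v) ∧ pullVec κ A v = u := by
  have : IsManifold (𝓡 m) 1 N := IsManifold.of_le (n := ∞) (by simp)
  refine ⟨FiberBundle.extend (EuclideanSpace ℝ (Fin m)) (E := fun y : N => TangentSpace (𝓡 m) y)
    (x := κ v) (pder (m := m) κ v u), FiberBundle.mdifferentiableAt_extend (I := 𝓡 m) (F := EuclideanSpace ℝ (Fin m)) (V := fun y : N => TangentSpace (𝓡 m) y) (pder (m := m) κ v u), ?_⟩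
  exact (congrArg (pder (m := m) κ v).inverse (FiberBundle.extend_apply_self
    (F := EuclideanSpace ℝ (Fin m)) (E := fun y : N => TangentSpace (𝓡 m) y)
    (pder (m := m) κ v u))).trans ((c.invertible v hv).inverse_apply_self _)

lemma pullVec_mlieBracket {A B : VectorField m N} (hA : DiffAt A (κ v)) (hB : DiffAt B (κ v)) :
    pullVec κ (VectorField.mlieBracket (𝓡 m) A B) v =
      fderiv ℝ (pullVec κ B) v (pullVec κ A v) - fderiv ℝ (pullVec κ A) v (pullVec κ B v) := by
  have : IsManifold (𝓡 m) (minSmoothness ℝ 3) N := IsManifold.of_le (n := ∞) (by simpa using three_le_infty)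
  have h := VectorField.mpullback_mlieBracket (I := 𝓡 m) (I' := 𝓡 m) (n := ∞) hA hB
    (c.contMDiffAt hv) (by simpa using two_le_infty)
  rw [← VectorField.mlieBracketWithin_univ (I := 𝓡 m) (M := EuclideanSpace ℝ (Fin m)),
    VectorField.mlieBracketWithin_eq_lieBracketWithin] at h
  refine h.trans ?_
  change VectorField.lieBracketWithin ℝ (pullVec κ A) (pullVec κ B) Set.univ v = _
  rw [VectorField.lieBracketWithin_univ]
  rfl

lemma differentiableAt_pullCov {α : CovectorField m N} (hα : SmoothCovector α) :
    DifferentiableAt ℝ (pullCov κ α) v :=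
  ((contDiffOn_pullCov hα c.isOpen c.contMDiff).contDiffAt (c.isOpen.mem_nhds hv)).differentiableAt
    (by simp)

lemma differentiableAt_pullBilin {b : BilinField m N} (hb : SmoothBilin b) :
    DifferentiableAt ℝ (pullBilin κ b) v :=
  ((contDiffOn_pullBilin hb c.isOpen c.contMDiff).contDiffAt
    (c.isOpen.mem_nhds hv)).differentiableAt (by simp)

lemma dirDeriv_cov {α : CovectorField m N} (hα : CovDiffAt α (κ v))
    (hα' : DifferentiableAt ℝ (pullCov κ α) v) {A : VectorField m N}
    (hA : DiffAt A (κ v)) {u : EuclideanSpace ℝ (Fin m)} {z : TangentSpace (𝓡 m) (κ v)}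
    (hu : pder κ v u = z) : dirDeriv (fun y => α y (A y)) (κ v) z =
      fderiv ℝ (pullCov κ α) v u (pullVec κ A v)
        + pullCov κ α v (fderiv ℝ (pullVec κ A) v u) := by
  subst hu
  refine (dirDeriv_comp (c.mdifferentiableAt hv) (hα A hA) u).trans ?_
  rw [← fderiv_cov_apply hα' (c.differentiableAt_pullVec hv hA)]
  refine congrArg (fun l : EuclideanSpace ℝ (Fin m) →L[ℝ] ℝ => l u)
    (Filter.EventuallyEq.fderiv_eq ?_)
  filter_upwards [c.isOpen.mem_nhds hv] with w hw
  exact c.cov_eq hw α A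

lemma dirDeriv_bilin {b : BilinField m N} (hb : BilinDiffAt b (κ v))
    (hb' : DifferentiableAt ℝ (pullBilin κ b) v) {A B : VectorField m N}
    (hA : DiffAt A (κ v)) (hB : DiffAt B (κ v)) {u : EuclideanSpace ℝ (Fin m)}
    {z : TangentSpace (𝓡 m) (κ v)} (hu : pder κ v u = z) :
    dirDeriv (fun y => b y (A y) (B y)) (κ v) z =
      fderiv ℝ (pullBilin κ b) v u (pullVec κ A v) (pullVec κ B v)
        + pullBilin κ b v (fderiv ℝ (pullVec κ A) v u) (pullVec κ B v)
        + pullBilin κ b v (pullVec κ A v) (fderiv ℝ (pullVec κ B) v u) := by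
  subst hu
  refine (dirDeriv_comp (c.mdifferentiableAt hv) (hb A B hA hB) u).trans ?_
  rw [← fderiv_bilin_apply hb' (c.differentiableAt_pullVec hv hA)
    (c.differentiableAt_pullVec hv hB)]
  refine congrArg (fun l : EuclideanSpace ℝ (Fin m) →L[ℝ] ℝ => l u)
    (Filter.EventuallyEq.fderiv_eq ?_)
  filter_upwards [c.isOpen.mem_nhds hv] with w hw
  exact c.bilin_eq hw b A B

/-- The derivatives of A and B cancel against the bracket, so that only the derivative of the
pulled-back form is left. The formulas for two-forms and Lie derivatives below have the same
mechanism. -/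
lemma extDerivOne_eq {α : CovectorField m N} (hα : CovDiffAt α (κ v))
    (hα' : DifferentiableAt ℝ (pullCov κ α) v) {A B : VectorField m N}
    (hA : DiffAt A (κ v)) (hB : DiffAt B (κ v)) :
    extDerivOne α A B (κ v) = fderiv ℝ (pullCov κ α) v (pullVec κ A v) (pullVec κ B v)
      - fderiv ℝ (pullCov κ α) v (pullVec κ B v) (pullVec κ A v) := by
  unfold extDerivOne
  refine (congrArg₂ (· - ·) (congrArg₂ (· - ·) (c.dirDeriv_cov hv hα hα' hB (c.pder_pullVec hv A))
    (c.dirDeriv_cov hv hα hα' hA (c.pder_pullVec hv B))) (c.cov_eq hv α _)).trans ?_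
  rw [c.pullVec_mlieBracket hv hA hB, map_sub]
  ring

lemma extDerivTwo_eq {b : BilinField m N} (hb : BilinDiffAt b (κ v))
    (hb' : DifferentiableAt ℝ (pullBilin κ b) v)
    (alt : ∀ x (y z : TangentSpace (𝓡 m) x), b x y z = -b x z y) {A B C : VectorField m N}
    (hA : DiffAt A (κ v)) (hB : DiffAt B (κ v)) (hC : DiffAt C (κ v)) :
    extDerivTwo b A B C (κ v) =
      fderiv ℝ (pullBilin κ b) v (pullVec κ A v) (pullVec κ B v) (pullVec κ C v)
      - fderiv ℝ (pullBilin κ b) v (pullVec κ B v) (pullVec κ A v) (pullVec κ C v)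
      + fderiv ℝ (pullBilin κ b) v (pullVec κ C v) (pullVec κ A v) (pullVec κ B v) := by
  have alt' : ∀ y z, pullBilin κ b v y z = -pullBilin κ b v z y := fun y z => alt _ _ _
  unfold extDerivTwo
  refine (congrArg₂ (· - ·) (congrArg₂ (· + ·) (congrArg₂ (· - ·) (congrArg₂ (· + ·)
    (congrArg₂ (· - ·) (c.dirDeriv_bilin hv hb hb' hB hC (c.pder_pullVec hv A))
    (c.dirDeriv_bilin hv hb hb' hA hC (c.pder_pullVec hv B)))
    (c.dirDeriv_bilin hv hb hb' hA hB (c.pder_pullVec hv C))) (c.bilin_eq hv b _ C))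
    (c.bilin_eq hv b _ B)) (c.bilin_eq hv b _ A)).trans ?_
  rw [c.pullVec_mlieBracket hv hA hB, c.pullVec_mlieBracket hv hA hC,
    c.pullVec_mlieBracket hv hB hC]
  simp only [map_sub, sub_apply]
  rw [alt' (pullVec κ A v) (fderiv ℝ (pullVec κ B) v (pullVec κ C v)),
    alt' (pullVec κ A v) (fderiv ℝ (pullVec κ C) v (pullVec κ B v)),
    alt' (pullVec κ B v) (fderiv ℝ (pullVec κ C) v (pullVec κ A v))]
  ring

lemma lieDerivBilin_eq {b : BilinField m N} (hb : BilinDiffAt b (κ v))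
    (hb' : DifferentiableAt ℝ (pullBilin κ b) v) {X A B : VectorField m N}
    (hX : DiffAt X (κ v)) (hA : DiffAt A (κ v)) (hB : DiffAt B (κ v)) :
    lieDerivBilin X b A B (κ v) =
      fderiv ℝ (pullBilin κ b) v (pullVec κ X v) (pullVec κ A v) (pullVec κ B v)
      + pullBilin κ b v (fderiv ℝ (pullVec κ X) v (pullVec κ A v)) (pullVec κ B v)
      + pullBilin κ b v (pullVec κ A v) (fderiv ℝ (pullVec κ X) v (pullVec κ B v)) := by
  unfold lieDerivBilin
  refine (congrArg₂ (· - ·) (congrArg₂ (· - ·)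
    (c.dirDeriv_bilin hv hb hb' hA hB (c.pder_pullVec hv X)) (c.bilin_eq hv b _ B))
    (c.bilin_eq hv b A _)).trans ?_
  rw [c.pullVec_mlieBracket hv hX hA, c.pullVec_mlieBracket hv hX hB]
  simp only [map_sub, sub_apply]
  ring

lemma lieDerivEnd_eq {T : EndField m N} (hT : SmoothEndOn T Set.univ)
    (hT' : DifferentiableAt ℝ (pullEnd κ T) v) {X A : VectorField m N}
    (hX : DiffAt X (κ v)) (hA : DiffAt A (κ v)) :
    (pder κ v).inverse (lieDerivEnd X T A (κ v)) =
      fderiv ℝ (pullEnd κ T) v (pullVec κ X v) (pullVec κ A v)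
      - fderiv ℝ (pullVec κ X) v (pullEnd κ T v (pullVec κ A v))
      + pullEnd κ T v (fderiv ℝ (pullVec κ X) v (pullVec κ A v)) := by
  have hTA : fderiv ℝ (pullVec κ (fun y => T y (A y))) v =
      fderiv ℝ (fun w => pullEnd κ T w (pullVec κ A w)) v := by
    refine Filter.EventuallyEq.fderiv_eq ?_
    filter_upwards [c.isOpen.mem_nhds hv] with w hw using (c.pullEnd_pullVec hw T A).symm
  refine (map_sub (pder (m := m) κ v).inverse _ _).trans ?_
  refine (congrArg₂ (· - ·) (c.pullVec_mlieBracket hv hX (hA.end_apply hT))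
    (c.pullEnd_pullVec hv T (VectorField.mlieBracket (𝓡 m) X A)).symm).trans ?_
  rw [c.pullVec_mlieBracket hv hX hA, hTA, fderiv_end_apply hT' (c.differentiableAt_pullVec hv hA),
    ← c.pullEnd_pullVec hv T A, map_sub]
  abel

end IsParam

/-! ## The Levi-Civita connection of a hyperKähler metric in a parametrization -/

section CovariantDerivativeOfEndomorphisms

variable {V : Type*} [NormedAddCommGroup V] [NormedSpace ℝ V] {v : V}
  {G : V → V →L[ℝ] V →L[ℝ] ℝ} {T : V → V →L[ℝ] V} {Γ : V →L[ℝ] V →L[ℝ] V}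

/-- The covariant derivative at `v` of a field of endomorphisms, for the Christoffel symbol `Γ`. -/
def covEnd (Γ : V →L[ℝ] V →L[ℝ] V) (T : V → V →L[ℝ] V) (v : V) : V →L[ℝ] V →L[ℝ] V :=
  fderiv ℝ T v + ((ContinuousLinearMap.compL ℝ V V V).flip (T v)).comp Γ
    - (ContinuousLinearMap.compL ℝ V V V (T v)).comp Γ

lemma covEnd_apply (u x : V) :
    covEnd Γ T v u x = fderiv ℝ T v u x + Γ u (T v x) - T v (Γ u x) := rfl

lemma fderiv_end_const (hT : DifferentiableAt ℝ T v) (x u : V) :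
    fderiv ℝ (fun w => T w x) v u = fderiv ℝ T v u x := by
  rw [fderiv_end_apply hT (differentiableAt_const x)]; simp

lemma differentiableAt_end_const (hT : DifferentiableAt ℝ T v) (x : V) :
    DifferentiableAt ℝ (fun w => T w x) v := hT.clm_apply (differentiableAt_const x)

/-- Obtained by differentiating T² = -1; the terms with Γ respect the relation by themselves. -/
lemma covEnd_anti (hT : DifferentiableAt ℝ T v) (sq : ∀ᶠ w in nhds v, ∀ x, T w (T w x) = -x)
    (u x : V) : covEnd Γ T v u (T v x) = -T v (covEnd Γ T v u x) := by
  have h : (fun w => T w (T w x)) =ᶠ[nhds v] fun _ => -x := by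
    filter_upwards [sq] with w hw using hw x
  have h1 := congrArg (fun l : V →L[ℝ] V => l u) (h.fderiv_eq (𝕜 := ℝ))
  simp only [fderiv_fun_const, Pi.zero_apply, zero_apply] at h1
  rw [fderiv_end_apply hT (differentiableAt_end_const hT x), fderiv_end_const hT] at h1
  simp only [covEnd_apply, map_add, map_sub, sq.self_of_nhds, map_neg]
  rw [eq_neg_of_add_eq_zero_left h1]
  abel

/-- Obtained by differentiating the skewness of G(T·, ·), with dG expressed through Γ. -/
lemma covEnd_skew (hG : DifferentiableAt ℝ G v) (hT : DifferentiableAt ℝ T v)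
    (compat : ∀ u x y, fderiv ℝ G v u x y = G v (Γ u x) y + G v x (Γ u y))
    (sk : ∀ᶠ w in nhds v, ∀ x y, G w (T w x) y = -G w x (T w y)) (u x y : V) :
    G v (covEnd Γ T v u x) y = -G v x (covEnd Γ T v u y) := by
  have h : (fun w => G w (T w x) y) =ᶠ[nhds v] fun w => -G w x (T w y) := by
    filter_upwards [sk] with w hw using hw x y
  have h1 := congrArg (fun l : V →L[ℝ] ℝ => l u) (h.fderiv_eq (𝕜 := ℝ))
  rw [fderiv_fun_neg] at h1
  simp only [neg_apply] at h1
  rw [fderiv_bilin_apply hG (differentiableAt_end_const hT x) (differentiableAt_const y),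
    fderiv_bilin_apply hG (differentiableAt_const x) (differentiableAt_end_const hT y), fderiv_end_const hT,
    fderiv_end_const hT] at h1
  simp only [fderiv_fun_const, Pi.zero_apply, zero_apply, map_zero, compat] at h1
  simp only [covEnd_apply, map_add, map_sub, add_apply, sub_apply]
  have s1 := sk.self_of_nhds x (Γ u y)
  have s2 := sk.self_of_nhds (Γ u x) y
  linarith

/-- For a torsion-free metric connection the exterior derivative of G(T·, ·) is the cyclic sum of
its covariant derivative: the terms with Γ cancel in pairs. -/
lemma covEnd_cyclic (hG : DifferentiableAt ℝ G v) (hT : DifferentiableAt ℝ T v)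
    (compat : ∀ u x y, fderiv ℝ G v u x y = G v (Γ u x) y + G v x (Γ u y))
    (symmΓ : ∀ u x, Γ u x = Γ x u) (symm : ∀ x y, G v x y = G v y x)
    (sk : ∀ᶠ w in nhds v, ∀ x y, G w (T w x) y = -G w x (T w y))
    (closed : ∀ u x y, fderiv ℝ (fun w => (G w).comp (T w)) v u x y
      + fderiv ℝ (fun w => (G w).comp (T w)) v x y u
      + fderiv ℝ (fun w => (G w).comp (T w)) v y u x = 0) (u x y : V) :
    G v (covEnd Γ T v u x) y + G v (covEnd Γ T v x y) u + G v (covEnd Γ T v y u) x = 0 := by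
  have hd : ∀ u x y, fderiv ℝ (fun w => (G w).comp (T w)) v u x y =
      G v (Γ u (T v x)) y + G v (T v x) (Γ u y) + G v (fderiv ℝ T v u x) y := fun u x y => by
    rw [(hG.hasFDerivAt.clm_comp hT.hasFDerivAt).fderiv]
    simp [compat]
    ring
  have h := closed u x y
  simp only [hd] at h
  simp only [covEnd_apply, map_add, map_sub, add_apply, sub_apply]
  have s := fun x y => sk.self_of_nhds x y
  rw [s (Γ u x) y, s (Γ x y) u, s (Γ y u) x, symmΓ u x, symmΓ y u, symmΓ x y] at *
  rw [symm (Γ x u), symm (Γ u y), symm (Γ y x)]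
  rw [symmΓ x u, symmΓ u y, symmΓ y x] at *
  linarith

end CovariantDerivativeOfEndomorphisms

/-! ### The first jet of a rotating symmetry -/

section Jet

variable {V : Type*} [NormedAddCommGroup V] [NormedSpace ℝ V]

/-- The first-order data at `v` of a hyperKähler structure with rotating symmetry on a vector
space: `Γ` is the Levi-Civita connection of `G`, and `∇X = L - I / 2`. -/
structure RotJet (G : V → V →L[ℝ] V →L[ℝ] ℝ) (I J K : V → V →L[ℝ] V) (X : V → V) (v : V)
    (Γ : V →L[ℝ] V →L[ℝ] V) (L : V →L[ℝ] V) : Prop where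
  quat : ∀ᶠ w in nhds v, QuatHerm (G w) (I w) (J w) (K w)
  diff_G : DifferentiableAt ℝ G v
  diff_I : DifferentiableAt ℝ I v
  diff_J : DifferentiableAt ℝ J v
  diff_K : DifferentiableAt ℝ K v
  diff_X : DifferentiableAt ℝ X v
  symm : ∀ u w, Γ u w = Γ w u
  compat : ∀ u x y, fderiv ℝ G v u x y = G v (Γ u x) y + G v x (Γ u y)
  deriv_I : ∀ u, fderiv ℝ I v u = (I v).comp (Γ u) - (Γ u).comp (I v)
  deriv_J : ∀ u, fderiv ℝ J v u = (J v).comp (Γ u) - (Γ u).comp (J v)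
  deriv_K : ∀ u, fderiv ℝ K v u = (K v).comp (Γ u) - (Γ u).comp (K v)
  deriv_X : ∀ u, fderiv ℝ X v u = L u - (1 / 2 : ℝ) • I v u - Γ u (X v)
  L_I : ∀ u, L (I v u) = I v (L u)
  L_J : ∀ u, L (J v u) = J v (L u)
  skew : ∀ u w, G v (L u) w = -G v (L w) u

/-- Closed fundamental forms and a rotating symmetry give the first-order data `RotJet`. -/
lemma exists_rotJet [FiniteDimensional ℝ V] {G : V → V →L[ℝ] V →L[ℝ] ℝ} {I J K : V → V →L[ℝ] V}
    {X : V → V} {v : V} (quat : ∀ᶠ w in nhds v, QuatHerm (G w) (I w) (J w) (K w))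
    (hG : DifferentiableAt ℝ G v) (hI : DifferentiableAt ℝ I v) (hJ : DifferentiableAt ℝ J v)
    (hK : DifferentiableAt ℝ K v) (hX : DifferentiableAt ℝ X v)
    (closed_I : ∀ u x y, fderiv ℝ (fun w => (G w).comp (I w)) v u x y
      + fderiv ℝ (fun w => (G w).comp (I w)) v x y u
      + fderiv ℝ (fun w => (G w).comp (I w)) v y u x = 0)
    (closed_J : ∀ u x y, fderiv ℝ (fun w => (G w).comp (J w)) v u x y
      + fderiv ℝ (fun w => (G w).comp (J w)) v x y u
      + fderiv ℝ (fun w => (G w).comp (J w)) v y u x = 0)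
    (closed_K : ∀ u x y, fderiv ℝ (fun w => (G w).comp (K w)) v u x y
      + fderiv ℝ (fun w => (G w).comp (K w)) v x y u
      + fderiv ℝ (fun w => (G w).comp (K w)) v y u x = 0)
    (killing : ∀ x y, fderiv ℝ G v (X v) x y + G v (fderiv ℝ X v x) y
      + G v x (fderiv ℝ X v y) = 0)
    (lie_I : ∀ x, fderiv ℝ I v (X v) x - fderiv ℝ X v (I v x) + I v (fderiv ℝ X v x) = 0)
    (lie_J : ∀ x, fderiv ℝ J v (X v) x - fderiv ℝ X v (J v x) + J v (fderiv ℝ X v x) = K v x) :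
    ∃ (Γ : V →L[ℝ] V →L[ℝ] V) (L : V →L[ℝ] V), RotJet G I J K X v Γ L := by
  have q := quat.self_of_nhds
  have symmD : ∀ u x y, fderiv ℝ G v u x y = fderiv ℝ G v u y x := fun u x y => by
    have h : (fun w => G w x y) =ᶠ[nhds v] fun w => G w y x := by
      filter_upwards [quat] with w hw using hw.symm x y
    have h1 := congrArg (fun l : V →L[ℝ] ℝ => l u) (h.fderiv_eq (𝕜 := ℝ))
    simpa [fderiv_bilin_apply hG (differentiableAt_const _) (differentiableAt_const _)] using h1
  obtain ⟨Γ, symmΓ, compat⟩ := exists_christoffel q.symm q.nondeg (D := fun u x y => fderiv ℝ G v u x y)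
    (fun _ _ => ⟨fun _ _ => by rw [(fderiv ℝ G v).map_add, add_apply, add_apply], fun _ _ => by
      rw [(fderiv ℝ G v).map_smul, smul_apply, smul_apply]⟩)
    (fun _ _ => ⟨fun _ _ => by simp only [map_add, add_apply], fun _ _ => by
      rw [ContinuousLinearMap.map_smul, smul_apply]⟩)
    (fun _ _ => ⟨fun _ _ => by simp only [map_add], fun _ _ => by
      rw [ContinuousLinearMap.map_smul]⟩) symmD
  have skI : ∀ᶠ w in nhds v, ∀ x y, G w (I w x) y = -G w x (I w y) := by
    filter_upwards [quat] with w hw x y using by rw [hw.gI, neg_neg]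
  have skJ : ∀ᶠ w in nhds v, ∀ x y, G w (J w x) y = -G w x (J w y) := by
    filter_upwards [quat] with w hw x y using by rw [hw.gJ, neg_neg]
  have skK : ∀ᶠ w in nhds v, ∀ x y, G w (K w x) y = -G w x (K w y) := by
    filter_upwards [quat] with w hw x y using by rw [hw.gK, neg_neg]
  have hc : ∀ u x, covEnd Γ K v u x = covEnd Γ I v u (J v x) + I v (covEnd Γ J v u x) :=
    fun u x => by
      have h : (fun w => K w x) =ᶠ[nhds v] fun w => I w (J w x) := by
        filter_upwards [quat] with w hw using (hw.IJ x).symm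
      have h1 := congrArg (fun l : V →L[ℝ] V => l u) (h.fderiv_eq (𝕜 := ℝ))
      simp only [fderiv_end_const hK, fderiv_end_apply hI (differentiableAt_end_const hJ x),
        fderiv_end_const hJ] at h1
      simp only [covEnd_apply, h1, map_add, map_sub, q.IJ]
      abel
  have hc' : ∀ u x, covEnd Γ K v u x = -covEnd Γ J v u (I v x) - J v (covEnd Γ I v u x) :=
    fun u x => by
      have h : (fun w => K w x) =ᶠ[nhds v] fun w => -J w (I w x) := by
        filter_upwards [quat] with w hw using by rw [hw.JI, neg_neg]
      have h1 := congrArg (fun l : V →L[ℝ] V => l u) (h.fderiv_eq (𝕜 := ℝ))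
      rw [fderiv_fun_neg] at h1
      simp only [neg_apply, fderiv_end_const hK, fderiv_end_apply hJ (differentiableAt_end_const hI x),
        fderiv_end_const hI] at h1
      simp only [covEnd_apply, h1, map_add, map_sub, q.JI, map_neg]
      abel
  -- Hitchin's argument: closedness of the three forms alone, without assuming integrability, gives
  -- ∇I = ∇J = ∇K = 0.
  have par := q.parallel_of_closed
    (covEnd_anti (Γ := Γ) hI (quat.mono fun w hw => hw.II))
    (covEnd_anti (Γ := Γ) hJ (quat.mono fun w hw => hw.JJ))
    (covEnd_anti (Γ := Γ) hK (quat.mono fun w hw => hw.KK)) hc hc'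
    (covEnd_skew hG hI compat skI) (covEnd_skew hG hJ compat skJ) (covEnd_skew hG hK compat skK)
    (covEnd_cyclic hG hI compat symmΓ q.symm skI closed_I)
    (covEnd_cyclic hG hJ compat symmΓ q.symm skJ closed_J)
    (covEnd_cyclic hG hK compat symmΓ q.symm skK closed_K)
  have dI : ∀ u x, fderiv ℝ I v u x = I v (Γ u x) - Γ u (I v x) := fun u x => by
    have := (par u x).1
    rw [covEnd_apply, add_sub_assoc] at this
    rw [eq_neg_of_add_eq_zero_left this]; abel
  have dJ : ∀ u x, fderiv ℝ J v u x = J v (Γ u x) - Γ u (J v x) := fun u x => by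
    have := (par u x).2.1
    rw [covEnd_apply, add_sub_assoc] at this
    rw [eq_neg_of_add_eq_zero_left this]; abel
  have dK : ∀ u x, fderiv ℝ K v u x = K v (Γ u x) - Γ u (K v x) := fun u x => by
    have := (par u x).2.2
    rw [covEnd_apply, add_sub_assoc] at this
    rw [eq_neg_of_add_eq_zero_left this]; abel
  -- With parallel I and J the Lie derivative conditions become [∇X, I] = 0 and [∇X, J] = -K.
  have hNI : ∀ x, fderiv ℝ X v (I v x) = I v (Γ x (X v)) - Γ (I v x) (X v) + I v (fderiv ℝ X v x) :=
    fun x => by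
      have := lie_I x
      rw [dI, symmΓ (X v), symmΓ (X v)] at this
      rw [← sub_eq_zero, ← neg_eq_zero, ← this]; abel
  have hNJ : ∀ x, fderiv ℝ X v (J v x) = J v (Γ x (X v)) - Γ (J v x) (X v) + J v (fderiv ℝ X v x)
      - K v x := fun x => by
      have := lie_J x
      rw [dJ, symmΓ (X v), symmΓ (X v)] at this
      rw [← this]; abel
  -- L is ∇X + I/2: since [I/2, J] = K, the added term cancels [∇X, J] = -K and leaves an
  -- endomorphism commuting with the quaternions.
  refine ⟨Γ, fderiv ℝ X v + Γ.flip (X v) + (1 / 2 : ℝ) • I v, quat, hG, hI, hJ, hK, hX, symmΓ,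
    compat, fun u => ContinuousLinearMap.ext (dI u), fun u => ContinuousLinearMap.ext (dJ u),
    fun u => ContinuousLinearMap.ext (dK u), fun u => ?_, fun u => ?_, fun u => ?_, fun u w => ?_⟩
  · simp
  · simp only [add_apply, ContinuousLinearMap.flip_apply, smul_apply, map_add, map_smul, hNI]
    abel
  · simp only [add_apply, ContinuousLinearMap.flip_apply, smul_apply, map_add, map_smul, hNJ, q.IJ,
      q.JI]
    module
  · have h := killing u w
    rw [compat, symmΓ (X v), symmΓ (X v)] at h
    simp only [add_apply, ContinuousLinearMap.flip_apply, smul_apply, map_add, map_smul]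
    rw [q.I_skew w u, q.symm (fderiv ℝ X v w), q.symm (Γ w (X v))]
    simp only [smul_eq_mul]
    linarith

end Jet

/-! ### Pulling the hyperKähler structure back to a parametrization -/

section Invertible

variable {m : ℕ}

lemma isInvertible_of_nondeg
    {b : EuclideanSpace ℝ (Fin m) →L[ℝ] EuclideanSpace ℝ (Fin m) →L[ℝ] ℝ}
    (h : ∀ u, (∀ v, b u v = 0) → u = 0) : b.IsInvertible := by
  have hinj : Function.Injective b.toLinearMap := by
    rw [← LinearMap.ker_eq_bot, LinearMap.ker_eq_bot']
    intro u hu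
    exact h u fun v => by
      change b u = 0 at hu
      rw [hu]; rfl
  have hfin : Module.finrank ℝ (EuclideanSpace ℝ (Fin m)) =
      Module.finrank ℝ (EuclideanSpace ℝ (Fin m) →L[ℝ] ℝ) := by
    rw [← (LinearMap.toContinuousLinearMap (𝕜 := ℝ) (E := EuclideanSpace ℝ (Fin m))
      (F' := ℝ)).finrank_eq]
    exact (Subspace.dual_finrank_eq (K := ℝ) (V := EuclideanSpace ℝ (Fin m))).symm
  refine ⟨(LinearEquiv.ofInjectiveOfFinrankEq b.toLinearMap hinj hfin).toContinuousLinearEquiv, ?_⟩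
  ext u
  rfl

end Invertible

lemma fundForm_skew {m : ℕ} {N : Type*} [TopologicalSpace N]
    [ChartedSpace (EuclideanSpace ℝ (Fin m)) N] {g : BilinField m N}
    (symm : ∀ (x : N) (u w : TangentSpace (𝓡 m) x), g x u w = g x w u)
    {T : EndField m N} (sq : ∀ x (u : TangentSpace (𝓡 m) x), T x (T x u) = -u)
    (herm : ∀ x (u w : TangentSpace (𝓡 m) x), g x (T x u) (T x w) = g x u w) (x : N)
    (y z : TangentSpace (𝓡 m) x) : fundForm g T x y z = -fundForm g T x z y := by
  change g x (T x y) z = -g x (T x z) y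
  rw [← herm x (T x y), sq, map_neg, neg_apply, symm]

namespace IsParam

variable {m : ℕ} {N : Type*} [TopologicalSpace N] [ChartedSpace (EuclideanSpace ℝ (Fin m)) N]
  {κ : EuclideanSpace ℝ (Fin m) → N} {U : Set (EuclideanSpace ℝ (Fin m))} (c : IsParam κ U)
  {v : EuclideanSpace ℝ (Fin m)} {g : BilinField m N} {I J K : EndField m N}
include c

lemma pder_injective (hv : v ∈ U) {u w : EuclideanSpace ℝ (Fin m)}
    (h : pder (m := m) κ v u = pder κ v w) : u = w :=
  (c.invertible v hv).injective h

lemma pullBilin_fundForm (hv : v ∈ U) (T : EndField m N) :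
    pullBilin κ (fundForm g T) v = (pullBilin κ g v).comp (pullEnd κ T v) := by
  ext u w
  exact (congrArg (fun x => g (κ v) x (pder (m := m) κ v w)) (c.pder_pullEnd hv T u)).symm

lemma pullCov_alphaZero (hv : v ∈ U) (X : VectorField m N) :
    pullCov κ (alphaZero g X) v = pullBilin κ g v (pullVec κ X v) := by
  ext u
  exact (congrArg (fun x => g (κ v) x (pder (m := m) κ v u)) (c.pder_pullVec hv X)).symm

lemma alphaOf_eq (hv : v ∈ U) {X : VectorField m N} {T : EndField m N} (sq : ∀ x (u : TangentSpace (𝓡 m) x), T x (T x u) = -u)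
    (herm : ∀ x (u w : TangentSpace (𝓡 m) x), g x (T x u) (T x w) = g x u w)
    (u : EuclideanSpace ℝ (Fin m)) : alphaOf g X T (κ v) (pder (m := m) κ v u) =
      pullBilin κ g v (pullEnd κ T v (pullVec κ X v)) u := by
  rw [c.pullEnd_pullVec hv]
  change -g (κ v) (X (κ v)) (T (κ v) (pder (m := m) κ v u)) =
    g (κ v) (pder (m := m) κ v (pullVec κ (fun y => T y (X y)) v)) (pder (m := m) κ v u)
  refine Eq.trans ?_ (congrArg (fun x => g (κ v) x (pder (m := m) κ v u))
    (c.pder_pullVec hv (fun y => T y (X y)))).symm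
  refine Eq.trans ?_ (herm (κ v) _ _)
  rw [sq, map_neg, neg_apply]

lemma nondeg_pullBilin (hv : v ∈ U)
    (hg : ∀ (x : N) (u : TangentSpace (𝓡 m) x), (∀ w, g x u w = 0) → u = 0)
    (u : EuclideanSpace ℝ (Fin m)) (hu : ∀ w, pullBilin κ g v u w = 0) : u = 0 := by
  refine c.pder_injective hv ?_
  rw [map_zero]
  refine hg (κ v) _ fun w => ?_
  obtain ⟨w', hw'⟩ := (c.invertible v hv).surjective w
  exact (congrArg (g (κ v) (pder (m := m) κ v u)) hw').symm.trans (hu w')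

lemma quatHerm (hv : v ∈ U)
    (symm : ∀ (x : N) (u w : TangentSpace (𝓡 m) x), g x u w = g x w u)
    (nondeg : ∀ (x : N) (u : TangentSpace (𝓡 m) x), (∀ w, g x u w = 0) → u = 0)
    (q : IsQuaternionHermitianAt g I J K (κ v)) :
    QuatHerm (pullBilin κ g v) (pullEnd κ I v) (pullEnd κ J v) (pullEnd κ K v) where
  symm _ _ := symm _ _ _
  nondeg := c.nondeg_pullBilin hv nondeg
  II u := c.pder_injective hv (by
    rw [c.pder_pullEnd hv, map_neg]
    exact (congrArg (I (κ v)) (c.pder_pullEnd hv I u)).trans (q.sq_I _))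
  JJ u := c.pder_injective hv (by
    rw [c.pder_pullEnd hv, map_neg]
    exact (congrArg (J (κ v)) (c.pder_pullEnd hv J u)).trans (q.sq_J _))
  KK u := c.pder_injective hv (by
    rw [c.pder_pullEnd hv, map_neg]
    exact (congrArg (K (κ v)) (c.pder_pullEnd hv K u)).trans (q.sq_K _))
  IJ u := c.pder_injective hv (by
    rw [c.pder_pullEnd hv I, c.pder_pullEnd hv K]
    exact (congrArg (I (κ v)) (c.pder_pullEnd hv J u)).trans (q.I_J _))
  JI u := c.pder_injective hv (by
    rw [c.pder_pullEnd hv J, map_neg, c.pder_pullEnd hv K]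
    exact (congrArg (J (κ v)) (c.pder_pullEnd hv I u)).trans (q.J_I _))
  gII u w := (congrArg₂ (fun x y => g (κ v) x y) (c.pder_pullEnd hv I u)
    (c.pder_pullEnd hv I w)).trans (q.herm_I _ _)
  gJJ u w := (congrArg₂ (fun x y => g (κ v) x y) (c.pder_pullEnd hv J u)
    (c.pder_pullEnd hv J w)).trans (q.herm_J _ _)
  gKK u w := (congrArg₂ (fun x y => g (κ v) x y) (c.pder_pullEnd hv K u)
    (c.pder_pullEnd hv K w)).trans (q.herm_K _ _)

variable [IsManifold (𝓡 m) ∞ N]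

/-- The pulled-back endomorphism is the pulled-back form ω_T divided by the pulled-back metric. Both
forms take values in fixed vector spaces, so their smoothness is available without inverting the
derivative of κ between varying tangent spaces. -/
lemma contDiffOn_pullEnd (hg : IsPseudoMetric g) {T : EndField m N} {U₁ : Set N}
    (hT : SmoothEndOn T U₁) (hU₁ : Set.MapsTo κ U U₁) : ContDiffOn ℝ ∞ (pullEnd κ T) U := by
  have hinv : ∀ w ∈ U, (pullBilin κ g w).IsInvertible := fun w hw =>
    isInvertible_of_nondeg (c.nondeg_pullBilin hw hg.nondegenerate)
  have h : ContDiffOn ℝ ∞ (fun w => (pullBilin κ g w).inverse.comp (pullBilin κ (fundForm g T) w))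
      U := by
    refine ContDiffOn.clm_comp (fun w hw => ?_)
      (contDiffOn_pullBilin_fundForm hg.smooth hT c.isOpen c.contMDiff hU₁)
    exact (hinv w hw).contDiffAt_map_inverse.comp_contDiffWithinAt w
      (contDiffOn_pullBilin hg.smooth c.isOpen c.contMDiff w hw)
  refine h.congr fun w hw => ?_
  rw [c.pullBilin_fundForm hw, ← ContinuousLinearMap.comp_assoc, (hinv w hw).inverse_comp_self,
    ContinuousLinearMap.id_comp]

/-- The same device: X is recovered from the one-form g(X, ·) by inverting the metric. -/
lemma contDiffOn_pullVec (hg : IsPseudoMetric g) {X : VectorField m N} (hX : SmoothVector X) :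
    ContDiffOn ℝ ∞ (pullVec κ X) U := by
  have hinv : ∀ w ∈ U, (pullBilin κ g w).IsInvertible := fun w hw =>
    isInvertible_of_nondeg (c.nondeg_pullBilin hw hg.nondegenerate)
  have h1 : ContDiffOn ℝ ∞ (pullCov κ (alphaZero g X)) U :=
    contDiffOn_clm_apply.mpr fun u => contDiffOn_bilin_apply hg.smooth c.contMDiff
      (s := fun w => X (κ w)) (hX.comp_contMDiffOn c.contMDiff)
      (contMDiffOn_pder c.isOpen c.contMDiff (contDiffOn_const (c := u)))
  have h : ContDiffOn ℝ ∞ (fun w => (pullBilin κ g w).inverse (pullCov κ (alphaZero g X) w))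
      U := by
    refine ContDiffOn.clm_apply (fun w hw => ?_) h1
    exact (hinv w hw).contDiffAt_map_inverse.comp_contDiffWithinAt w
      (contDiffOn_pullBilin hg.smooth c.isOpen c.contMDiff w hw)
  refine h.congr fun w hw => ?_
  rw [c.pullCov_alphaZero hw, (hinv w hw).inverse_apply_self]

variable (hv : v ∈ U)
include hv

lemma differentiableAt_pullEnd (hg : IsPseudoMetric g) {T : EndField m N} {U₁ : Set N}
    (hT : SmoothEndOn T U₁) (hU₁ : Set.MapsTo κ U U₁) : DifferentiableAt ℝ (pullEnd κ T) v :=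
  ((c.contDiffOn_pullEnd hg hT hU₁).contDiffAt (c.isOpen.mem_nhds hv)).differentiableAt (by simp)

/-- Cartan's formula is evaluated on fields with prescribed values at the point; skewness of `b`
brings the three terms into cyclic order. -/
lemma closed_fderiv {b : BilinField m N} (hb : BilinDiffAt b (κ v))
    (hd : DifferentiableAt ℝ (pullBilin κ b) v)
    (sk : ∀ x (y z : TangentSpace (𝓡 m) x), b x y z = -b x z y) (closed : IsClosedTwoForm b)
    (u x y : EuclideanSpace ℝ (Fin m)) : fderiv ℝ (pullBilin κ b) v u x y
      + fderiv ℝ (pullBilin κ b) v x y u + fderiv ℝ (pullBilin κ b) v y u x = 0 := by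
  obtain ⟨A, hA, rfl⟩ := c.exists_pullVec_eq hv u
  obtain ⟨B, hB, rfl⟩ := c.exists_pullVec_eq hv x
  obtain ⟨C, hC, rfl⟩ := c.exists_pullVec_eq hv y
  have h := closed (κ v) A B C hA hB hC
  rw [c.extDerivTwo_eq hv hb hd sk hA hB hC] at h
  have alt : ∀ u x y, fderiv ℝ (pullBilin κ b) v u x y =
      -fderiv ℝ (pullBilin κ b) v u y x := fun u x y => by
    have e : (fun w => pullBilin κ b w x y) = fun w =>
        -pullBilin κ b w y x := funext fun w => sk _ _ _
    have e1 := congrArg (fun f => fderiv ℝ f v u) e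
    simp only [fderiv_fun_neg, neg_apply] at e1
    simpa [fderiv_bilin_apply hd (differentiableAt_const _) (differentiableAt_const _)] using e1
  rw [alt (pullVec κ B v)]
  linarith

omit c hv in
lemma bilinDiffAt_fundForm (hg : IsPseudoMetric g) {T : EndField m N}
    (hT : SmoothEndOn T Set.univ) (x : N) : BilinDiffAt (fundForm g T) x := fun A B hA hB =>
  hg.smooth.bilinDiffAt _ (fun y => T y (A y)) B (hA.end_apply hT) hB

lemma differentiableAt_pullBilin_fundForm (hg : IsPseudoMetric g) {T : EndField m N}
    (hT : SmoothEndOn T Set.univ) : DifferentiableAt ℝ (pullBilin κ (fundForm g T)) v :=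
  ((contDiffOn_pullBilin_fundForm hg.smooth hT c.isOpen c.contMDiff
    (Set.mapsTo_univ _ _)).contDiffAt (c.isOpen.mem_nhds hv)).differentiableAt (by simp)

lemma closed_flat (hg : IsPseudoMetric g) {T : EndField m N} (hT : SmoothEndOn T Set.univ)
    (sk : ∀ x (y z : TangentSpace (𝓡 m) x), fundForm g T x y z = -fundForm g T x z y)
    (closed : IsClosedTwoForm (fundForm g T)) (u x y : EuclideanSpace ℝ (Fin m)) :
    fderiv ℝ (fun w => (pullBilin κ g w).comp (pullEnd κ T w)) v u x y
      + fderiv ℝ (fun w => (pullBilin κ g w).comp (pullEnd κ T w)) v x y u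
      + fderiv ℝ (fun w => (pullBilin κ g w).comp (pullEnd κ T w)) v y u x = 0 := by
  have he : pullBilin κ (fundForm g T) =ᶠ[nhds v]
      fun w => (pullBilin κ g w).comp (pullEnd κ T w) := by
    filter_upwards [c.isOpen.mem_nhds hv] with w hw using c.pullBilin_fundForm hw T
  rw [← he.fderiv_eq]
  exact c.closed_fderiv hv (bilinDiffAt_fundForm hg hT _)
    (c.differentiableAt_pullBilin_fundForm hv hg hT) sk closed u x y

/-- The first-order data of a hyperKähler manifold with rotating symmetry. -/
lemma exists_rotJet (hHK : IsHyperKahler g I J K) {X : VectorField m N}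
    (hX : IsRotating g I J K X) : ∃ Γ L, RotJet (pullBilin κ g) (pullEnd κ I) (pullEnd κ J)
      (pullEnd κ K) (pullVec κ X) v Γ L := by
  have hg := hHK.metric
  have hI := c.differentiableAt_pullEnd hv hg hHK.smooth_I (Set.mapsTo_univ _ _)
  have hJ := c.differentiableAt_pullEnd hv hg hHK.smooth_J (Set.mapsTo_univ _ _)
  have hK := c.differentiableAt_pullEnd hv hg hHK.smooth_K (Set.mapsTo_univ _ _)
  have hG := c.differentiableAt_pullBilin hv hg.smooth
  have hX' : DiffAt X (κ v) := hX.smooth.mdifferentiable (by simp) _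
  refine HKQK.exists_rotJet ?_ hG hI hJ hK (c.differentiableAt_pullVec hv hX')
    (c.closed_flat hv hg hHK.smooth_I (fundForm_skew hg.symm (fun x => (hHK.hermitian x).sq_I)
      (fun x => (hHK.hermitian x).herm_I)) hHK.closed_I)
    (c.closed_flat hv hg hHK.smooth_J (fundForm_skew hg.symm (fun x => (hHK.hermitian x).sq_J)
      (fun x => (hHK.hermitian x).herm_J)) hHK.closed_J)
    (c.closed_flat hv hg hHK.smooth_K (fundForm_skew hg.symm (fun x => (hHK.hermitian x).sq_K)
      (fun x => (hHK.hermitian x).herm_K)) hHK.closed_K) (fun x y => ?_) (fun x => ?_) fun x => ?_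
  · filter_upwards [c.isOpen.mem_nhds hv] with w hw
    exact c.quatHerm hw hg.symm hg.nondegenerate (hHK.hermitian _)
  · obtain ⟨A, hA, rfl⟩ := c.exists_pullVec_eq hv x
    obtain ⟨B, hB, rfl⟩ := c.exists_pullVec_eq hv y
    rw [← c.lieDerivBilin_eq hv (hg.smooth.bilinDiffAt _) hG hX' hA hB]
    exact hX.killing _ _ _ hA hB
  · obtain ⟨A, hA, rfl⟩ := c.exists_pullVec_eq hv x
    rw [← c.lieDerivEnd_eq hv hHK.smooth_I hI hX' hA, hX.lie_I _ _ hA]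
    exact map_zero _
  · obtain ⟨A, hA, rfl⟩ := c.exists_pullVec_eq hv x
    rw [← c.lieDerivEnd_eq hv hHK.smooth_J hJ hX' hA, hX.lie_J _ _ hA]
    exact (c.pullEnd_pullVec hv K A).symm

/-- `dα₀ + ω_I = 2 g(L·, ·)`. -/
lemma extDerivOne_alphaZero (hHK : IsHyperKahler g I J K) {X : VectorField m N}
    (hX : IsRotating g I J K X) {Γ L} (r : RotJet (pullBilin κ g) (pullEnd κ I) (pullEnd κ J)
      (pullEnd κ K) (pullVec κ X) v Γ L) {A B : VectorField m N} (hA : DiffAt A (κ v))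
    (hB : DiffAt B (κ v)) :
    extDerivOne (alphaZero g X) A B (κ v) + fundForm g I (κ v) (A (κ v)) (B (κ v)) =
      2 * pullBilin κ g v (L (pullVec κ A v)) (pullVec κ B v) := by
  have hX' : DiffAt X (κ v) := hX.smooth.mdifferentiable (by simp) _
  have he : pullCov κ (alphaZero g X) =ᶠ[nhds v] fun w => pullBilin κ g w (pullVec κ X w) := by
    filter_upwards [c.isOpen.mem_nhds hv] with w hw using c.pullCov_alphaZero hw X
  have hd : DifferentiableAt ℝ (pullCov κ (alphaZero g X)) v :=
    he.differentiableAt_iff.mpr (r.diff_G.clm_apply r.diff_X)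
  have q := r.quat.self_of_nhds
  have hb : CovDiffAt (alphaZero g X) (κ v) := fun A hA =>
    hHK.metric.smooth.bilinDiffAt _ X A hX' hA
  rw [c.extDerivOne_eq hv hb hd hA hB,
    c.bilin_eq hv, c.pullBilin_fundForm hv, he.fderiv_eq,
    (r.diff_G.hasFDerivAt.clm_apply r.diff_X.hasFDerivAt).fderiv]
  simp only [add_apply, ContinuousLinearMap.comp_apply, ContinuousLinearMap.flip_apply, r.deriv_X,
    r.compat, map_sub, map_smul, sub_apply, smul_apply, smul_eq_mul,
    r.symm (pullVec κ A v) (pullVec κ B v)]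
  rw [r.skew (pullVec κ B v), q.I_skew (pullVec κ B v)]
  ring

lemma fderiv_momentMap (hHK : IsHyperKahler g I J K) {X : VectorField m N} {μ : N → ℝ}
    (hμ : IsKahlerMomentMap g I X μ) (u : EuclideanSpace ℝ (Fin m)) :
    fderiv ℝ (fun w => μ (κ w)) v u =
      pullBilin κ g v (pullEnd κ I v (pullVec κ X v)) u := by
  refine (dirDeriv_comp (c.mdifferentiableAt hv)
    (hμ.smooth.mdifferentiable (by simp) _) u).symm.trans ?_
  refine (hμ.deriv _ _).trans ?_
  exact c.alphaOf_eq hv (fun x => (hHK.hermitian x).sq_I) (fun x => (hHK.hermitian x).herm_I) u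

end IsParam

/-! ## Submersions in charts -/

section Submersion

variable {n m : ℕ} {P : Type*} [TopologicalSpace P] [ChartedSpace (EuclideanSpace ℝ (Fin n)) P]
  {N : Type*} [TopologicalSpace N] [ChartedSpace (EuclideanSpace ℝ (Fin m)) N]

lemma isParam_symm {e : OpenPartialHomeomorph N (EuclideanSpace ℝ (Fin m))}
    [IsManifold (𝓡 m) ∞ N] (he : e ∈ IsManifold.maximalAtlas (𝓡 m) ∞ N) :
    IsParam e.symm e.target where
  isOpen := e.open_target
  contMDiff := contMDiffOn_symm_of_mem_maximalAtlas he
  invertible v hv := by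
    have h1 : MDifferentiableAt (𝓡 m) (𝓡 m) e.symm v :=
      ((contMDiffOn_symm_of_mem_maximalAtlas he v hv).contMDiffAt
        (e.open_target.mem_nhds hv)).mdifferentiableAt (by simp)
    have h2 : MDifferentiableAt (𝓡 m) (𝓡 m) e (e.symm v) :=
      ((contMDiffOn_of_mem_maximalAtlas he _ (e.map_target hv)).contMDiffAt
        (e.open_source.mem_nhds (e.map_target hv))).mdifferentiableAt (by simp)
    have h1' : MDifferentiableAt (𝓡 m) (𝓡 m) e.symm (e (e.symm v)) := by
      rwa [e.right_inv hv]
    have c1 : (mfderiv (𝓡 m) (𝓡 m) e (e.symm v)).comp (mfderiv (𝓡 m) (𝓡 m) e.symm v) =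
        ContinuousLinearMap.id ℝ _ := by
      rw [← mfderiv_comp v h2 h1, ← mfderiv_id]
      refine Filter.EventuallyEq.mfderiv_eq ?_
      filter_upwards [e.open_target.mem_nhds hv] with w hw using e.right_inv hw
    have c2 : (mfderiv (𝓡 m) (𝓡 m) e.symm (e (e.symm v))).comp
        (mfderiv (𝓡 m) (𝓡 m) e (e.symm v)) = ContinuousLinearMap.id ℝ _ := by
      rw [← mfderiv_comp _ h1' h2, ← mfderiv_id]
      refine Filter.EventuallyEq.mfderiv_eq ?_
      filter_upwards [e.open_source.mem_nhds (e.map_target hv)] with w hw using e.left_inv hw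
    rw [e.right_inv hv] at c2
    exact ContinuousLinearMap.IsInvertible.of_inverse (g := mfderiv (𝓡 m) (𝓡 m) e (e.symm v)) c2 c1

/-- Charts in which the map `f` is the linear projection `pr`, with section `j`. -/
structure SubmersionChart (f : P → N) (χ : EuclideanSpace ℝ (Fin n) → P)
    (O : Set (EuclideanSpace ℝ (Fin n))) (κ : EuclideanSpace ℝ (Fin m) → N)
    (ψ : N → EuclideanSpace ℝ (Fin m)) (U : Set (EuclideanSpace ℝ (Fin m))) (Ω : Set N)
    (pr : EuclideanSpace ℝ (Fin n) →L[ℝ] EuclideanSpace ℝ (Fin m))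
    (j : EuclideanSpace ℝ (Fin m) →L[ℝ] EuclideanSpace ℝ (Fin n)) : Prop where
  dom : IsParam χ O
  cod : IsParam κ U
  mapsTo : ∀ x ∈ O, pr x ∈ U
  eq : ∀ x ∈ O, f (χ x) = κ (pr x)
  pr_j : ∀ u, pr (j u) = u
  isOpen : IsOpen Ω
  contMDiff : ContMDiffOn (𝓡 m) (𝓡 m) ∞ ψ Ω
  left_inv : ∀ v ∈ U, κ v ∈ Ω ∧ ψ (κ v) = v
  right_inv : ∀ w ∈ Ω, κ (ψ w) = w

namespace SubmersionChart

variable {f : P → N} {χ : EuclideanSpace ℝ (Fin n) → P}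
    {O : Set (EuclideanSpace ℝ (Fin n))} {κ : EuclideanSpace ℝ (Fin m) → N}
    {ψ : N → EuclideanSpace ℝ (Fin m)} {U : Set (EuclideanSpace ℝ (Fin m))} {Ω : Set N}
    {pr : EuclideanSpace ℝ (Fin n) →L[ℝ] EuclideanSpace ℝ (Fin m)}
    {j : EuclideanSpace ℝ (Fin m) →L[ℝ] EuclideanSpace ℝ (Fin n)}
    (s : SubmersionChart f χ O κ ψ U Ω pr j) {x : EuclideanSpace ℝ (Fin n)} (hx : x ∈ O)
include s hx

lemma mfderiv_apply (hf : MDifferentiableAt (𝓡 n) (𝓡 m) f (χ x))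
    (u : EuclideanSpace ℝ (Fin n)) :
    (mfderiv (𝓡 n) (𝓡 m) f (χ x) (pder χ x u) : EuclideanSpace ℝ (Fin m)) =
      pder κ (pr x) (pr u) := by
  have h1 : mfderiv (𝓡 n) (𝓡 m) (f ∘ χ) x = (mfderiv (𝓡 n) (𝓡 m) f (χ x)).comp
      (mfderiv (𝓡 n) (𝓡 n) χ x) := mfderiv_comp x hf (s.dom.mdifferentiableAt hx)
  have hpr : MDifferentiableAt (𝓡 n) (𝓡 m) pr x := pr.differentiableAt.mdifferentiableAt
  have h2 : mfderiv (𝓡 n) (𝓡 m) (κ ∘ pr) x = (mfderiv (𝓡 m) (𝓡 m) κ (pr x)).comp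
      (mfderiv (𝓡 n) (𝓡 m) pr x) := mfderiv_comp x (s.cod.mdifferentiableAt (s.mapsTo x hx)) hpr
  have h3 : f ∘ χ =ᶠ[nhds x] κ ∘ pr := by
    filter_upwards [s.dom.isOpen.mem_nhds hx] with y hy using s.eq y hy
  have h4 : (mfderiv (𝓡 n) (𝓡 m) pr x : EuclideanSpace ℝ (Fin n) →L[ℝ] EuclideanSpace ℝ (Fin m)) =
      pr := by
    rw [mfderiv_eq_fderiv, ContinuousLinearMap.fderiv]
  have h5 : (mfderiv (𝓡 n) (𝓡 m) (f ∘ χ) x :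
      EuclideanSpace ℝ (Fin n) →L[ℝ] EuclideanSpace ℝ (Fin m)) = mfderiv (𝓡 n) (𝓡 m) (κ ∘ pr) x :=
    h3.mfderiv_eq
  have h6 := (congrArg (fun l : EuclideanSpace ℝ (Fin n) →L[ℝ] EuclideanSpace ℝ (Fin m) => l u)
    h1).symm.trans ((congrArg (fun l : EuclideanSpace ℝ (Fin n) →L[ℝ] EuclideanSpace ℝ (Fin m) =>
      l u) h5).trans (congrArg (fun l : EuclideanSpace ℝ (Fin n) →L[ℝ] EuclideanSpace ℝ (Fin m) =>
      l u) h2))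
  exact h6.trans (congrArg (fun l : EuclideanSpace ℝ (Fin n) →L[ℝ] EuclideanSpace ℝ (Fin m) =>
      pder (m := m) κ (pr x) (l u)) h4)

end SubmersionChart

variable [IsManifold (𝓡 n) ∞ P] [IsManifold (𝓡 m) ∞ N]

/-- This is the local normal form of a submersion; `pr` is the first projection of the splitting of
the domain and `j` the inclusion of the first factor. -/
lemma exists_submersionChart {f : P → N} {p : P}
    (h : Manifold.IsSubmersionAt (𝓡 n) (𝓡 m) ∞ f p) :
    ∃ χ O κ ψ U Ω pr j e, SubmersionChart (n := n) (m := m) f χ O κ ψ U Ω pr j ∧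
      e ∈ O ∧ χ e = p := by
  obtain ⟨F, _, _, h⟩ := h
  refine ⟨h.domChart.symm, h.domChart.target, h.codChart.symm, h.codChart, h.codChart.target,
    h.codChart.source, (ContinuousLinearMap.fst ℝ _ F).comp h.equiv.toContinuousLinearMap,
    h.equiv.symm.toContinuousLinearMap.comp (ContinuousLinearMap.inl ℝ _ F), h.domChart p,
    ⟨isParam_symm h.domChart_mem_maximalAtlas, isParam_symm h.codChart_mem_maximalAtlas,
      fun x hx => ?_, fun x hx => ?_, fun u => ?_, h.codChart.open_source,
      contMDiffOn_of_mem_maximalAtlas h.codChart_mem_maximalAtlas,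
      fun v hv => ⟨h.codChart.map_target hv, h.codChart.right_inv hv⟩,
      fun w hw => h.codChart.left_inv hw⟩,
    h.domChart.map_source h.mem_domChart_source, h.domChart.left_inv h.mem_domChart_source⟩
  · have hx' : x ∈ (h.domChart.extend (𝓡 n)).target := by simpa using hx
    simpa using h.target_subset_preimage_target hx'
  · have hx' : x ∈ (h.domChart.extend (𝓡 n)).target := by simpa using hx
    have h1 := h.writtenInCharts hx'
    have h2 : f (h.domChart.symm x) ∈ h.codChart.source :=
      h.source_subset_preimage_source (h.domChart.map_target hx)
    have h3 : h.codChart (f (h.domChart.symm x)) = (h.equiv x).1 := by simpa using h1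
    rw [← h.codChart.left_inv h2, h3]
    rfl
  · simp

/-- The kernel of the derivative of a submersion with one-dimensional fibres. -/
lemma exists_smul_eq_of_mfderiv_eq_zero {P : Type*} [TopologicalSpace P]
    [ChartedSpace (EuclideanSpace ℝ (Fin (m + 1))) P] [IsManifold (𝓡 (m + 1)) ∞ P] {f : P → N}
    {p : P} (h : Manifold.IsSubmersionAt (𝓡 (m + 1)) (𝓡 m) ∞ f p)
    {y z : TangentSpace (𝓡 (m + 1)) p} (hy : mfderiv (𝓡 (m + 1)) (𝓡 m) f p y = 0)
    (hz : mfderiv (𝓡 (m + 1)) (𝓡 m) f p z = 0) (hy₀ : y ≠ 0) : ∃ c : ℝ, z = c • y := by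
  have hf : MDifferentiableAt (𝓡 (m + 1)) (𝓡 m) f p := by
    obtain ⟨F, _, _, h⟩ := h
    exact h.contMDiffAt.mdifferentiableAt (by simp)
  obtain ⟨χ, O, κ, ψ, U, Ω, pr, j, e, s, he, rfl⟩ := exists_submersionChart h
  obtain ⟨y', rfl⟩ := (s.dom.invertible e he).surjective y
  obtain ⟨z', rfl⟩ := (s.dom.invertible e he).surjective z
  have key : ∀ u : EuclideanSpace ℝ (Fin (m + 1)),
      mfderiv (𝓡 (m + 1)) (𝓡 m) f (χ e) (pder (m := m + 1) χ e u) = 0 → pr u = 0 := fun u hu => by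
    refine s.cod.pder_injective (s.mapsTo e he) ?_
    rw [map_zero]
    exact (s.mfderiv_apply he hf u).symm.trans hu
  have hsurj : Function.Surjective pr.toLinearMap := fun u => ⟨j u, s.pr_j u⟩
  have hker : Module.finrank ℝ pr.toLinearMap.ker = 1 := by
    have h1 := pr.toLinearMap.finrank_range_add_finrank_ker
    rw [LinearMap.range_eq_top.mpr hsurj, finrank_top, finrank_euclideanSpace,
      finrank_euclideanSpace, Fintype.card_fin, Fintype.card_fin] at h1
    omega
  have hne : (⟨y', key y' hy⟩ : pr.toLinearMap.ker) ≠ 0 := by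
    intro h0
    apply hy₀
    have : y' = 0 := congrArg Subtype.val h0
    rw [this, map_zero]
    rfl
  obtain ⟨c, hc⟩ := (finrank_eq_one_iff_of_nonzero' _ hne).mp hker ⟨z', key z' hz⟩
  refine ⟨c, ?_⟩
  have : z' = c • y' := (congrArg Subtype.val hc).symm
  rw [this, map_smul]
  rfl

end Submersion

/-! ## The local model of a twist -/

/-- The endomorphism field `x ↦ x - (η x / a) X` that relates the horizontal lifts of a twist. -/
def shear {V : Type*} [NormedAddCommGroup V] [NormedSpace ℝ V] (η : V → V →L[ℝ] ℝ) (X : V → V)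
    (a : V → ℝ) (v : V) : V →L[ℝ] V :=
  ContinuousLinearMap.id ℝ _ - (η v).smulRight ((a v)⁻¹ • X v)

lemma shear_apply {V : Type*} [NormedAddCommGroup V] [NormedSpace ℝ V] (η : V → V →L[ℝ] ℝ)
    (X : V → V) (a : V → ℝ) (v u : V) : shear η X a v u = u - η v u • (a v)⁻¹ • X v := by
  simp [shear]

section TwistModel

variable {m : ℕ}
  {M : Type*} [TopologicalSpace M] [ChartedSpace (EuclideanSpace ℝ (Fin m)) M]
  {P : Type*} [TopologicalSpace P] [ChartedSpace (EuclideanSpace ℝ (Fin (m + 1))) P]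
  {W : Type*} [TopologicalSpace W] [ChartedSpace (EuclideanSpace ℝ (Fin m)) W]

/-- A map is constant along the flow of a vector field in the kernel of its derivative. -/
lemma mfderiv_eq_zero_of_integralCurve [IsManifold (𝓡 (m + 1)) ∞ P] {f : P → M} {p : P}
    (hf : MDifferentiableAt (𝓡 (m + 1)) (𝓡 m) f p) {Z : VectorField (m + 1) P} {γ : ℝ → P}
    (hγ : IsMIntegralCurve γ Z) (h0 : γ 0 = p) (hc : ∀ t, f (γ t) = f p) :
    mfderiv (𝓡 (m + 1)) (𝓡 m) f p (Z p) = 0 := by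
  subst h0
  have h1 := hf.hasMFDerivAt.comp 0 (hγ 0)
  have h2 : f ∘ γ = fun _ => f (γ 0) := funext hc
  rw [h2] at h1
  have h3 := hasMFDerivAt_unique h1 (hasMFDerivAt_const (f (γ 0)) (0 : ℝ))
  have h4 := congrArg (fun l : ℝ →L[ℝ] EuclideanSpace ℝ (Fin m) => l 1) h3
  have h5 : ((1 : ℝ →L[ℝ] ℝ).smulRight (Z (γ 0)) : ℝ →L[ℝ] TangentSpace (𝓡 (m + 1)) (γ 0)) 1 =
      Z (γ 0) := by simp
  exact (congrArg (mfderiv (𝓡 (m + 1)) (𝓡 m) f (γ 0)) h5).symm.trans h4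

variable [IsManifold (𝓡 m) ∞ M] [IsManifold (𝓡 (m + 1)) ∞ P] [IsManifold (𝓡 m) ∞ W]

/-- The fibres of πW consist of points joined by flow lines of X', so πW is constant along each of
them. -/
lemma IsFlowQuotient.mfderiv_eq_zero {πW : P → W} {X' : VectorField (m + 1) P}
    (h : IsFlowQuotient πW X') (p : P) : mfderiv (𝓡 (m + 1)) (𝓡 m) πW p (X' p) = 0 := by
  have hs := h.submersion.isSubmersionAt p
  obtain ⟨γ, t, hγ, h0, -⟩ := (h.fibres p p).mp rfl
  exact mfderiv_eq_zero_of_integralCurve (hs.contMDiffAt.mdifferentiableAt (by simp)) hγ h0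
    fun s => ((h.fibres p (γ s)).mpr ⟨γ, s, hγ, h0, rfl⟩).symm

lemma IsPrincipalCircleBundle.mfderiv_eq_zero [MulAction Circle P] {πM : P → M}
    {Y : VectorField (m + 1) P} (h : IsPrincipalCircleBundle πM Y) (p : P) :
    mfderiv (𝓡 (m + 1)) (𝓡 m) πM p (Y p) = 0 := by
  have hs := h.submersion.isSubmersionAt p
  exact mfderiv_eq_zero_of_integralCurve (hs.contMDiffAt.mdifferentiableAt (by simp))
    (h.generator p) (by simp) fun s => ((h.fibres p _).mpr ⟨_, rfl⟩).symm

/-- Parametrizations `ρ` of `M` and `κ` of `W` by the same open set, induced by a local section of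
`P → W` that is horizontal at the point `v₀`. The form `η` is the pullback of the connection. -/
structure TwistChart (X : VectorField m M) (F : BilinField m M) (a : M → ℝ)
    (πM : P → M) (πW : P → W) (θ : CovectorField (m + 1) P)
    (ρ : EuclideanSpace ℝ (Fin m) → M) (κ : EuclideanSpace ℝ (Fin m) → W)
    (ψ : W → EuclideanSpace ℝ (Fin m)) (U : Set (EuclideanSpace ℝ (Fin m))) (Ω : Set W)
    (η : EuclideanSpace ℝ (Fin m) → EuclideanSpace ℝ (Fin m) →L[ℝ] ℝ)
    (v₀ : EuclideanSpace ℝ (Fin m)) : Prop where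
  mem : v₀ ∈ U
  paramM : IsParam ρ U
  paramW : IsParam κ U
  isOpen : IsOpen Ω
  contMDiff : ContMDiffOn (𝓡 m) (𝓡 m) ∞ ψ Ω
  left_inv : ∀ v ∈ U, κ v ∈ Ω ∧ ψ (κ v) = v
  right_inv : ∀ w ∈ Ω, κ (ψ w) = w
  smooth : ContDiffOn ℝ ∞ η U
  eq_zero : η v₀ = 0
  curvature : ∀ u w, fderiv ℝ η v₀ u w - fderiv ℝ η v₀ w u = pullBilin ρ F v₀ u w
  shear_injective : ∀ v ∈ U, ∀ u, shear η (pullVec ρ X) (fun v => a (ρ v)) v u = 0 → u = 0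
  lift : ∀ v ∈ U, ∃ q : P, πW q = κ v ∧ πM q = ρ v ∧
    (∀ u : EuclideanSpace ℝ (Fin m), ∃ z : TangentSpace (𝓡 (m + 1)) q, θ q z = 0 ∧
      (mfderiv (𝓡 (m + 1)) (𝓡 m) πW q z : EuclideanSpace ℝ (Fin m)) = pder κ v u ∧
      (mfderiv (𝓡 (m + 1)) (𝓡 m) πM q z : EuclideanSpace ℝ (Fin m)) =
        pder ρ v (shear η (pullVec ρ X) (fun v => a (ρ v)) v u)) ∧
    ∀ z : TangentSpace (𝓡 (m + 1)) q, θ q z = 0 → ∃ u : EuclideanSpace ℝ (Fin m),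
      (mfderiv (𝓡 (m + 1)) (𝓡 m) πW q z : EuclideanSpace ℝ (Fin m)) = pder κ v u ∧
      (mfderiv (𝓡 (m + 1)) (𝓡 m) πM q z : EuclideanSpace ℝ (Fin m)) =
        pder ρ v (shear η (pullVec ρ X) (fun v => a (ρ v)) v u)

lemma isInvertible_of_injective {l : EuclideanSpace ℝ (Fin m) →L[ℝ] EuclideanSpace ℝ (Fin m)}
    (h : ∀ u, l u = 0 → u = 0) : l.IsInvertible := by
  have hinj : Function.Injective l.toLinearMap :=
    LinearMap.ker_eq_bot.mp (LinearMap.ker_eq_bot'.mpr h)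
  refine ⟨(LinearEquiv.ofInjectiveEndo l.toLinearMap hinj).toContinuousLinearEquiv, ?_⟩
  ext u
  rfl

/-- A local section ι of πW composed with πM parametrizes `M`, because horizontal vectors inject
into both tangent spaces. Making ι affine in a submersion chart, and horizontal at the centre, gives
η = 0 there. -/
theorem exists_twistChart [MulAction Circle P] {X : VectorField m M} {F : BilinField m M}
    {a : M → ℝ} {πM : P → M} {πW : P → W} {θ : CovectorField (m + 1) P}
    (hT : IsTwist X F a πM πW θ) {g : BilinField m M} (hg : IsPseudoMetric g) (p : P) :
    ∃ ρ κ ψ U Ω η v₀, TwistChart X F a πM πW θ ρ κ ψ U Ω η v₀ ∧ ρ v₀ = πM p ∧ κ v₀ = πW p := by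
  obtain ⟨Y, X', hY, hθ, hX', hq⟩ := hT.exists_lift
  have dM : ∀ q, MDifferentiableAt (𝓡 (m + 1)) (𝓡 m) πM q := fun q => by
    have hs := hY.submersion.isSubmersionAt q
    exact hs.contMDiffAt.mdifferentiableAt (by simp)
  have cM : ContMDiff (𝓡 (m + 1)) (𝓡 m) ∞ πM := fun q => by
    have hs := hY.submersion.isSubmersionAt q
    exact hs.contMDiffAt
  have dW : ∀ q, MDifferentiableAt (𝓡 (m + 1)) (𝓡 m) πW q := fun q => by
    have hs := hq.submersion.isSubmersionAt q
    exact hs.contMDiffAt.mdifferentiableAt (by simp)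
  -- The kernel of dπM is spanned by Y, and θ(Y) = 1; in the next statement the kernel of dπW is
  -- spanned by X', and θ(X') = a ≠ 0.
  have injM : ∀ (q : P) (z : TangentSpace (𝓡 (m + 1)) q), θ q z = 0 →
      mfderiv (𝓡 (m + 1)) (𝓡 m) πM q z = 0 → z = 0 := fun q z h0 hz => by
    have hne : Y q ≠ 0 := fun h => by
      have := hθ.vertical q
      rw [h, map_zero] at this
      exact zero_ne_one this
    obtain ⟨c, rfl⟩ := exists_smul_eq_of_mfderiv_eq_zero (hY.submersion.isSubmersionAt q) (hY.mfderiv_eq_zero q)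
      hz hne
    rw [map_smul, hθ.vertical, smul_eq_mul, mul_one] at h0
    rw [h0, zero_smul]
  have injW : ∀ (q : P) (z : TangentSpace (𝓡 (m + 1)) q), θ q z = 0 →
      mfderiv (𝓡 (m + 1)) (𝓡 m) πW q z = 0 → z = 0 := fun q z h0 hz => by
    have hne : X' q ≠ 0 := fun h => by
      have := hX'.vertical q
      rw [h, map_zero] at this
      exact hT.data.ne_zero _ this.symm
    obtain ⟨c, rfl⟩ := exists_smul_eq_of_mfderiv_eq_zero (hq.submersion.isSubmersionAt q) (hq.mfderiv_eq_zero q)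
      hz hne
    rw [map_smul, hX'.vertical, smul_eq_mul, mul_eq_zero] at h0
    rw [h0.resolve_right (hT.data.ne_zero _), zero_smul]
  obtain ⟨χ, O, κ, ψ, U, Ω, pr, j, e, s, he, rfl⟩ := exists_submersionChart (hq.submersion.isSubmersionAt p)
  have prX : ∀ x ∈ O, pr (pullVec χ X' x) = 0 := fun x hx => by
    refine s.cod.pder_injective (s.mapsTo x hx) ?_
    rw [map_zero, ← s.mfderiv_apply hx (dW _)]
    exact (congrArg (mfderiv (𝓡 (m + 1)) (𝓡 m) πW (χ x)) (s.dom.pder_pullVec hx X')).trans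
      (hq.mfderiv_eq_zero _)
  have θX : ∀ x ∈ O, pullCov χ θ x (pullVec χ X' x) = a (πM (χ x)) := fun x hx =>
    (s.dom.cov_eq hx θ X').symm.trans (hX'.vertical _)
  have ha := hT.data.ne_zero
  -- The linear section j is corrected along X', which projects to zero on W, so as to be horizontal
  -- at e.
  let j' : EuclideanSpace ℝ (Fin m) →L[ℝ] EuclideanSpace ℝ (Fin (m + 1)) :=
    j - ((pullCov χ θ e).comp j).smulRight ((a (πM (χ e)))⁻¹ • pullVec χ X' e)
  have hj' : ∀ u, j' u = j u - pullCov χ θ e (j u) • (a (πM (χ e)))⁻¹ • pullVec χ X' e :=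
    fun u => by simp [j']
  have pr_j' : ∀ u, pr (j' u) = u := fun u => by
    rw [hj', map_sub, map_smul, map_smul, prX e he, s.pr_j, smul_zero, smul_zero, sub_zero]
  have θ_j' : ∀ u, pullCov χ θ e (j' u) = 0 := fun u => by
    rw [hj', map_sub, map_smul, map_smul, θX e he, smul_eq_mul, smul_eq_mul, inv_mul_cancel₀ (ha _),
      mul_one, sub_self]
  let ι : EuclideanSpace ℝ (Fin m) → EuclideanSpace ℝ (Fin (m + 1)) := fun v => e + j' (v - pr e)
  have ι₀ : ι (pr e) = e := by simp [ι]
  have cι : ContDiff ℝ ∞ ι := contDiff_const.add (j'.contDiff.comp (contDiff_id.sub contDiff_const))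
  have dι : ∀ v, fderiv ℝ ι v = j' := fun v => by
    refine HasFDerivAt.fderiv ?_
    have h1 : HasFDerivAt (fun v : EuclideanSpace ℝ (Fin m) => v - pr e)
        (ContinuousLinearMap.id ℝ _) v := (hasFDerivAt_id v).sub_const _
    have h2 := (j'.hasFDerivAt (x := v - pr e)).comp v h1
    rw [ContinuousLinearMap.comp_id] at h2
    exact h2.const_add e
  have prι : ∀ v, pr (ι v) = v := fun v => by simp [ι, map_add, pr_j']
  let U₁ : Set (EuclideanSpace ℝ (Fin m)) := U ∩ ι ⁻¹' O
  have oU₁ : IsOpen U₁ := s.cod.isOpen.inter (s.dom.isOpen.preimage cι.continuous)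
  let ρ : EuclideanSpace ℝ (Fin m) → M := fun v => πM (χ (ι v))
  have cρ : ContMDiffOn (𝓡 m) (𝓡 m) ∞ ρ U₁ := cM.comp_contMDiffOn
    (s.dom.contMDiff.comp cι.contMDiff.contMDiffOn fun v hv => hv.2)
  have dρ : ∀ v ∈ U₁, ∀ u, pder (m := m) ρ v u =
      mfderiv (𝓡 (m + 1)) (𝓡 m) πM (χ (ι v)) (pder (m := m + 1) χ (ι v) (j' u)) := by
    intro v hv u
    have h1 : HasMFDerivAt (𝓡 m) (𝓡 (m + 1)) ι v j' := by
      have := (cι.differentiable (by simp) v).hasFDerivAt.hasMFDerivAt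
      rwa [dι] at this
    have h2 := ((dM (χ (ι v))).hasMFDerivAt.comp v
      ((s.dom.mdifferentiableAt hv.2).hasMFDerivAt.comp v h1)).mfderiv
    exact congrArg (fun l : EuclideanSpace ℝ (Fin m) →L[ℝ] EuclideanSpace ℝ (Fin m) => l u) h2
  -- Invertibility of the derivative of ρ must be an open condition. The pullback of `g` is a
  -- continuous map into a fixed space of bilinear forms, and its invertibility forces the
  -- derivative of ρ to be injective.
  let U₂ : Set (EuclideanSpace ℝ (Fin m)) := U₁ ∩ pullBilin ρ g ⁻¹'
    Set.range ((↑) : (EuclideanSpace ℝ (Fin m) ≃L[ℝ] EuclideanSpace ℝ (Fin m) →L[ℝ] ℝ) →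
      EuclideanSpace ℝ (Fin m) →L[ℝ] EuclideanSpace ℝ (Fin m) →L[ℝ] ℝ)
  have oU₂ : IsOpen U₂ := (contDiffOn_pullBilin hg.smooth oU₁ cρ).continuousOn.isOpen_inter_preimage
    oU₁ ContinuousLinearEquiv.isOpen
  have mem₁ : pr e ∈ U₁ := ⟨s.mapsTo e he, by change ι (pr e) ∈ O; rwa [ι₀]⟩
  have inv₀ : (pder (m := m) ρ (pr e)).IsInvertible := by
    refine isInvertible_of_injective fun u hu => ?_
    rw [dρ _ mem₁, ι₀] at hu
    have h1 : pder (m := m + 1) χ e (j' u) = 0 := injM _ _ (θ_j' u) hu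
    rw [← pr_j' u, s.dom.pder_injective he (h1.trans (map_zero _).symm), map_zero]
  have mem₂ : pr e ∈ U₂ := by
    refine ⟨mem₁, isInvertible_of_nondeg fun u hu => ?_⟩
    refine inv₀.injective ?_
    rw [map_zero]
    refine hg.nondegenerate (ρ (pr e)) _ fun w => ?_
    obtain ⟨w', rfl⟩ := inv₀.surjective w
    exact hu w'
  have pM : IsParam ρ U₂ := by
    refine ⟨oU₂, cρ.mono Set.inter_subset_left, fun v hv => isInvertible_of_injective fun u hu => ?_⟩
    obtain ⟨l, hl⟩ : (pullBilin ρ g v).IsInvertible := hv.2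
    have h1 : pullBilin ρ g v u = 0 := by
      ext w
      rw [pullBilin_apply]
      refine (congrArg (fun x => g (ρ v) x (pder (m := m) ρ v w)) hu).trans ?_
      exact congrArg (fun l : EuclideanSpace ℝ (Fin m) →L[ℝ] ℝ => l _) (map_zero (g (ρ v)))
    rw [← hl] at h1
    exact l.map_eq_zero_iff.mp h1
  let η : EuclideanSpace ℝ (Fin m) → EuclideanSpace ℝ (Fin m) →L[ℝ] ℝ :=
    fun v => (pullCov χ θ (ι v)).comp j'
  let E := shear η (pullVec ρ X) (fun v => a (ρ v))
  -- z v u is the horizontal lift of the vector u on W: the section direction corrected along X' by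
  -- η(u)/a. Its image on M is therefore u - (η(u)/a) X, the shear of u.
  let z : EuclideanSpace ℝ (Fin m) → EuclideanSpace ℝ (Fin m) → EuclideanSpace ℝ (Fin (m + 1)) :=
    fun v u => j' u - η v u • (a (ρ v))⁻¹ • pullVec χ X' (ι v)
  have θz : ∀ v ∈ U₁, ∀ u, pullCov χ θ (ι v) (z v u) = 0 := fun v hv u => by
    simp only [z]
    rw [map_sub, map_smul, map_smul, θX _ hv.2, smul_eq_mul, smul_eq_mul]
    change _ - η v u * ((a (ρ v))⁻¹ * a (ρ v)) = 0
    rw [inv_mul_cancel₀ (ha _), mul_one]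
    exact sub_self _
  have Wz : ∀ v ∈ U₁, ∀ u, (mfderiv (𝓡 (m + 1)) (𝓡 m) πW (χ (ι v))
      (pder (m := m + 1) χ (ι v) (z v u)) : EuclideanSpace ℝ (Fin m)) = pder (m := m) κ v u := by
    intro v hv u
    rw [s.mfderiv_apply hv.2 (dW _), prι, map_sub, map_smul, map_smul, prX _ hv.2, pr_j', smul_zero,
      smul_zero, sub_zero]
  have Mz : ∀ v ∈ U₂, ∀ u, (mfderiv (𝓡 (m + 1)) (𝓡 m) πM (χ (ι v))
      (pder (m := m + 1) χ (ι v) (z v u)) : EuclideanSpace ℝ (Fin m)) =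
      pder (m := m) ρ v (E v u) := by
    intro v hv u
    have h1 : pder (m := m) ρ v (E v u) = pder (m := m) ρ v u
        - η v u • (a (ρ v))⁻¹ • pder (m := m) ρ v (pullVec ρ X v) := by
      rw [shear_apply, map_sub, map_smul, map_smul]
    have h2 : pder (m := m) ρ v (pullVec ρ X v) = mfderiv (𝓡 (m + 1)) (𝓡 m) πM (χ (ι v))
        (pder (m := m + 1) χ (ι v) (pullVec χ X' (ι v))) :=
      (pM.pder_pullVec hv X).trans ((hX'.projects (χ (ι v))).symm.trans
        (congrArg (mfderiv (𝓡 (m + 1)) (𝓡 m) πM (χ (ι v)))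
          (s.dom.pder_pullVec hv.1.2 X')).symm)
    rw [h1, dρ v hv.1, h2]
    simp only [z]
    rw [map_sub, map_smul, map_smul]
    exact (map_sub _ _ _).trans (congrArg₂ (· - ·) rfl ((map_smul _ _ _).trans
      (congrArg (η v u • ·) (map_smul _ _ _))))
  refine ⟨ρ, κ, ψ, U₂, Ω, η, pr e, ⟨mem₂, pM, ⟨oU₂, s.cod.contMDiff.mono fun v hv => hv.1.1,
    fun v hv => s.cod.invertible v hv.1.1⟩, s.isOpen, s.contMDiff, fun v hv => s.left_inv v hv.1.1,
    s.right_inv, ?_, ?_, fun u w => ?_, fun v hv u hu => ?_, fun v hv => ?_⟩, ?_, ?_⟩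
  · exact ContDiffOn.clm_comp ((contDiffOn_pullCov hθ.smooth s.dom.isOpen s.dom.contMDiff).comp
      cι.contDiffOn fun v hv => hv.1.2) contDiffOn_const
  · ext u
    simp only [η, ι₀]
    exact θ_j' u
  · have hd := s.dom.differentiableAt_pullCov he hθ.smooth
    -- ι is affine with linear part j', so the derivative of η at the centre is that of θ on the
    -- image of j'; its skew part is dθ.
    have hη : ∀ u w, fderiv ℝ η (pr e) u w = fderiv ℝ (pullCov χ θ) e (j' u) (j' w) := fun u w => by
      have h1 : HasFDerivAt (fun v => pullCov χ θ (ι v)) ((fderiv ℝ (pullCov χ θ) e).comp j')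
          (pr e) := by
        have h2 : HasFDerivAt ι j' (pr e) := by
          rw [← dι (pr e)]; exact (cι.differentiable (by simp) _).hasFDerivAt
        rw [← ι₀] at hd
        have h3 := hd.hasFDerivAt.comp (pr e) h2
        rwa [ι₀] at h3
      rw [(h1.clm_comp (hasFDerivAt_const j' (pr e))).fderiv]
      simp
    rw [hη, hη]
    obtain ⟨A, hA, hA'⟩ := s.dom.exists_pullVec_eq he (j' u)
    obtain ⟨B, hB, hB'⟩ := s.dom.exists_pullVec_eq he (j' w)
    have h1 := s.dom.extDerivOne_eq he (hθ.smooth.covDiffAt _) hd hA hB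
    rw [hA', hB', hθ.curvature _ _ _ hA hB] at h1
    rw [← h1, pullBilin_apply, dρ _ mem₁, dρ _ mem₁, ← hA', ← hB', ι₀]
    have hA2 := s.dom.pder_pullVec he A
    have hB2 := s.dom.pder_pullVec he B
    have hρ : ρ (pr e) = πM (χ e) := by simp only [ρ, ι₀]
    rw [hρ]
    exact (congrArg₂ (fun x y => F (πM (χ e)) (mfderiv (𝓡 (m + 1)) (𝓡 m) πM (χ e) x)
      (mfderiv (𝓡 (m + 1)) (𝓡 m) πM (χ e) y)) hA2 hB2).symm
  · have h1 := Mz v hv u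
    change E v u = 0 at hu
    rw [hu, map_zero] at h1
    have h2 : pder (m := m + 1) χ (ι v) (z v u) = 0 := injM _ _ (θz v hv.1 u) h1
    have h3 := Wz v hv.1 u
    rw [h2] at h3
    exact s.cod.pder_injective hv.1.1 (h3.symm.trans ((map_zero _).trans (map_zero _).symm))
  · refine ⟨χ (ι v), (s.eq _ hv.1.2).trans (by rw [prι]), rfl, fun u => ⟨pder (m := m + 1) χ (ι v)
      (z v u), θz v hv.1 u, Wz v hv.1 u, Mz v hv u⟩, fun y hy => ?_⟩
    obtain ⟨u, hu⟩ := (s.cod.invertible v hv.1.1).surjective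
      (mfderiv (𝓡 (m + 1)) (𝓡 m) πW (χ (ι v)) y)
    let y' : TangentSpace (𝓡 (m + 1)) (χ (ι v)) := pder (m := m + 1) χ (ι v) (z v u)
    have h1 : y - y' = 0 := by
      refine injW _ _ ?_ ?_
      · exact (map_sub (θ (χ (ι v))) _ _).trans (by rw [hy, zero_sub, neg_eq_zero]; exact θz v hv.1 u)
      · exact (map_sub _ _ _).trans (sub_eq_zero.mpr (hu.symm.trans (Wz v hv.1 u).symm))
    rw [sub_eq_zero] at h1
    exact ⟨u, hu.symm, (congrArg (mfderiv (𝓡 (m + 1)) (𝓡 m) πM (χ (ι v))) h1).trans (Mz v hv u)⟩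
  · simp only [ρ, ι₀]
  · exact (s.eq e he).symm

end TwistModel

/-! ## First-order data of a twist -/

section Flat

variable {V : Type*} [NormedAddCommGroup V] [NormedSpace ℝ V]

lemma differentiableAt_shear {η : V → V →L[ℝ] ℝ}
    {X : V → V} {a : V → ℝ}
    {v : V} (hη : DifferentiableAt ℝ η v) (hX : DifferentiableAt ℝ X v)
    (ha : DifferentiableAt ℝ a v) (ha₀ : a v ≠ 0) : DifferentiableAt ℝ (shear η X a) v := by
  unfold shear
  have h1 : DifferentiableAt ℝ (fun v => (a v)⁻¹ • X v) v := (ha.inv ha₀).smul hX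
  exact (differentiableAt_const _).sub ((((ContinuousLinearMap.smulRightL ℝ V V).differentiableAt).comp
    v hη).clm_apply h1)

lemma shear_eq_id {η : V → V →L[ℝ] ℝ}
    {X : V → V} {a : V → ℝ}
    {v : V} (h₀ : η v = 0) : shear η X a v = ContinuousLinearMap.id ℝ _ := by
  ext1 u
  rw [shear_apply, h₀]
  simp

/-- Where η vanishes the derivatives of X and a do not contribute. -/
lemma fderiv_shear {η : V → V →L[ℝ] ℝ}
    {X : V → V} {a : V → ℝ}
    {v : V} (hη : DifferentiableAt ℝ η v) (hX : DifferentiableAt ℝ X v)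
    (ha : DifferentiableAt ℝ a v) (ha₀ : a v ≠ 0) (h₀ : η v = 0) (u x : V) :
    fderiv ℝ (shear η X a) v u x = -(fderiv ℝ η v u x / a v) • X v := by
  have h1 : DifferentiableAt ℝ (fun v => (a v)⁻¹ • X v) v := (ha.inv ha₀).smul hX
  have h2 : fderiv ℝ (fun v => shear η X a v x) v u = fderiv ℝ (shear η X a) v u x := by
    have := fderiv_end_apply (differentiableAt_shear hη hX ha ha₀) (differentiableAt_const x) u
    simpa using this
  have h3 : DifferentiableAt ℝ (fun v => η v x) v := hη.clm_apply (differentiableAt_const x)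
  have h4 : HasFDerivAt (fun v => shear η X a v x)
      (-(η v x • fderiv ℝ (fun v => (a v)⁻¹ • X v) v
        + (fderiv ℝ (fun v => η v x) v).smulRight ((a v)⁻¹ • X v))) v := by
    simp only [shear_apply]
    exact (h3.hasFDerivAt.smul h1.hasFDerivAt).const_sub x
  have h5 : fderiv ℝ (fun v => η v x) v u = fderiv ℝ η v u x := by
    have := fderiv_cov_apply hη (differentiableAt_const x) u
    simpa using this
  rw [← h2, h4.fderiv, h₀]
  simp [h5, smul_smul, div_eq_mul_inv]

namespace RotJet

variable {G : V → V →L[ℝ] V →L[ℝ] ℝ}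
  {I J K : V → V →L[ℝ] V}
  {X : V → V} {v : V}
  {Γ : V →L[ℝ] V →L[ℝ] V}
  {L : V →L[ℝ] V}

/-- For parallel T the covariant derivative of T X is T (L - I/2). The choices id, I, J, K for T
give the derivatives of the four one-forms composing g_α, read through E. -/
lemma hasFDerivAt_rotated (r : RotJet G I J K X v Γ L)
    {T : V → V →L[ℝ] V}
    (hT : DifferentiableAt ℝ T v)
    (dT : ∀ u, fderiv ℝ T v u = (T v).comp (Γ u) - (Γ u).comp (T v))
    {E : V → V →L[ℝ] V}
    (hE : DifferentiableAt ℝ E v) (hE₀ : E v = ContinuousLinearMap.id ℝ _)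
    (x : V) :
    DifferentiableAt ℝ (fun v => G v (T v (X v)) (E v x)) v ∧ ∀ u,
    fderiv ℝ (fun v => G v (T v (X v)) (E v x)) v u =
      G v (T v (L u - (1 / 2 : ℝ) • I v u)) x + G v (T v (X v)) (Γ u x + fderiv ℝ E v u x) := by
  have hTX : DifferentiableAt ℝ (fun v => T v (X v)) v := hT.clm_apply r.diff_X
  have hEx : DifferentiableAt ℝ (fun v => E v x) v := hE.clm_apply (differentiableAt_const x)
  refine ⟨(r.diff_G.clm_apply hTX).clm_apply hEx, fun u => ?_⟩
  have h1 : fderiv ℝ (fun v => E v x) v u = fderiv ℝ E v u x := by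
    have := fderiv_end_apply hE (differentiableAt_const x) u
    simpa using this
  rw [fderiv_bilin_apply r.diff_G hTX hEx, h1, fderiv_end_apply hT r.diff_X, dT, r.deriv_X,
    r.compat, hE₀]
  simp only [ContinuousLinearMap.id_apply, sub_apply,
    ContinuousLinearMap.comp_apply, map_sub, map_add, add_apply, map_smul,
    smul_apply]
  ring

-- The metric on W is the deformation read through E = id - η ⊗ X/a. Differentiating this at the
-- base point, where E = id, and comparing with the Christoffel symbols of both metrics gives the
-- metric equation for S = Γ_W - dE - Γ. As both connections are torsion-free, the torsion of S
-- comes only from dE, whose skew part is -(F/a) X.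
set_option maxHeartbeats 1000000 in
theorem twistJet (r : RotJet G I J K X v Γ L)
    {η : V → V →L[ℝ] ℝ}
    {f h a : V → ℝ} (hη : DifferentiableAt ℝ η v) (h₀ : η v = 0)
    (ha : DifferentiableAt ℝ a v) (ha₀ : a v ≠ 0) (hf : DifferentiableAt ℝ f v)
    (hh : DifferentiableAt ℝ h v)
    {F : V →L[ℝ] V →L[ℝ] ℝ}
    (hF : ∀ u w, fderiv ℝ η v u w - fderiv ℝ η v w u = F u w)
    {H : V → V →L[ℝ] V →L[ℝ] ℝ}
    (hH : DifferentiableAt ℝ H v)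
    (eq : ∀ᶠ w in nhds v, ∀ x y, H w x y = deform (G w) (I w) (J w) (K w) (X w) (f w) (h w)
      (shear η X a w x) (shear η X a w y))
    {ΓW : V →L[ℝ] V →L[ℝ] V}
    (symm : ∀ u w, ΓW u w = ΓW w u)
    (compat : ∀ u x y, fderiv ℝ H v u x y = H v (ΓW u x) y + H v x (ΓW u y)) :
    TwistJet (G v) (I v) (J v) (K v) (X v) L (f v) (h v) (a v) (fderiv ℝ f v) (fderiv ℝ h v) F
      (ΓW - fderiv ℝ (shear η X a) v - Γ) where
  quat := r.quat.self_of_nhds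
  L_I := r.L_I
  L_J := r.L_J
  skew := r.skew
  torsion u w := by
    simp only [sub_apply, fderiv_shear hη r.diff_X ha ha₀ h₀]
    rw [symm w u, r.symm w u, ← hF, sub_div, sub_smul]
    module
  metric u x y := by
    have hE := differentiableAt_shear hη r.diff_X ha ha₀
    have hE₀ : shear η X a v = ContinuousLinearMap.id ℝ _ := shear_eq_id h₀
    have hx : ∀ x, DifferentiableAt ℝ (fun v => shear η X a v x) v := fun x =>
      hE.clm_apply (differentiableAt_const x)
    have hx' : ∀ x, fderiv ℝ (fun v => shear η X a v x) v u = fderiv ℝ (shear η X a) v u x :=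
      fun x => by
        have := fderiv_end_apply hE (differentiableAt_const x) u
        simpa using this
    have hG := (r.diff_G.clm_apply (hx x)).clm_apply (hx y)
    have dG := fderiv_bilin_apply r.diff_G (hx x) (hx y) u
    have h1 := fun x => r.hasFDerivAt_rotated (T := fun _ => ContinuousLinearMap.id ℝ _)
      (differentiableAt_const _) (fun u => by ext; simp) hE hE₀ x
    simp only [ContinuousLinearMap.id_apply] at h1
    have h2 := fun x => r.hasFDerivAt_rotated r.diff_I r.deriv_I hE hE₀ x
    have h3 := fun x => r.hasFDerivAt_rotated r.diff_J r.deriv_J hE hE₀ x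
    have h4 := fun x => r.hasFDerivAt_rotated r.diff_K r.deriv_K hE hE₀ x
    have key : fderiv ℝ (fun w => H w x y) v u = fderiv ℝ H v u x y := by
      have := fderiv_bilin_apply hH (differentiableAt_const x) (differentiableAt_const y) u
      simpa using this
    have hev : (fun w => H w x y) =ᶠ[nhds v] fun w => deform (G w) (I w) (J w) (K w) (X w) (f w) (h w)
      (shear η X a w x) (shear η X a w y) := eq.mono fun w hw => hw x y
    have hD := (hf.hasFDerivAt.mul hG.hasFDerivAt).add (hh.hasFDerivAt.mul
      (((((h1 x).1.hasFDerivAt.mul (h1 y).1.hasFDerivAt).add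
        ((h2 x).1.hasFDerivAt.mul (h2 y).1.hasFDerivAt)).add
        ((h3 x).1.hasFDerivAt.mul (h3 y).1.hasFDerivAt)).add
        ((h4 x).1.hasFDerivAt.mul (h4 y).1.hasFDerivAt)))
    have hD' := (hD.congr_of_eventuallyEq hev).fderiv
    have hD2 := congrArg (fun l : V →L[ℝ] ℝ => l u) hD'
    have e0 := eq.self_of_nhds
    simp only [hE₀, ContinuousLinearMap.id_apply] at e0
    simp only [add_apply, smul_apply, Pi.add_apply, Pi.mul_apply, dG, (h1 _).2, (h2 _).2,
      (h3 _).2, (h4 _).2, hE₀, hx', key, compat, e0, ContinuousLinearMap.id_apply, smul_eq_mul,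
      r.compat] at hD2
    simp only [deform, galpha, nablaDeform, sub_apply, map_sub, map_add,
      add_apply, map_smul, smul_apply] at hD2 ⊢
    linear_combination hD2

end RotJet

/-! ### The orthogonal complement of the quaternionic line -/

section LinearAlgebra

variable {g : V →L[ℝ] V →L[ℝ] ℝ} {I J K : V →L[ℝ] V} {X : V}

/-- Orthogonal projection to the complement of the quaternionic line of a non-null vector. -/
lemma QuatHerm.exists_quatPerp_sub (q : QuatHerm g I J K) (hn : g X X ≠ 0) (w : V) :
    ∃ e, QuatPerp g I J K X e ∧ ∀ d, QuatPerp g I J K X d → g d w = g d e := by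
  refine ⟨w - (g X w / g X X) • X - (g (I X) w / g X X) • I X 
    - (g (J X) w / g X X) • J X - (g (K X) w / g X X) • K X, ⟨?_, ?_, ?_, ?_⟩, fun d hd => ?_⟩
  pick_goal 5
  · rw [q.symm d, q.symm d]
    simp [hd.r, hd.i, hd.j, hd.k]
  all_goals
    simp only [map_sub, map_smul, smul_eq_mul, q.gI, q.gJ, q.gK, q.II, q.JJ, q.KK, q.IJ, q.JI, q.IK,
      q.KI, q.JK, q.KJ, map_neg, neg_apply, q.I_self, q.J_self, q.K_self]
    field_simp
    ring

/-- If all vectors of the complement were null, polarization and nondegeneracy would make the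
complement zero, and the four forms g(X, ·), g(IX, ·), g(JX, ·), g(KX, ·) would embed V in ℝ⁴. -/
lemma QuatHerm.exists_quatPerp_ne_zero [FiniteDimensional ℝ V] (q : QuatHerm g I J K)
    (hn : g X X ≠ 0) (hV : 4 < Module.finrank ℝ V) :
    ∃ e, QuatPerp g I J K X e ∧ g e e ≠ 0 := by
  by_contra! hc
  have h0 : ∀ d, QuatPerp g I J K X d → d = 0 := fun d hd => by
    refine q.nondeg d fun w => ?_
    obtain ⟨e, he, hw⟩ := q.exists_quatPerp_sub hn w
    have h1 := hc (d + e) ⟨by simp [hd.r, he.r], by simp [hd.i, he.i], by simp [hd.j, he.j],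
      by simp [hd.k, he.k]⟩
    simp only [map_add, add_apply, hc d hd, hc e he, q.symm e d] at h1
    rw [hw d hd]
    linarith
  let l : V →ₗ[ℝ] Fin 4 → ℝ := LinearMap.pi ![(g X).toLinearMap, (g (I X)).toLinearMap,
    (g (J X)).toLinearMap, (g (K X)).toLinearMap]
  have hl : Function.Injective l := (injective_iff_map_eq_zero l).mpr fun d hd => by
    refine h0 d ⟨?_, ?_, ?_, ?_⟩
    · exact congrFun hd 0
    · exact congrFun hd 1
    · exact congrFun hd 2
    · exact congrFun hd 3
  have := LinearMap.finrank_le_finrank_of_injective hl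
  simp at this
  omega

/-- A nondegenerate elementary deformation has nonzero coefficients. -/
lemma QuatHerm.deform_ne_zero (q : QuatHerm g I J K) {f h : ℝ} {e : V}
    (hn : g X X ≠ 0) (he : QuatPerp g I J K X e) (hee : g e e ≠ 0)
    (hd : ∀ u, (∀ w, deform g I J K X f h u w = 0) → u = 0) : f ≠ 0 ∧ f + h * g X X ≠ 0 := by
  constructor
  · rintro rfl
    refine hee ?_
    rw [hd e fun w => ?_, map_zero]
    simp [deform, galpha, he.r, he.i, he.j, he.k]
  · intro hq
    refine hn ?_
    rw [hd X fun w => ?_, map_zero]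
    simp only [deform, galpha, q.I_self, q.J_self, q.K_self]
    linear_combination g X w * hq

end LinearAlgebra

end Flat

/-! ## The first-order data of a twist in a twist chart -/

section

variable {m : ℕ} {N : Type*} [TopologicalSpace N] [ChartedSpace (EuclideanSpace ℝ (Fin m)) N]
  {g : BilinField m N} {I J K : EndField m N} {X : VectorField m N}

namespace IsParam

variable {κ : EuclideanSpace ℝ (Fin m) → N} {U : Set (EuclideanSpace ℝ (Fin m))}
  (c : IsParam κ U) {v : EuclideanSpace ℝ (Fin m)} (hv : v ∈ U)
include c hv

lemma elemDeform_eq (h₁ : ∀ x, IsQuaternionHermitianAt g I J K x) (f h : N → ℝ)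
    (u w : EuclideanSpace ℝ (Fin m)) :
    elemDeform g I J K X f h (κ v) (pder (m := m) κ v u) (pder (m := m) κ v w) =
      deform (pullBilin κ g v) (pullEnd κ I v) (pullEnd κ J v) (pullEnd κ K v) (pullVec κ X v)
        (f (κ v)) (h (κ v)) u w := by
  have h0 : ∀ u, alphaZero g X (κ v) (pder (m := m) κ v u) =
      pullBilin κ g v (pullVec κ X v) u := fun u =>
    (congrArg (fun l : EuclideanSpace ℝ (Fin m) →L[ℝ] ℝ => l u) (c.pullCov_alphaZero hv X))
  have hI := fun u => c.alphaOf_eq hv (X := X) (fun x => (h₁ x).sq_I) (fun x => (h₁ x).herm_I) u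
  have hJ := fun u => c.alphaOf_eq hv (X := X) (fun x => (h₁ x).sq_J) (fun x => (h₁ x).herm_J) u
  have hK := fun u => c.alphaOf_eq hv (X := X) (fun x => (h₁ x).sq_K) (fun x => (h₁ x).herm_K) u
  unfold elemDeform gAlpha
  simp only [deform, galpha, h0, hI, hJ, hK]
  rfl

end IsParam

end

/-- All tangent spaces are the model space by definition, so one endomorphism can be read at two
equal points without a transport. -/
lemma mem_congr_point {m : ℕ} {W : Type*} [TopologicalSpace W]
    [ChartedSpace (EuclideanSpace ℝ (Fin m)) W]
    (QW : (w : W) → Submodule ℝ (TangentSpace (𝓡 m) w →L[ℝ] TangentSpace (𝓡 m) w)) {w w' : W}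
    (h : w = w') (L : EuclideanSpace ℝ (Fin m) →L[ℝ] EuclideanSpace ℝ (Fin m)) :
    L ∈ (QW w).carrier ↔ L ∈ (QW w').carrier := by
  subst h; rfl

namespace TwistChart

variable {m : ℕ}
  {M : Type*} [TopologicalSpace M] [ChartedSpace (EuclideanSpace ℝ (Fin m)) M]
  {P : Type*} [TopologicalSpace P] [ChartedSpace (EuclideanSpace ℝ (Fin (m + 1))) P]
  {W : Type*} [TopologicalSpace W] [ChartedSpace (EuclideanSpace ℝ (Fin m)) W]
  {X : VectorField m M} {F : BilinField m M} {a : M → ℝ} {πM : P → M} {πW : P → W}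
  {θ : CovectorField (m + 1) P} {ρ : EuclideanSpace ℝ (Fin m) → M}
  {κ : EuclideanSpace ℝ (Fin m) → W} {ψ : W → EuclideanSpace ℝ (Fin m)}
  {U : Set (EuclideanSpace ℝ (Fin m))} {Ω : Set W}
  {η : EuclideanSpace ℝ (Fin m) → EuclideanSpace ℝ (Fin m) →L[ℝ] ℝ}
  {v₀ : EuclideanSpace ℝ (Fin m)} 
  {g : BilinField m M} {I J K : EndField m M} {v : EuclideanSpace ℝ (Fin m)}

section

variable (t : TwistChart X F a πM πW θ ρ κ ψ U Ω η v₀) (hv : v ∈ U)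
include t hv

/-- Vectors on W are lifted horizontally; their images on M are the sheared vectors. -/
lemma pullBilin_eq {b : (x : M) → TangentSpace (𝓡 m) x → TangentSpace (𝓡 m) x → ℝ}
    {gW : BilinField m W} (hrel : HRelatedBilin πM πW θ b gW) (u w : EuclideanSpace ℝ (Fin m)) :
    pullBilin κ gW v u w = b (ρ v)
      (pder (m := m) ρ v (shear η (pullVec ρ X) (fun v => a (ρ v)) v u))
      (pder (m := m) ρ v (shear η (pullVec ρ X) (fun v => a (ρ v)) v w)) := by
  obtain ⟨q, hW, hM, hu, -⟩ := t.lift v hv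
  obtain ⟨y, hy, yW, yM⟩ := hu u
  obtain ⟨z, hz, zW, zM⟩ := hu w
  have h := hrel q y z hy hz
  have h1 : ∀ x x' : EuclideanSpace ℝ (Fin m), gW (πW q) x x' = gW (κ v) x x' := fun x x' =>
    congrArg (fun p => (gW p : EuclideanSpace ℝ (Fin m) →L[ℝ] EuclideanSpace ℝ (Fin m) →L[ℝ] ℝ)
      x x') hW
  have h2 : ∀ x x' : EuclideanSpace ℝ (Fin m), b (πM q) x x' = b (ρ v) x x' := fun x x' =>
    congrArg (fun p => (b p : EuclideanSpace ℝ (Fin m) → EuclideanSpace ℝ (Fin m) → ℝ) x x') hM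
  rw [← yM, ← zM]
  refine Eq.trans ?_ (h.trans (h2 _ _))
  refine Eq.trans ?_ (h1 _ _).symm
  rw [yW, zW]
  rfl

lemma isInvertible_shear :
    (shear η (pullVec ρ X) (fun v => a (ρ v)) v).IsInvertible :=
  isInvertible_of_injective (t.shear_injective v hv)

/-- In the chart the bundle on W is the conjugate of ⟨I, J, K⟩ by the shear. Writing this as E S = R
E avoids the inverse of E. -/
lemma mem_iff {QW : (w : W) → Submodule ℝ (TangentSpace (𝓡 m) w →L[ℝ] TangentSpace (𝓡 m) w)}
    (hrel : HRelatedBundle πM πW θ (quatSpan I J K) QW)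
    {L : TangentSpace (𝓡 m) (κ v) →L[ℝ] TangentSpace (𝓡 m) (κ v)}
    {S : EuclideanSpace ℝ (Fin m) →L[ℝ] EuclideanSpace ℝ (Fin m)}
    (hS : ∀ u, pder (m := m) κ v (S u) = L (pder (m := m) κ v u)) :
    L ∈ QW (κ v) ↔ ∃ R ∈ Submodule.span ℝ {pullEnd ρ I v, pullEnd ρ J v, pullEnd ρ K v},
      (shear η (pullVec ρ X) (fun v => a (ρ v)) v).comp S =
        R.comp (shear η (pullVec ρ X) (fun v => a (ρ v)) v) := by
  set E := shear η (pullVec ρ X) (fun v => a (ρ v)) v with hE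
  obtain ⟨q, hW, hM, hu, hu'⟩ := t.lift v hv
  have h1 : L ∈ QW (κ v) ↔ ∃ T ∈ quatSpan I J K (πM q), ∀ u v : TangentSpace (𝓡 (m + 1)) q,
      θ q u = 0 → θ q v = 0 →
      mfderiv (𝓡 (m + 1)) (𝓡 m) πM q v = T (mfderiv (𝓡 (m + 1)) (𝓡 m) πM q u) →
      (mfderiv (𝓡 (m + 1)) (𝓡 m) πW q v : EuclideanSpace ℝ (Fin m)) =
        (L : EuclideanSpace ℝ (Fin m) →L[ℝ] EuclideanSpace ℝ (Fin m))
          (mfderiv (𝓡 (m + 1)) (𝓡 m) πW q u) :=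
    (mem_congr_point QW hW.symm L).trans (hrel q L)
  have hspan : ∀ r s t : ℝ, ∀ x : EuclideanSpace ℝ (Fin m),
      pder (m := m) ρ v ((r • pullEnd ρ I v + s • pullEnd ρ J v + t • pullEnd ρ K v) x) =
        ((r • I (πM q) + s • J (πM q) + t • K (πM q) :
          EuclideanSpace ℝ (Fin m) →L[ℝ] EuclideanSpace ℝ (Fin m))) (pder (m := m) ρ v x) := by
    intro r s t' x
    have h2 : ∀ T : EndField m M, pder (m := m) ρ v (pullEnd ρ T v x) =
        (T (πM q) : EuclideanSpace ℝ (Fin m) →L[ℝ] EuclideanSpace ℝ (Fin m))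
          (pder (m := m) ρ v x) := fun T =>
      (t.paramM.pder_pullEnd hv T x).trans (congrArg (fun p =>
        (T p : EuclideanSpace ℝ (Fin m) →L[ℝ] EuclideanSpace ℝ (Fin m)) (pder (m := m) ρ v x)) hM.symm)
    simp only [add_apply, smul_apply, map_add, map_smul, h2]
    rfl
  rw [h1]
  constructor
  · rintro ⟨T, hT, h⟩
    obtain ⟨r, s, t', rfl⟩ := mem_span_triple_iff.mp hT
    refine ⟨r • pullEnd ρ I v + s • pullEnd ρ J v + t' • pullEnd ρ K v,
      mem_span_triple_iff.mpr ⟨r, s, t', rfl⟩, ?_⟩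
    ext1 u
    obtain ⟨u', hu1⟩ := (t.isInvertible_shear hv).surjective
      ((r • pullEnd ρ I v + s • pullEnd ρ J v + t' • pullEnd ρ K v) (E u))
    obtain ⟨y, hy, yW, yM⟩ := hu u
    obtain ⟨z, hz, zW, zM⟩ := hu u'
    rw [hu1, hspan, ← yM] at zM
    have h3 := h y z hy hz zM
    rw [zW, yW] at h3
    have h4 : u' = S u := t.paramW.pder_injective hv (h3.trans (hS u).symm)
    rw [h4] at hu1
    exact hu1
  · rintro ⟨R, hR, h⟩
    obtain ⟨r, s, t', rfl⟩ := mem_span_triple_iff.mp hR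
    refine ⟨r • I (πM q) + s • J (πM q) + t' • K (πM q),
      mem_span_triple_iff.mpr ⟨r, s, t', rfl⟩, fun y z hy hz hyz => ?_⟩
    obtain ⟨u, uW, uM⟩ := hu' y hy
    obtain ⟨u', uW', uM'⟩ := hu' z hz
    have h2 : pder (m := m) ρ v (E u') = pder (m := m) ρ v (E (S u)) := by
      have h3 := congrArg (fun l : EuclideanSpace ℝ (Fin m) →L[ℝ] EuclideanSpace ℝ (Fin m) => l u) h
      simp only [ContinuousLinearMap.comp_apply] at h3
      rw [h3, hspan, ← uM', ← uM]
      exact hyz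
    have h3 := (t.isInvertible_shear hv).injective (t.paramM.pder_injective hv h2)
    rw [uW, uW', h3]
    exact hS u

end

lemma differentiableAt_comp (t : TwistChart X F a πM πW θ ρ κ ψ U Ω η v₀) {f : M → ℝ}
    (hf : ContMDiff (𝓡 m) 𝓘(ℝ, ℝ) ∞ f) : DifferentiableAt ℝ (fun v => f (ρ v)) v₀ := by
  have := (hf.contMDiffAt.comp v₀ (t.paramM.contMDiffAt t.mem)).mdifferentiableAt (by simp)
  exact this.differentiableAt

variable [IsManifold (𝓡 m) ∞ M] [IsManifold (𝓡 m) ∞ W]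

/-- The data on M are fixed before the Christoffel symbols on W are chosen, so that they can be used
both with a given connection and with a constructed one. -/
theorem exists_jet (t : TwistChart X F a πM πW θ ρ κ ψ U Ω η v₀) (hHK : IsHyperKahler g I J K)
    (hX : IsRotating g I J K X) (hF : IsTwistData X F a) {f h : M → ℝ}
    (hf : ContMDiff (𝓡 m) 𝓘(ℝ, ℝ) ∞ f) (hh : ContMDiff (𝓡 m) 𝓘(ℝ, ℝ) ∞ h)
    {gW : BilinField m W} (hgW : IsPseudoMetric gW)
    (hrel : HRelatedBilin πM πW θ (elemDeform g I J K X f h) gW) :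
    ∃ Γ L, RotJet (pullBilin ρ g) (pullEnd ρ I) (pullEnd ρ J) (pullEnd ρ K) (pullVec ρ X) v₀ Γ L ∧
      ∀ ΓW : EuclideanSpace ℝ (Fin m) →L[ℝ] EuclideanSpace ℝ (Fin m) →L[ℝ]
        EuclideanSpace ℝ (Fin m), (∀ u w, ΓW u w = ΓW w u) →
      (∀ u x y, fderiv ℝ (pullBilin κ gW) v₀ u x y =
        pullBilin κ gW v₀ (ΓW u x) y + pullBilin κ gW v₀ x (ΓW u y)) →
      TwistJet (pullBilin ρ g v₀) (pullEnd ρ I v₀) (pullEnd ρ J v₀) (pullEnd ρ K v₀)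
        (pullVec ρ X v₀) L (f (ρ v₀)) (h (ρ v₀)) (a (ρ v₀)) (fderiv ℝ (fun v => f (ρ v)) v₀)
        (fderiv ℝ (fun v => h (ρ v)) v₀) (pullBilin ρ F v₀)
        (ΓW - fderiv ℝ (shear η (pullVec ρ X) (fun v => a (ρ v))) v₀ - Γ) := by
  obtain ⟨Γ, L, r⟩ := t.paramM.exists_rotJet t.mem hHK hX
  refine ⟨Γ, L, r, fun ΓW symm compat => ?_⟩
  refine r.twistJet (f := fun v => f (ρ v)) (h := fun v => h (ρ v))
    ((t.smooth.contDiffAt (t.paramM.isOpen.mem_nhds t.mem)).differentiableAt (by simp)) t.eq_zero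
    (t.differentiableAt_comp hF.smooth_a) (hF.ne_zero _) (t.differentiableAt_comp hf)
    (t.differentiableAt_comp hh) t.curvature (t.paramW.differentiableAt_pullBilin t.mem hgW.smooth)
    ?_ symm compat
  filter_upwards [t.paramM.isOpen.mem_nhds t.mem] with w hw x y
  rw [t.pullBilin_eq hw hrel, t.paramM.elemDeform_eq hw hHK.hermitian]

end TwistChart

/-! ## Covariant derivatives in local parametrizations -/

section

variable {m : ℕ} {N : Type*} [TopologicalSpace N] [ChartedSpace (EuclideanSpace ℝ (Fin m)) N]

/-- The covariant derivative of `A` at `κ v` with Christoffel symbols `Γ`. -/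
def paramCov (κ : EuclideanSpace ℝ (Fin m) → N) (v : EuclideanSpace ℝ (Fin m))
    (Γ : EuclideanSpace ℝ (Fin m) →L[ℝ] EuclideanSpace ℝ (Fin m) →L[ℝ] EuclideanSpace ℝ (Fin m))
    (A : VectorField m N) : EuclideanSpace ℝ (Fin m) →L[ℝ] EuclideanSpace ℝ (Fin m) :=
  (pder κ v).comp ((fderiv ℝ (pullVec κ A) v + Γ.flip (pullVec κ A v)).comp (pder κ v).inverse)

lemma DiffAt.end_apply_of_mem [IsManifold (𝓡 m) ∞ N] {T : EndField m N} {U : Set N}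
    (hU : IsOpen U) (hT : SmoothEndOn T U) {A : VectorField m N} {x : N} (hx : x ∈ U)
    (hA : DiffAt A x) : DiffAt (fun y => T y (A y)) x :=
  MDifferentiableAt.clm_bundle_apply (F₁ := EuclideanSpace ℝ (Fin m))
    (F₂ := EuclideanSpace ℝ (Fin m)) (b := id)
    (E₁ := fun y : N => TangentSpace (𝓡 m) y) (E₂ := fun y : N => TangentSpace (𝓡 m) y)
    ((hT.contMDiffAt (hU.mem_nhds hx)).mdifferentiableAt (by simp)) hA

variable [IsManifold (𝓡 m) ∞ N]

namespace IsParam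

variable {κ : EuclideanSpace ℝ (Fin m) → N} {U : Set (EuclideanSpace ℝ (Fin m))}
  (c : IsParam κ U) {v : EuclideanSpace ℝ (Fin m)} (hv : v ∈ U)
  {Γ : EuclideanSpace ℝ (Fin m) →L[ℝ] EuclideanSpace ℝ (Fin m) →L[ℝ] EuclideanSpace ℝ (Fin m)}
include c hv

/-- The additivity and Leibniz axioms involve the operator at one point only, so Christoffel symbols
at that point already suffice for them. -/
lemma isCovariantDerivativeOn_singleton {w : N} (hw : κ v = w)
    {cov : VectorField m N → (x : N) → TangentSpace (𝓡 m) x →L[ℝ] TangentSpace (𝓡 m) x}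
    (h : ∀ A, cov A w = paramCov κ v Γ A) :
    IsCovariantDerivativeOn (EuclideanSpace ℝ (Fin m)) cov {w} where
  add {A B x} hA hB hx := by
    obtain rfl : x = w := hx
    subst hw
    have h1 : pullVec κ (A + B) = pullVec κ A + pullVec κ B := by
      ext1 w
      exact map_add (pder (m := m) κ w).inverse _ _
    have h2 := fderiv_add (c.differentiableAt_pullVec hv hA) (c.differentiableAt_pullVec hv hB)
    rw [h, h, h]
    change paramCov κ v Γ (A + B) = paramCov κ v Γ A + paramCov κ v Γ B
    simp only [paramCov, h1, h2, Pi.add_apply, map_add]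
    ext1 u
    simp only [ContinuousLinearMap.comp_apply, add_apply, map_add]
    abel
  leibniz {A f x} hA hf hx := by
    obtain rfl : x = w := hx
    subst hw
    have h1 : pullVec κ (f • A) = fun w => f (κ w) • pullVec κ A w := by
      ext1 w
      exact map_smul (pder (m := m) κ w).inverse _ _
    have hf' : DifferentiableAt ℝ (fun w => f (κ w)) v :=
      (hf.comp v (c.mdifferentiableAt hv)).differentiableAt
    have h2 := fderiv_fun_smul hf' (c.differentiableAt_pullVec hv hA)
    rw [h, h]
    let d : EuclideanSpace ℝ (Fin m) →L[ℝ] ℝ := mvfderiv (𝓡 m) f (κ v)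
    let b : EuclideanSpace ℝ (Fin m) := A (κ v)
    change paramCov κ v Γ (f • A) = f (κ v) • paramCov κ v Γ A + d.smulRight b
    ext1 u
    obtain ⟨u, rfl⟩ := (c.invertible v hv).surjective u
    have h3 : d (pder (m := m) κ v u) =
        fderiv ℝ (fun v => f (κ v)) v u := dirDeriv_comp (c.mdifferentiableAt hv) hf u
    have h4 : (pder (m := m) κ v) (pullVec κ A v) = b := c.pder_pullVec hv A
    simp only [paramCov, h1, h2, map_smul, add_apply, smul_apply,
      ContinuousLinearMap.comp_apply, (c.invertible v hv).inverse_apply_self,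
      ContinuousLinearMap.smulRight_apply, h3, map_add, smul_add]
    rw [h4]
    abel

omit [IsManifold (𝓡 m) ∞ N] in
lemma paramCov_apply (A : VectorField m N) (u : EuclideanSpace ℝ (Fin m)) :
    paramCov κ v Γ A (pder (m := m) κ v u) =
      pder (m := m) κ v (fderiv ℝ (pullVec κ A) v u + Γ u (pullVec κ A v)) := by
  simp [paramCov, (c.invertible v hv).inverse_apply_self]

end IsParam

/-- `Γ` are the Christoffel symbols of `nab` at `v` in the parametrization `κ`. -/
def HasChristoffel (nab : CovariantDerivative (𝓡 m) (EuclideanSpace ℝ (Fin m))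
      (TangentSpace (𝓡 m) : N → Type _)) (κ : EuclideanSpace ℝ (Fin m) → N)
    (v : EuclideanSpace ℝ (Fin m))
    (Γ : EuclideanSpace ℝ (Fin m) →L[ℝ] EuclideanSpace ℝ (Fin m) →L[ℝ] EuclideanSpace ℝ (Fin m)) :
    Prop :=
  ∀ A : VectorField m N, DiffAt A (κ v) → ∀ u, nab A (κ v) (pder (m := m) κ v u) =
    pder (m := m) κ v (fderiv ℝ (pullVec κ A) v u + Γ u (pullVec κ A v))

/-- The difference between `nab` and differentiation in the parametrization is tensorial; Γ is this
tensor pulled back by κ. -/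
lemma IsParam.exists_hasChristoffel {κ : EuclideanSpace ℝ (Fin m) → N}
    {U : Set (EuclideanSpace ℝ (Fin m))} (c : IsParam κ U) {v : EuclideanSpace ℝ (Fin m)}
    (hv : v ∈ U) (nab : CovariantDerivative (𝓡 m) (EuclideanSpace ℝ (Fin m))
      (TangentSpace (𝓡 m) : N → Type _)) : ∃ Γ, HasChristoffel nab κ v Γ := by
  have : IsManifold (𝓡 m) 1 N := IsManifold.of_le (n := ∞) (by simp)
  have h1 := c.isCovariantDerivativeOn_singleton hv (Γ := 0) rfl
    (cov := fun A _ => paramCov κ v 0 A) fun A => rfl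
  have h2 := nab.isCovariantDerivativeOn (s := {κ v})
  let D : EuclideanSpace ℝ (Fin m) →L[ℝ] EuclideanSpace ℝ (Fin m) →L[ℝ]
    EuclideanSpace ℝ (Fin m) := h2.difference h1 (κ v)
  let Γ : EuclideanSpace ℝ (Fin m) →L[ℝ] EuclideanSpace ℝ (Fin m) →L[ℝ]
    EuclideanSpace ℝ (Fin m) := ContinuousLinearMap.comp
      (ContinuousLinearMap.compL ℝ _ _ _ (pder κ v).inverse)
      (D.flip.bilinearComp (pder κ v) (pder κ v))
  refine ⟨Γ, fun A hA u => ?_⟩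
  have h3 := congrArg (fun l : EuclideanSpace ℝ (Fin m) →L[ℝ] EuclideanSpace ℝ (Fin m) =>
    l (pder (m := m) κ v u)) (h2.difference_apply h1 (by simp) hA)
  let n : EuclideanSpace ℝ (Fin m) := nab A (κ v) (pder (m := m) κ v u)
  have h4 : D (A (κ v)) (pder (m := m) κ v u) = n - paramCov κ v 0 A (pder (m := m) κ v u) := h3
  rw [c.paramCov_apply hv] at h4
  have h5 : pder (m := m) κ v (Γ u (pullVec κ A v)) = D (A (κ v)) (pder (m := m) κ v u) := by
    have h6 : pder (m := m) κ v (Γ u (pullVec κ A v)) =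
      D (pder (m := m) κ v (pullVec κ A v)) (pder (m := m) κ v u) :=
      (c.invertible v hv).self_apply_inverse _
    rw [h6, c.pder_pullVec hv]
  change n = _
  rw [map_add, h5, h4]
  simp

/-- Since the axioms are pointwise, the cover by singletons allows a separate parametrization and
separate symbols at every point, with no compatibility to check. -/
lemma exists_covariantDerivative {ι : N → EuclideanSpace ℝ (Fin m) → N}
    {U : N → Set (EuclideanSpace ℝ (Fin m))} (c : ∀ w, IsParam (ι w) (U w))
    {v : N → EuclideanSpace ℝ (Fin m)} (hv : ∀ w, v w ∈ U w) (hw : ∀ w, ι w (v w) = w)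
    (Γ : N → EuclideanSpace ℝ (Fin m) →L[ℝ] EuclideanSpace ℝ (Fin m) →L[ℝ]
      EuclideanSpace ℝ (Fin m)) :
    ∃ nab : CovariantDerivative (𝓡 m) (EuclideanSpace ℝ (Fin m))
      (TangentSpace (𝓡 m) : N → Type _), ∀ w, HasChristoffel nab (ι w) (v w) (Γ w) := by
  let cov : VectorField m N → (x : N) → TangentSpace (𝓡 m) x →L[ℝ] TangentSpace (𝓡 m) x :=
    fun A w => paramCov (ι w) (v w) (Γ w) A
  refine ⟨CovariantDerivative.ofIsCovariantDerivativeOnOfOpenCover (s := fun w : N => {w})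
    (cov := cov) (fun w => (c w).isCovariantDerivativeOn_singleton (hv w) (hw w) fun A => rfl)
    (Set.iUnion_of_singleton N), fun w A hA u => ?_⟩
  rw [← (c w).paramCov_apply (hv w)]
  exact congrArg (fun w' => (paramCov (ι w') (v w') (Γ w') A) (pder (m := m) (ι w) (v w) u)) (hw w)

namespace HasChristoffel

variable {nab : CovariantDerivative (𝓡 m) (EuclideanSpace ℝ (Fin m))
      (TangentSpace (𝓡 m) : N → Type _)} {κ : EuclideanSpace ℝ (Fin m) → N}
  {U : Set (EuclideanSpace ℝ (Fin m))} {v : EuclideanSpace ℝ (Fin m)}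
  {Γ : EuclideanSpace ℝ (Fin m) →L[ℝ] EuclideanSpace ℝ (Fin m) →L[ℝ] EuclideanSpace ℝ (Fin m)}
  {g : BilinField m N}

lemma apply_eq (h : HasChristoffel nab κ v Γ) (c : IsParam κ U) (hv : v ∈ U) {A : VectorField m N}
    (hA : DiffAt A (κ v)) (B : VectorField m N) : nab A (κ v) (B (κ v)) =
      pder (m := m) κ v (fderiv ℝ (pullVec κ A) v (pullVec κ B v)
        + Γ (pullVec κ B v) (pullVec κ A v)) :=
  (congrArg (nab A (κ v)) (c.pder_pullVec hv B)).symm.trans (h A hA _)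

/-- Vanishing torsion says ∇_A B - ∇_B A = [A, B]; in the parametrization the derivatives of the
fields account for the bracket and the skew part of Γ is left. -/
lemma symm (h : HasChristoffel nab κ v Γ) (c : IsParam κ U) (hv : v ∈ U)
    (ht : nab.torsion = 0) (u w : EuclideanSpace ℝ (Fin m)) : Γ u w = Γ w u := by
  obtain ⟨A, hA, rfl⟩ := c.exists_pullVec_eq hv u
  obtain ⟨B, hB, rfl⟩ := c.exists_pullVec_eq hv w
  have : IsManifold (𝓡 m) 2 N := IsManifold.of_le (n := ∞) two_le_infty
  have h1 := nab.torsion_eq_zero_iff.mp ht hA hB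
  have h2 := c.pder_pullVec hv (VectorField.mlieBracket (𝓡 m) A B)
  rw [c.pullVec_mlieBracket hv hA hB] at h2
  have h3 := (congrArg₂ (· - ·) (h.apply_eq c hv hB A) (h.apply_eq c hv hA B)).symm.trans
    (h1.trans h2.symm)
  have h4 := c.pder_injective hv ((map_sub (pder (m := m) κ v) _ _).trans h3)
  have h5 : Γ (pullVec κ A v) (pullVec κ B v) - Γ (pullVec κ B v) (pullVec κ A v) =
    (fderiv ℝ (pullVec κ B) v (pullVec κ A v) + Γ (pullVec κ A v) (pullVec κ B v)
      - (fderiv ℝ (pullVec κ A) v (pullVec κ B v) + Γ (pullVec κ B v) (pullVec κ A v)))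
      - (fderiv ℝ (pullVec κ B) v (pullVec κ A v) - fderiv ℝ (pullVec κ A) v (pullVec κ B v)) := by
    abel
  rw [← sub_eq_zero, h5, h4, sub_self]

lemma compat (h : HasChristoffel nab κ v Γ) (c : IsParam κ U) (hv : v ∈ U)
    (hg : SmoothBilin g) (hn : IsLeviCivita g nab) (u x y : EuclideanSpace ℝ (Fin m)) :
    fderiv ℝ (pullBilin κ g) v u x y = pullBilin κ g v (Γ u x) y + pullBilin κ g v x (Γ u y) := by
  obtain ⟨A, hA, rfl⟩ := c.exists_pullVec_eq hv x
  obtain ⟨B, hB, rfl⟩ := c.exists_pullVec_eq hv y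
  have h1 := hn.metric (κ v) A B hA hB (pder (m := m) κ v u)
  rw [c.dirDeriv_bilin hv (hg.bilinDiffAt _) (c.differentiableAt_pullBilin hv hg) hA hB rfl] at h1
  have h2 : g (κ v) (nab A (κ v) (pder (m := m) κ v u)) (B (κ v)) = pullBilin κ g v
      (fderiv ℝ (pullVec κ A) v u + Γ u (pullVec κ A v)) (pullVec κ B v) :=
    congrArg₂ (fun a b => g (κ v) a b) (h A hA u) (c.pder_pullVec hv B).symm
  have h3 : g (κ v) (A (κ v)) (nab B (κ v) (pder (m := m) κ v u)) = pullBilin κ g v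
      (pullVec κ A v) (fderiv ℝ (pullVec κ B) v u + Γ u (pullVec κ B v)) :=
    congrArg₂ (fun a b => g (κ v) a b) (c.pder_pullVec hv A).symm (h B hB u)
  rw [h2, h3] at h1
  simp only [map_add, add_apply] at h1
  linarith

/-- The covariant derivative of a field of endomorphisms in a parametrization. -/
lemma endField_eq (h : HasChristoffel nab κ v Γ) (c : IsParam κ U) (hv : v ∈ U) {T : EndField m N}
    {U₁ : Set N} (hU₁ : IsOpen U₁) (hT : SmoothEndOn T U₁) (hvU : κ v ∈ U₁)
    (hT' : DifferentiableAt ℝ (pullEnd κ T) v) {A : VectorField m N} (hA : DiffAt A (κ v))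
    (u : EuclideanSpace ℝ (Fin m)) :
    nab (fun y => T y (A y)) (κ v) (pder (m := m) κ v u)
      - T (κ v) (nab A (κ v) (pder (m := m) κ v u)) =
      pder (m := m) κ v ((fderiv ℝ (pullEnd κ T) v u + ((Γ u).comp (pullEnd κ T v)
        - (pullEnd κ T v).comp (Γ u))) (pullVec κ A v)) := by
  have h1 := h _ (DiffAt.end_apply_of_mem hU₁ hT hvU hA) u
  have h2 : T (κ v) (nab A (κ v) (pder (m := m) κ v u)) = pder (m := m) κ v
      (pullEnd κ T v (fderiv ℝ (pullVec κ A) v u + Γ u (pullVec κ A v))) :=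
    (congrArg (T (κ v)) (h A hA u)).trans (c.pder_pullEnd hv T _).symm
  have h3 : fderiv ℝ (pullVec κ (fun y => T y (A y))) v u =
      fderiv ℝ (pullEnd κ T) v u (pullVec κ A v) + pullEnd κ T v (fderiv ℝ (pullVec κ A) v u) := by
    rw [← fderiv_end_apply hT' (c.differentiableAt_pullVec hv hA)]
    refine congrArg (fun l : EuclideanSpace ℝ (Fin m) →L[ℝ] EuclideanSpace ℝ (Fin m) => l u)
      (Filter.EventuallyEq.fderiv_eq ?_)
    filter_upwards [c.isOpen.mem_nhds hv] with w hw using (c.pullEnd_pullVec hw T A).symm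
  rw [h3, ← c.pullEnd_pullVec hv T A] at h1
  refine (congrArg₂ (· - ·) h1 h2).trans ((map_sub (pder (m := m) κ v) _ _).symm.trans
    (congrArg (pder (m := m) κ v) ?_))
  simp only [add_apply, sub_apply, ContinuousLinearMap.comp_apply, map_add]
  abel

end HasChristoffel

lemma isLeviCivita_of_hasChristoffel {nab : CovariantDerivative (𝓡 m) (EuclideanSpace ℝ (Fin m))
      (TangentSpace (𝓡 m) : N → Type _)} {g : BilinField m N} (hg : SmoothBilin g)
    (H : ∀ w, ∃ κ U v Γ, IsParam κ U ∧ v ∈ U ∧ κ v = w ∧ HasChristoffel nab κ v Γ ∧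
      (∀ u w, Γ u w = Γ w u) ∧ ∀ u x y, fderiv ℝ (pullBilin κ g) v u x y =
        pullBilin κ g v (Γ u x) y + pullBilin κ g v x (Γ u y)) : IsLeviCivita g nab where
  torsion_free := by
    have : IsManifold (𝓡 m) 2 N := IsManifold.of_le (n := ∞) two_le_infty
    refine nab.torsion_eq_zero_iff.mpr fun {A B w} hA hB => ?_
    obtain ⟨κ, U, v, Γ, c, hv, rfl, h, symm, -⟩ := H w
    have h2 := c.pder_pullVec hv (VectorField.mlieBracket (𝓡 m) A B)
    rw [c.pullVec_mlieBracket hv hA hB] at h2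
    refine (congrArg₂ (· - ·) (h.apply_eq c hv hB A) (h.apply_eq c hv hA B)).trans (Eq.trans ?_ h2)
    refine (map_sub (pder (m := m) κ v) _ _).symm.trans (congrArg (pder (m := m) κ v) ?_)
    rw [symm (pullVec κ A v)]
    abel
  metric w A B hA hB z := by
    obtain ⟨κ, U, v, Γ, c, hv, rfl, h, -, compat⟩ := H w
    obtain ⟨u, rfl⟩ := (c.invertible v hv).surjective z
    rw [c.dirDeriv_bilin hv (hg.bilinDiffAt _) (c.differentiableAt_pullBilin hv hg) hA hB rfl]
    have h2 : g (κ v) (nab A (κ v) (pder (m := m) κ v u)) (B (κ v)) = pullBilin κ g v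
        (fderiv ℝ (pullVec κ A) v u + Γ u (pullVec κ A v)) (pullVec κ B v) :=
      congrArg₂ (fun a b => g (κ v) a b) (h A hA u) (c.pder_pullVec hv B).symm
    have h3 : g (κ v) (A (κ v)) (nab B (κ v) (pder (m := m) κ v u)) = pullBilin κ g v
        (pullVec κ A v) (fderiv ℝ (pullVec κ B) v u + Γ u (pullVec κ B v)) :=
      congrArg₂ (fun a b => g (κ v) a b) (c.pder_pullVec hv A).symm (h B hB u)
    refine Eq.trans ?_ (congrArg₂ (· + ·) h2 h3).symm
    rw [compat]
    simp only [map_add, add_apply]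
    ring

end

/-! ## Pushing forward fields of endomorphisms -/

section PushEnd

variable {m : ℕ} {N : Type*} [TopologicalSpace N] [ChartedSpace (EuclideanSpace ℝ (Fin m)) N]

/-- The push-forward of a field of endomorphisms by a parametrization `κ` with inverse `ψ`. -/
def pushEnd (κ : EuclideanSpace ℝ (Fin m) → N) (ψ : N → EuclideanSpace ℝ (Fin m))
    (B : EuclideanSpace ℝ (Fin m) → EuclideanSpace ℝ (Fin m) →L[ℝ] EuclideanSpace ℝ (Fin m)) :
    EndField m N :=
  fun w => (pder κ (ψ w)).comp ((B (ψ w)).comp (pder κ (ψ w)).inverse)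

variable {κ : EuclideanSpace ℝ (Fin m) → N} {U : Set (EuclideanSpace ℝ (Fin m))}
  (c : IsParam κ U)
include c

lemma IsParam.pushEnd_apply {ψ : N → EuclideanSpace ℝ (Fin m)} {v : EuclideanSpace ℝ (Fin m)}
    (hv : v ∈ U) (hψ : ψ (κ v) = v)
    (B : EuclideanSpace ℝ (Fin m) → EuclideanSpace ℝ (Fin m) →L[ℝ] EuclideanSpace ℝ (Fin m))
    (u : EuclideanSpace ℝ (Fin m)) :
    pushEnd κ ψ B (κ v) (pder (m := m) κ v u) = pder (m := m) κ v (B v u) := by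
  change (pder (m := m) κ (ψ (κ v))) ((B (ψ (κ v))) ((pder (m := m) κ (ψ (κ v))).inverse
    (pder (m := m) κ v u))) = _
  rw [hψ, (c.invertible v hv).inverse_apply_self]

variable [IsManifold (𝓡 m) ∞ N]

/-- In a trivialization of the tangent bundle the field reads A B A⁻¹, where A is the derivative of
κ in that trivialization; this is smooth in v and is then composed with ψ. -/
lemma IsParam.smoothEndOn_pushEnd {ψ : N → EuclideanSpace ℝ (Fin m)} {Ω : Set N} (hΩ : IsOpen Ω)
    (hψ : ContMDiffOn (𝓡 m) (𝓡 m) ∞ ψ Ω) (hψU : Set.MapsTo ψ Ω U) (hκψ : ∀ w ∈ Ω, κ (ψ w) = w)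
    {B : EuclideanSpace ℝ (Fin m) → EuclideanSpace ℝ (Fin m) →L[ℝ] EuclideanSpace ℝ (Fin m)}
    (hB : ContDiffOn ℝ ∞ B U) : SmoothEndOn (pushEnd κ ψ B) Ω := by
  intro w₀ hw₀
  have : IsManifold (𝓡 m) 1 N := IsManifold.of_le (n := ∞) (by simp)
  refine ContMDiffAt.contMDiffWithinAt ?_
  rw [contMDiffAt_hom_bundle]
  refine ⟨contMDiffAt_id, ?_⟩
  have hv₀ := hψU hw₀
  have cψ : ContMDiffAt (𝓡 m) (𝓡 m) ∞ ψ w₀ := (hψ w₀ hw₀).contMDiffAt (hΩ.mem_nhds hw₀)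
  let e := trivializationAt (EuclideanSpace ℝ (Fin m)) (fun y : N => TangentSpace (𝓡 m) y) w₀
  let C : N → EuclideanSpace ℝ (Fin m) →L[ℝ] EuclideanSpace ℝ (Fin m) :=
    fun w => e.continuousLinearMapAt ℝ w
  let D : N → EuclideanSpace ℝ (Fin m) →L[ℝ] EuclideanSpace ℝ (Fin m) := fun w => e.symmL ℝ w
  let A : EuclideanSpace ℝ (Fin m) → EuclideanSpace ℝ (Fin m) →L[ℝ] EuclideanSpace ℝ (Fin m) :=
    fun v => (C (κ v)).comp (pder (m := m) κ v)
  have hCD : ∀ w ∈ e.baseSet, ∀ u, C w (D w u) = u := fun w hw u =>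
    e.continuousLinearMapAt_symmL (R := ℝ) hw u
  have hDC : ∀ w ∈ e.baseSet, ∀ u, D w (C w u) = u := fun w hw u =>
    e.symmL_continuousLinearMapAt (R := ℝ) hw u
  have hinv : ∀ v ∈ U, κ v ∈ e.baseSet → (A v).inverse = (pder (m := m) κ v).inverse.comp (D (κ v)) ∧
      (A v).IsInvertible := by
    intro v hv he
    have h1 : (A v).comp ((pder (m := m) κ v).inverse.comp (D (κ v))) =
        ContinuousLinearMap.id ℝ _ := by
      ext1 u
      simp only [A, ContinuousLinearMap.comp_apply, (c.invertible v hv).self_apply_inverse,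
        hCD _ he, ContinuousLinearMap.id_apply]
    have h2 : ((pder (m := m) κ v).inverse.comp (D (κ v))).comp (A v) =
        ContinuousLinearMap.id ℝ _ := by
      ext1 u
      simp only [A, ContinuousLinearMap.comp_apply, hDC _ he, (c.invertible v hv).inverse_apply_self,
        ContinuousLinearMap.id_apply]
    exact ⟨ContinuousLinearMap.inverse_eq h1 h2, ContinuousLinearMap.IsInvertible.of_inverse h1 h2⟩
  let U₁ : Set (EuclideanSpace ℝ (Fin m)) := U ∩ κ ⁻¹' e.baseSet
  have oU₁ : IsOpen U₁ := c.contMDiff.continuousOn.isOpen_inter_preimage c.isOpen e.open_baseSet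
  have he₀ : κ (ψ w₀) ∈ e.baseSet := by
    rw [hκψ w₀ hw₀]; exact mem_baseSet_trivializationAt _ _ w₀
  have cA : ContDiffOn ℝ ∞ A U₁ := by
    refine contDiffOn_clm_apply.mpr fun u => ?_
    have h1 := (contMDiffOn_pder c.isOpen c.contMDiff (contDiffOn_const (c := u))).mono
      (Set.inter_subset_left (t := κ ⁻¹' e.baseSet))
    have h2 := ((e.contMDiffOn_iff (fun v hv => e.mem_source.mpr hv.2)).mp h1).2
    refine h2.contDiffOn.congr fun v hv => ?_
    exact e.continuousLinearMapAt_apply_of_mem (R := ℝ) hv.2 _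
  have cAt := cA.contDiffAt (oU₁.mem_nhds ⟨hv₀, he₀⟩)
  have hfin : ContDiffAt ℝ ∞ (fun v => (A v).comp ((B v).comp (A v).inverse)) (ψ w₀) := by
    refine cAt.clm_comp (((hB _ hv₀).contDiffAt (c.isOpen.mem_nhds hv₀)).clm_comp ?_)
    exact ((hinv _ hv₀ he₀).2.contDiffAt_map_inverse).comp _ cAt
  refine (hfin.contMDiffAt.comp w₀ cψ).congr_of_eventuallyEq ?_
  filter_upwards [hΩ.mem_nhds hw₀, e.open_baseSet.mem_nhds (mem_baseSet_trivializationAt _ _ w₀)]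
    with w hw he
  have he' : κ (ψ w) ∈ e.baseSet := by rw [hκψ w hw]; exact he
  change (C w).comp ((pushEnd κ ψ B w : EuclideanSpace ℝ (Fin m) →L[ℝ] EuclideanSpace ℝ (Fin m)).comp
    (D w)) = (A (ψ w)).comp ((B (ψ w)).comp (A (ψ w)).inverse)
  rw [(hinv _ (hψU hw) he').1]
  simp only [A, hκψ w hw]
  rfl

end PushEnd

/-! ## Local frames of the twisted quaternionic bundle -/

section

variable {V : Type*} [NormedAddCommGroup V] [NormedSpace ℝ V]
  {g : V →L[ℝ] V →L[ℝ] ℝ} {I J K : V →L[ℝ] V} (q : QuatHerm g I J K) (X : V) (f h : ℝ) (u v : V)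
include q

/-- Composition with I permutes α₀, α_I, α_J, α_K up to sign, so the sum of their squares is
Hermitian. -/
lemma QuatHerm.deform_I :
    deform g I J K X f h (I u) (I v) = deform g I J K X f h u v := by
  simp only [deform, galpha, q.gI, q.II, q.JJ, q.KK, q.IJ, q.JI, q.IK, q.KI, q.JK, q.KJ, map_neg,
    neg_apply]
  ring

lemma QuatHerm.deform_J :
    deform g I J K X f h (J u) (J v) = deform g I J K X f h u v := by
  simp only [deform, galpha, q.gJ, q.II, q.JJ, q.KK, q.IJ, q.JI, q.IK, q.KI, q.JK, q.KJ, map_neg,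
    neg_apply]
  ring

lemma QuatHerm.deform_K :
    deform g I J K X f h (K u) (K v) = deform g I J K X f h u v := by
  simp only [deform, galpha, q.gK, q.II, q.JJ, q.KK, q.IJ, q.JI, q.IK, q.KI, q.JK, q.KJ, map_neg,
    neg_apply]
  ring

end

lemma contDiffOn_shear {V : Type*} [NormedAddCommGroup V] [NormedSpace ℝ V] {η : V → V →L[ℝ] ℝ}
    {X : V → V} {a : V → ℝ} {U : Set V} (hη : ContDiffOn ℝ ∞ η U) (hX : ContDiffOn ℝ ∞ X U)
    (ha : ContDiffOn ℝ ∞ a U) (ha₀ : ∀ v ∈ U, a v ≠ 0) : ContDiffOn ℝ ∞ (shear η X a) U :=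
  contDiffOn_const.sub (ContDiffOn.clm_apply
    ((ContinuousLinearMap.smulRightL ℝ V V).contDiff.comp_contDiffOn hη) ((ha.inv ha₀).smul hX))

namespace TwistChart

variable {m : ℕ}
  {M : Type*} [TopologicalSpace M] [ChartedSpace (EuclideanSpace ℝ (Fin m)) M]
  {P : Type*} [TopologicalSpace P] [ChartedSpace (EuclideanSpace ℝ (Fin (m + 1))) P]
  {W : Type*} [TopologicalSpace W] [ChartedSpace (EuclideanSpace ℝ (Fin m)) W]
  {X : VectorField m M} {F : BilinField m M} {a : M → ℝ} {πM : P → M} {πW : P → W}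
  {θ : CovectorField (m + 1) P} {ρ : EuclideanSpace ℝ (Fin m) → M}
  {κ : EuclideanSpace ℝ (Fin m) → W} {ψ : W → EuclideanSpace ℝ (Fin m)}
  {U : Set (EuclideanSpace ℝ (Fin m))} {Ω : Set W}
  {η : EuclideanSpace ℝ (Fin m) → EuclideanSpace ℝ (Fin m) →L[ℝ] ℝ}
  {v₀ : EuclideanSpace ℝ (Fin m)} {g : BilinField m M} {I J K : EndField m M}
  {QW : (w : W) → Submodule ℝ (TangentSpace (𝓡 m) w →L[ℝ] TangentSpace (𝓡 m) w)}
  [IsManifold (𝓡 m) ∞ M] [IsManifold (𝓡 m) ∞ W]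
  (t : TwistChart X F a πM πW θ ρ κ ψ U Ω η v₀)
include t

-- At the base point the shear is the identity, so the two bundles have the same fibre in the chart.
omit [IsManifold (𝓡 m) ∞ M] [IsManifold (𝓡 m) ∞ W] in
lemma mem_iff_base (hrel : HRelatedBundle πM πW θ (quatSpan I J K) QW)
    {L : TangentSpace (𝓡 m) (κ v₀) →L[ℝ] TangentSpace (𝓡 m) (κ v₀)}
    {S : EuclideanSpace ℝ (Fin m) →L[ℝ] EuclideanSpace ℝ (Fin m)}
    (hS : ∀ u, pder (m := m) κ v₀ (S u) = L (pder (m := m) κ v₀ u)) :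
    L ∈ QW (κ v₀) ↔ S ∈ Submodule.span ℝ {pullEnd ρ I v₀, pullEnd ρ J v₀, pullEnd ρ K v₀} := by
  rw [t.mem_iff t.mem hrel hS, shear_eq_id t.eq_zero]
  simp

/-- The frame is obtained by conjugating I, J, K with the shear and pushing forward to W; the
quaternionic relations and Hermitian property are invariant under conjugation. -/
theorem exists_frame (hHK : IsHyperKahler g I J K) (hX : SmoothVector X) (hF : IsTwistData X F a)
    {f h : M → ℝ} {gW : BilinField m W}
    (hrel : HRelatedBilin πM πW θ (elemDeform g I J K X f h) gW)
    (hQ : HRelatedBundle πM πW θ (quatSpan I J K) QW) :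
    ∃ (U₁ : Set W) (I' J' K' : EndField m W), IsOpen U₁ ∧ κ v₀ ∈ U₁ ∧ SmoothEndOn I' U₁ ∧
      SmoothEndOn J' U₁ ∧ SmoothEndOn K' U₁ ∧
      ∀ w ∈ U₁, IsQuaternionHermitianAt gW I' J' K' w ∧ QW w = quatSpan I' J' K' w := by
  let E := shear η (pullVec ρ X) (fun v => a (ρ v))
  let B : EndField m M → EuclideanSpace ℝ (Fin m) → EuclideanSpace ℝ (Fin m) →L[ℝ]
    EuclideanSpace ℝ (Fin m) := fun T v => (E v).inverse.comp ((pullEnd ρ T v).comp (E v))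
  have hg := hHK.metric
  have hEB : ∀ v ∈ U, ∀ T u, E v (B T v u) = pullEnd ρ T v (E v u) := fun v hv T u =>
    (t.isInvertible_shear hv).self_apply_inverse _
  have cE : ContDiffOn ℝ ∞ E U := by
    have ca : ContDiffOn ℝ ∞ (fun v => a (ρ v)) U := fun v hv =>
      (hF.smooth_a.contMDiffAt.comp v (t.paramM.contMDiffAt hv)).contDiffAt.contDiffWithinAt
    exact contDiffOn_shear t.smooth (t.paramM.contDiffOn_pullVec hg hX) ca fun v _ => hF.ne_zero _
  have cB : ∀ T, SmoothEndOn T Set.univ → ContDiffOn ℝ ∞ (B T) U := fun T hT => by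
    refine ContDiffOn.clm_comp (fun v hv => ?_)
      ((t.paramM.contDiffOn_pullEnd hg hT (Set.mapsTo_univ _ _)).clm_comp cE)
    exact (t.isInvertible_shear hv).contDiffAt_map_inverse.comp_contDiffWithinAt v (cE v hv)
  let U₁ : Set W := Ω ∩ ψ ⁻¹' U
  have oU₁ : IsOpen U₁ :=
    t.contMDiff.continuousOn.isOpen_inter_preimage t.isOpen t.paramM.isOpen
  have hsm : ∀ T, SmoothEndOn T Set.univ → SmoothEndOn (pushEnd κ ψ (B T)) U₁ := fun T hT =>
    t.paramW.smoothEndOn_pushEnd oU₁ (t.contMDiff.mono Set.inter_subset_left)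
      (fun w hw => hw.2) (fun w hw => t.right_inv w hw.1) (cB T hT)
  have hmem : κ v₀ ∈ U₁ := ⟨(t.left_inv v₀ t.mem).1, by
    rw [Set.mem_preimage, (t.left_inv v₀ t.mem).2]; exact t.mem⟩
  refine ⟨U₁, _, _, _, oU₁, hmem, hsm I hHK.smooth_I, hsm J hHK.smooth_J, hsm K hHK.smooth_K,
    fun w hw => ?_⟩
  obtain ⟨v, hv, hψ, rfl⟩ : ∃ v ∈ U, ψ (κ v) = v ∧ κ v = w :=
    ⟨ψ w, hw.2, (t.left_inv _ hw.2).2, t.right_inv w hw.1⟩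
  have q := t.paramM.quatHerm hv hg.symm hg.nondegenerate (hHK.hermitian (ρ v))
  have hp : ∀ T u, pushEnd κ ψ (B T) (κ v) (pder (m := m) κ v u) = pder (m := m) κ v (B T v u) :=
    fun T u => t.paramW.pushEnd_apply hv hψ (B T) u
  have hpp : ∀ T T' u, pushEnd κ ψ (B T) (κ v) (pushEnd κ ψ (B T') (κ v) (pder (m := m) κ v u)) =
      pder (m := m) κ v (B T v (B T' v u)) := fun T T' u =>
    (congrArg (pushEnd κ ψ (B T) (κ v)) (hp T' u)).trans (hp T _)
  have surj := (t.paramW.invertible v hv).surjective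
  have hE : ∀ x y, E v x = E v y → x = y := fun x y hxy => (t.isInvertible_shear hv).injective hxy
  have hgW : ∀ x y, pullBilin κ gW v x y = deform (pullBilin ρ g v) (pullEnd ρ I v) (pullEnd ρ J v)
      (pullEnd ρ K v) (pullVec ρ X v) (f (ρ v)) (h (ρ v)) (E v x) (E v y) := fun x y => by
    rw [t.pullBilin_eq hv hrel, t.paramM.elemDeform_eq hv hHK.hermitian]
  have herm : ∀ T, (∀ x y, pullBilin κ gW v (B T v x) (B T v y) = pullBilin κ gW v x y) →
      ∀ x y : TangentSpace (𝓡 m) (κ v), gW (κ v) (pushEnd κ ψ (B T) (κ v) x)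
        (pushEnd κ ψ (B T) (κ v) y) = gW (κ v) x y := fun T hT x y => by
    obtain ⟨x, rfl⟩ := surj x
    obtain ⟨y, rfl⟩ := surj y
    exact (congrArg₂ (fun x y => gW (κ v) x y) (hp T x) (hp T y)).trans (hT x y)
  refine ⟨⟨fun x => ?_, fun x => ?_, fun x => ?_, fun x => ?_, fun x => ?_, herm I fun x y => ?_,
    herm J fun x y => ?_, herm K fun x y => ?_⟩, ?_⟩
  · obtain ⟨x, rfl⟩ := surj x
    refine (hpp I I x).trans ((congrArg (pder (m := m) κ v) (hE _ (-x) ?_)).trans (map_neg _ _))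
    rw [hEB v hv, hEB v hv, q.II, map_neg]
  · obtain ⟨x, rfl⟩ := surj x
    refine (hpp J J x).trans ((congrArg (pder (m := m) κ v) (hE _ (-x) ?_)).trans (map_neg _ _))
    rw [hEB v hv, hEB v hv, q.JJ, map_neg]
  · obtain ⟨x, rfl⟩ := surj x
    refine (hpp K K x).trans ((congrArg (pder (m := m) κ v) (hE _ (-x) ?_)).trans (map_neg _ _))
    rw [hEB v hv, hEB v hv, q.KK, map_neg]
  · obtain ⟨x, rfl⟩ := surj x
    refine (hpp I J x).trans ((congrArg (pder (m := m) κ v) (hE _ _ ?_)).trans (hp K x).symm)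
    rw [hEB v hv, hEB v hv, hEB v hv, q.IJ]
  · obtain ⟨x, rfl⟩ := surj x
    refine (hpp J I x).trans ((congrArg (pder (m := m) κ v) (hE _ (-(B K v x)) ?_)).trans
      ((map_neg _ _).trans (congrArg Neg.neg (hp K x)).symm))
    rw [hEB v hv, hEB v hv, map_neg, hEB v hv, q.JI]
  · rw [hgW, hgW, hEB v hv, hEB v hv, q.deform_I]
  · rw [hgW, hgW, hEB v hv, hEB v hv, q.deform_J]
  · rw [hgW, hgW, hEB v hv, hEB v hv, q.deform_K]
  · ext L
    let L' : EuclideanSpace ℝ (Fin m) →L[ℝ] EuclideanSpace ℝ (Fin m) := L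
    let S := (pder (m := m) κ v).inverse.comp (L'.comp (pder (m := m) κ v))
    have hS : ∀ u, pder (m := m) κ v (S u) = L (pder (m := m) κ v u) := fun u =>
      (t.paramW.invertible v hv).self_apply_inverse _
    rw [t.mem_iff hv hQ hS]
    have hcomb : ∀ r s z : ℝ, ∀ u, pder (m := m) κ v (r • B I v u + s • B J v u + z • B K v u) =
        (r • pushEnd κ ψ (B I) (κ v) + s • pushEnd κ ψ (B J) (κ v) + z • pushEnd κ ψ (B K) (κ v))
          (pder (m := m) κ v u) := fun r s z u => by
      simp only [map_add, map_smul, ← hp]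
      rfl
    constructor
    · rintro ⟨R, hR, hRS⟩
      obtain ⟨r, s, z, rfl⟩ := mem_span_triple_iff.mp hR
      refine mem_span_triple_iff.mpr ⟨r, s, z, ?_⟩
      ext1 x
      obtain ⟨x, rfl⟩ := surj x
      refine (hS x).symm.trans (Eq.trans (congrArg (pder (m := m) κ v) (hE _ _ ?_)) (hcomb r s z x))
      refine (congrArg (fun l : EuclideanSpace ℝ (Fin m) →L[ℝ] EuclideanSpace ℝ (Fin m) => l x)
        hRS).trans ?_
      simp only [map_add, map_smul, hEB v hv]
      rfl
    · intro hL
      obtain ⟨r, s, z, hL⟩ := mem_span_triple_iff.mp hL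
      refine ⟨_, mem_span_triple_iff.mpr ⟨r, s, z, rfl⟩, ?_⟩
      ext1 x
      have h1 : S x = r • B I v x + s • B J v x + z • B K v x :=
        t.paramW.pder_injective hv ((hS x).trans ((congrArg (fun l : EuclideanSpace ℝ (Fin m) →L[ℝ]
          EuclideanSpace ℝ (Fin m) => l (pder (m := m) κ v x)) hL).trans (hcomb r s z x).symm))
      change E v (S x) = _
      rw [h1]
      simp only [map_add, map_smul, hEB v hv]
      rfl

end TwistChart

/-! ## The quaternionic Kähler condition on a twist -/

section

variable {m : ℕ}
  {M : Type*} [TopologicalSpace M] [ChartedSpace (EuclideanSpace ℝ (Fin m)) M]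
  {P : Type*} [TopologicalSpace P] [ChartedSpace (EuclideanSpace ℝ (Fin (m + 1))) P]
  {W : Type*} [TopologicalSpace W] [ChartedSpace (EuclideanSpace ℝ (Fin m)) W]
  {X : VectorField m M} {F : BilinField m M} {a : M → ℝ} {πM : P → M} {πW : P → W}
  {θ : CovectorField (m + 1) P} {ρ : EuclideanSpace ℝ (Fin m) → M}
  {κ : EuclideanSpace ℝ (Fin m) → W} {ψ : W → EuclideanSpace ℝ (Fin m)}
  {U : Set (EuclideanSpace ℝ (Fin m))} {Ω : Set W}
  {η : EuclideanSpace ℝ (Fin m) → EuclideanSpace ℝ (Fin m) →L[ℝ] ℝ}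
  {v₀ : EuclideanSpace ℝ (Fin m)} {g : BilinField m M} {I J K : EndField m M}
  {QW : (w : W) → Submodule ℝ (TangentSpace (𝓡 m) w →L[ℝ] TangentSpace (𝓡 m) w)}
  [IsManifold (𝓡 m) ∞ M] [IsManifold (𝓡 m) ∞ W]
  {gW : BilinField m W}
  {Γ Γ' : EuclideanSpace ℝ (Fin m) →L[ℝ] EuclideanSpace ℝ (Fin m) →L[ℝ] EuclideanSpace ℝ (Fin m)}
  {L : EuclideanSpace ℝ (Fin m) →L[ℝ] EuclideanSpace ℝ (Fin m)} {f h : M → ℝ}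

lemma IsParam.inter {m : ℕ} {N : Type*} [TopologicalSpace N]
    [ChartedSpace (EuclideanSpace ℝ (Fin m)) N] {κ : EuclideanSpace ℝ (Fin m) → N}
    {U : Set (EuclideanSpace ℝ (Fin m))} (c : IsParam κ U) {U₁ : Set N} (hU₁ : IsOpen U₁) :
    IsParam κ (U ∩ κ ⁻¹' U₁) where
  isOpen := c.contMDiff.continuousOn.isOpen_inter_preimage c.isOpen hU₁
  contMDiff := c.contMDiff.mono Set.inter_subset_left
  invertible v hv := c.invertible v hv.1

namespace TwistChart

variable (t : TwistChart X F a πM πW θ ρ κ ψ U Ω η v₀)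
include t

lemma differentiableAt_pullEnd (hgW : IsPseudoMetric gW) {T : EndField m W} {U₁ : Set W}
    (hU₁ : IsOpen U₁) (hT : SmoothEndOn T U₁) (hv : κ v₀ ∈ U₁) :
    DifferentiableAt ℝ (pullEnd κ T) v₀ :=
  (t.paramW.inter hU₁).differentiableAt_pullEnd ⟨t.mem, hv⟩ hgW hT fun _ h => h.2

/-- Modulo the bundle itself, the covariant derivative on W of one of its sections is the commutator
with the difference tensor S. Both directions of the parallelism criterion follow from this. -/
lemma covariant_sub_commutator_mem [Nontrivial (EuclideanSpace ℝ (Fin m))]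
    (hF : IsTwistData X F a) (hgW : IsPseudoMetric gW)
    (hQ : HRelatedBundle πM πW θ (quatSpan I J K) QW)
    (r : RotJet (pullBilin ρ g) (pullEnd ρ I) (pullEnd ρ J) (pullEnd ρ K) (pullVec ρ X) v₀ Γ L)
    {T : EndField m W} {U₁ : Set W} (hU₁ : IsOpen U₁) (hT : SmoothEndOn T U₁) (hv : κ v₀ ∈ U₁)
    (mem : ∀ w ∈ U₁, T w ∈ QW w) (u : EuclideanSpace ℝ (Fin m)) :
    fderiv ℝ (pullEnd κ T) v₀ u + ((Γ' u).comp (pullEnd κ T v₀) - (pullEnd κ T v₀).comp (Γ' u))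
      - (((Γ' - fderiv ℝ (shear η (pullVec ρ X) (fun v => a (ρ v))) v₀ - Γ) u).comp (pullEnd κ T v₀)
        - (pullEnd κ T v₀).comp
          ((Γ' - fderiv ℝ (shear η (pullVec ρ X) (fun v => a (ρ v))) v₀ - Γ) u))
      ∈ Submodule.span ℝ {pullEnd ρ I v₀, pullEnd ρ J v₀, pullEnd ρ K v₀} := by
  have hη : DifferentiableAt ℝ η v₀ :=
    (t.smooth.contDiffAt (t.paramM.isOpen.mem_nhds t.mem)).differentiableAt (by simp)
  refine fderiv_add_commutator_sub_mem r.quat r.diff_I r.diff_J r.diff_K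
    (differentiableAt_shear hη r.diff_X (t.differentiableAt_comp hF.smooth_a) (hF.ne_zero _))
    (t.differentiableAt_pullEnd hgW hU₁ hT hv) (shear_eq_id t.eq_zero) (Γ := fun u => Γ u)
    r.deriv_I r.deriv_J r.deriv_K ?_ (fun u => Γ' u) u
  have c := t.paramW.inter hU₁
  filter_upwards [c.isOpen.mem_nhds ⟨t.mem, hv⟩] with v hv
  exact (t.mem_iff hv.1 hQ (t.paramW.pder_pullEnd hv.1 T)).mp (mem _ hv.2)

/-- The difference of the Levi-Civita connections on a quaternionic Kähler twist normalizes the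
quaternionic bundle. -/
theorem commutator_mem [Nontrivial (EuclideanSpace ℝ (Fin m))]
    (hF : IsTwistData X F a) (hQ : HRelatedBundle πM πW θ (quatSpan I J K) QW)
    (r : RotJet (pullBilin ρ g) (pullEnd ρ I) (pullEnd ρ J) (pullEnd ρ K) (pullVec ρ X) v₀ Γ L)
    (hQK : IsQuaternionicKahler gW QW) :
    ∃ Γ' : EuclideanSpace ℝ (Fin m) →L[ℝ] EuclideanSpace ℝ (Fin m) →L[ℝ] EuclideanSpace ℝ (Fin m),
      (∀ u w, Γ' u w = Γ' w u) ∧ (∀ u x y, fderiv ℝ (pullBilin κ gW) v₀ u x y =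
        pullBilin κ gW v₀ (Γ' u x) y + pullBilin κ gW v₀ x (Γ' u y)) ∧
      ∀ u, ∀ T ∈ Submodule.span ℝ {pullEnd ρ I v₀, pullEnd ρ J v₀, pullEnd ρ K v₀},
        ((Γ' - fderiv ℝ (shear η (pullVec ρ X) (fun v => a (ρ v))) v₀ - Γ) u).comp T
          - T.comp ((Γ' - fderiv ℝ (shear η (pullVec ρ X) (fun v => a (ρ v))) v₀ - Γ) u) ∈
        Submodule.span ℝ {pullEnd ρ I v₀, pullEnd ρ J v₀, pullEnd ρ K v₀} := by
  obtain ⟨nab, hLC, hloc⟩ := hQK.parallel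
  obtain ⟨Γ', hΓ'⟩ := t.paramW.exists_hasChristoffel t.mem nab
  refine ⟨Γ', hΓ'.symm t.paramW t.mem hLC.torsion_free,
    hΓ'.compat t.paramW t.mem hQK.metric.smooth hLC, fun u R hR => ?_⟩
  set S := (Γ' - fderiv ℝ (shear η (pullVec ρ X) (fun v => a (ρ v))) v₀ - Γ) u with hS
  set Q := Submodule.span ℝ {pullEnd ρ I v₀, pullEnd ρ J v₀, pullEnd ρ K v₀} with hQdef
  obtain ⟨U₁, I', J', K', hU₁, hv, sI, sJ, sK, hfr⟩ := hloc (κ v₀)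
  -- For a member of a local frame the covariant derivative lies in the bundle by assumption, hence
  -- so does the commutator with S.
  have key : ∀ T : EndField m W, (T = I' ∨ T = J' ∨ T = K') → SmoothEndOn T U₁ →
      S.comp (pullEnd κ T v₀) - (pullEnd κ T v₀).comp S ∈ Q := by
    intro T hT sT
    have hmem : ∀ w ∈ U₁, T w ∈ QW w := fun w hw => by
      rw [(hfr w hw).2.1]
      exact Submodule.subset_span (by rcases hT with rfl | rfl | rfl <;> simp)
    have h1 := t.covariant_sub_commutator_mem (Γ' := Γ') hF hQK.metric hQ r hU₁ sT hv hmem u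
    have hd := t.differentiableAt_pullEnd hQK.metric hU₁ sT hv
    obtain ⟨D, hD, hD'⟩ := (hfr _ hv).2.2 T hT (pder (m := m) κ v₀ u)
    have h2 : fderiv ℝ (pullEnd κ T) v₀ u + ((Γ' u).comp (pullEnd κ T v₀)
        - (pullEnd κ T v₀).comp (Γ' u)) ∈ Q := by
      refine (t.mem_iff_base hQ fun x => ?_).mp hD
      obtain ⟨A, hA, rfl⟩ := t.paramW.exists_pullVec_eq t.mem x
      refine (hΓ'.endField_eq t.paramW t.mem hU₁ sT hv hd hA u).symm.trans ((hD' A hA).trans ?_)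
      exact congrArg D (t.paramW.pder_pullVec t.mem A).symm
    have h3 := Q.sub_mem h2 h1
    rwa [sub_sub_cancel] at h3
  -- An arbitrary R in ⟨I, J, K⟩ is carried to W in order to expand it in the given frame; linearity
  -- then extends `key` from the frame to R.
  let LW : EuclideanSpace ℝ (Fin m) →L[ℝ] EuclideanSpace ℝ (Fin m) :=
    (pder (m := m) κ v₀).comp (R.comp (pder (m := m) κ v₀).inverse)
  have inv := t.paramW.invertible v₀ t.mem
  have hLW : LW ∈ (QW (κ v₀)).carrier := (t.mem_iff_base hQ (S := R) fun x => by
    change _ = pder (m := m) κ v₀ (R ((pder (m := m) κ v₀).inverse (pder (m := m) κ v₀ x)))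
    rw [inv.inverse_apply_self]).mpr hR
  have hLW' : LW ∈ (quatSpan I' J' K' (κ v₀)).carrier := by rw [← (hfr _ hv).2.1]; exact hLW
  obtain ⟨r', s, z, hL⟩ := mem_span_triple_iff.mp hLW'
  have hR' : R = r' • pullEnd κ I' v₀ + s • pullEnd κ J' v₀ + z • pullEnd κ K' v₀ := by
    ext1 x
    refine inv.injective ?_
    have h1 : LW (pder (m := m) κ v₀ x) = pder (m := m) κ v₀ (R x) := by
      simp only [LW, ContinuousLinearMap.comp_apply, inv.inverse_apply_self]
    rw [← h1]
    refine (congrArg (fun l : EuclideanSpace ℝ (Fin m) →L[ℝ] EuclideanSpace ℝ (Fin m) =>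
      l (pder (m := m) κ v₀ x)) hL).trans ?_
    simp only [add_apply, smul_apply, map_add, map_smul, t.paramW.pder_pullEnd t.mem]
    rfl
  have h4 := Q.add_mem (Q.add_mem (Q.smul_mem r' (key I' (by simp) sI))
    (Q.smul_mem s (key J' (by simp) sJ))) (Q.smul_mem z (key K' (by simp) sK))
  convert! h4 using 1
  rw [hR']
  ext1 x
  simp only [ContinuousLinearMap.comp_apply, sub_apply, add_apply, smul_apply, map_add, map_smul,
    smul_sub]
  abel

/-- At the base point of a twist chart the quaternionic bundle is parallel if the difference of the
connections normalizes it. -/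
lemma exists_covariant_mem [Nontrivial (EuclideanSpace ℝ (Fin m))]
    (hF : IsTwistData X F a) (hgW : IsPseudoMetric gW)
    (hQ : HRelatedBundle πM πW θ (quatSpan I J K) QW)
    (r : RotJet (pullBilin ρ g) (pullEnd ρ I) (pullEnd ρ J) (pullEnd ρ K) (pullVec ρ X) v₀ Γ L)
    (hN : ∀ u, ∀ T ∈ Submodule.span ℝ {pullEnd ρ I v₀, pullEnd ρ J v₀, pullEnd ρ K v₀},
        ((Γ' - fderiv ℝ (shear η (pullVec ρ X) (fun v => a (ρ v))) v₀ - Γ) u).comp T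
          - T.comp ((Γ' - fderiv ℝ (shear η (pullVec ρ X) (fun v => a (ρ v))) v₀ - Γ) u) ∈
        Submodule.span ℝ {pullEnd ρ I v₀, pullEnd ρ J v₀, pullEnd ρ K v₀})
    {nab : CovariantDerivative (𝓡 m) (EuclideanSpace ℝ (Fin m))
      (TangentSpace (𝓡 m) : W → Type _)} (hΓ' : HasChristoffel nab κ v₀ Γ')
    {T : EndField m W} {U₁ : Set W} (hU₁ : IsOpen U₁) (hT : SmoothEndOn T U₁)
    (mem : ∀ w ∈ U₁, T w ∈ QW w) {w : W} (hw : κ v₀ = w) (hwU : w ∈ U₁) (z : TangentSpace (𝓡 m) w) :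
    ∃ D ∈ QW w, ∀ B : VectorField m W, DiffAt B w →
      nab (fun y => T y (B y)) w z - T w (nab B w z) = D (B w) := by
  subst hw
  have inv := t.paramW.invertible v₀ t.mem
  obtain ⟨u, rfl⟩ := inv.surjective z
  have hT₀ := (t.mem_iff_base hQ (t.paramW.pder_pullEnd t.mem T)).mp (mem _ hwU)
  -- The covariant derivative is its difference from the commutator plus the commutator, and both
  -- lie in the bundle.
  have h1 := Submodule.add_mem _ (t.covariant_sub_commutator_mem (Γ' := Γ') hF hgW hQ r hU₁ hT hwU
    mem u) (hN u _ hT₀)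
  rw [sub_add_cancel] at h1
  set Y := fderiv ℝ (pullEnd κ T) v₀ u + ((Γ' u).comp (pullEnd κ T v₀)
        - (pullEnd κ T v₀).comp (Γ' u)) with hY
  let D : EuclideanSpace ℝ (Fin m) →L[ℝ] EuclideanSpace ℝ (Fin m) :=
    (pder (m := m) κ v₀).comp (Y.comp (pder (m := m) κ v₀).inverse)
  refine ⟨D, (t.mem_iff_base hQ (S := Y) fun x => ?_).mpr h1, fun B hB => ?_⟩
  · change _ = pder (m := m) κ v₀ (Y ((pder (m := m) κ v₀).inverse (pder (m := m) κ v₀ x)))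
    rw [inv.inverse_apply_self]
  · exact hΓ'.endField_eq t.paramW t.mem hU₁ hT hwU (t.differentiableAt_pullEnd hgW hU₁ hT hwU) hB u

end TwistChart

end

/-! ### From normalizing difference tensors to a quaternionic Kähler structure on W -/

lemma exists_christoffel_fderiv {V : Type*} [NormedAddCommGroup V] [NormedSpace ℝ V]
    [FiniteDimensional ℝ V] {g : V → V →L[ℝ] V →L[ℝ] ℝ} {v : V} (hd : DifferentiableAt ℝ g v)
    (symm : ∀ w x y, g w x y = g w y x) (nondeg : ∀ x, (∀ y, g v x y = 0) → x = 0) :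
    ∃ Γ : V →L[ℝ] V →L[ℝ] V, (∀ u w, Γ u w = Γ w u) ∧
      ∀ u x y, fderiv ℝ g v u x y = g v (Γ u x) y + g v x (Γ u y) := by
  refine exists_christoffel (D := fun u x y => fderiv ℝ g v u x y) (symm v) nondeg
    (fun x y => ⟨fun _ _ => congrArg (fun b : V →L[ℝ] V →L[ℝ] ℝ => b x y)
        (ContinuousLinearMap.map_add (fderiv ℝ g v) _ _),
      fun _ _ => congrArg (fun b : V →L[ℝ] V →L[ℝ] ℝ => b x y)
        (ContinuousLinearMap.map_smul (fderiv ℝ g v) _ _)⟩)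
    (fun x y => ⟨fun _ _ => by simp, fun _ _ => by simp⟩)
    (fun x y => ⟨fun _ _ => by simp, fun _ _ => by simp⟩) fun u x y => ?_
  have h1 := fun x y => fderiv_bilin_apply hd (differentiableAt_const x) (differentiableAt_const y) u
  simp only [fderiv_fun_const, Pi.zero_apply, zero_apply, map_zero, add_zero] at h1
  rw [← h1, ← h1]
  exact congrArg (fun φ => fderiv ℝ φ v u) (funext fun w => symm _ _ _)

section

variable {m : ℕ}
  {M : Type*} [TopologicalSpace M] [ChartedSpace (EuclideanSpace ℝ (Fin m)) M]
  [IsManifold (𝓡 m) ∞ M]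
  {P : Type*} [TopologicalSpace P] [ChartedSpace (EuclideanSpace ℝ (Fin (m + 1))) P]
  [IsManifold (𝓡 (m + 1)) ∞ P] [MulAction Circle P]
  {W : Type*} [TopologicalSpace W] [ChartedSpace (EuclideanSpace ℝ (Fin m)) W]
  [IsManifold (𝓡 m) ∞ W]
  {X : VectorField m M} {F : BilinField m M} {a : M → ℝ} {πM : P → M} {πW : P → W}
  {θ : CovectorField (m + 1) P} {g : BilinField m M} {I J K : EndField m M} {f h : M → ℝ}
  {QW : (w : W) → Submodule ℝ (TangentSpace (𝓡 m) w →L[ℝ] TangentSpace (𝓡 m) w)}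
  {gW : BilinField m W}

lemma IsParam.exists_christoffel {N : Type*} [TopologicalSpace N]
    [ChartedSpace (EuclideanSpace ℝ (Fin m)) N] {g : BilinField m N}
    {κ : EuclideanSpace ℝ (Fin m) → N} {U : Set (EuclideanSpace ℝ (Fin m))} (c : IsParam κ U)
    {v : EuclideanSpace ℝ (Fin m)} (hv : v ∈ U) [IsManifold (𝓡 m) ∞ N] (hg : IsPseudoMetric g) :
    ∃ Γ : EuclideanSpace ℝ (Fin m) →L[ℝ] EuclideanSpace ℝ (Fin m) →L[ℝ] EuclideanSpace ℝ (Fin m),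
      (∀ u w, Γ u w = Γ w u) ∧ ∀ u x y, fderiv ℝ (pullBilin κ g) v u x y =
        pullBilin κ g v (Γ u x) y + pullBilin κ g v x (Γ u y) :=
  exists_christoffel_fderiv (c.differentiableAt_pullBilin hv hg.smooth)
    (fun _ _ _ => hg.symm _ _ _) (c.nondeg_pullBilin hv hg.nondegenerate)

/-- A twist is quaternionic Kähler if at each point the difference of the Levi-Civita connections
normalizes the quaternionic bundle. -/
theorem isQuaternionicKahler_of_normalizes [Nontrivial (EuclideanSpace ℝ (Fin m))]
    (hT : IsTwist X F a πM πW θ) (hHK : IsHyperKahler g I J K) (hX : IsRotating g I J K X)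
    (hf : ContMDiff (𝓡 m) 𝓘(ℝ, ℝ) ∞ f) (hh : ContMDiff (𝓡 m) 𝓘(ℝ, ℝ) ∞ h)
    (hgW : IsPseudoMetric gW) (hrel : HRelatedBilin πM πW θ (elemDeform g I J K X f h) gW)
    (hQ : HRelatedBundle πM πW θ (quatSpan I J K) QW)
    (hN : ∀ ρ κ ψ U Ω η v₀, TwistChart X F a πM πW θ ρ κ ψ U Ω η v₀ → ∀ Γ L S,
      RotJet (pullBilin ρ g) (pullEnd ρ I) (pullEnd ρ J) (pullEnd ρ K) (pullVec ρ X) v₀ Γ L →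
      TwistJet (pullBilin ρ g v₀) (pullEnd ρ I v₀) (pullEnd ρ J v₀) (pullEnd ρ K v₀)
        (pullVec ρ X v₀) L (f (ρ v₀)) (h (ρ v₀)) (a (ρ v₀)) (fderiv ℝ (fun v => f (ρ v)) v₀)
        (fderiv ℝ (fun v => h (ρ v)) v₀) (pullBilin ρ F v₀) S →
      ∀ u, ∀ T ∈ Submodule.span ℝ {pullEnd ρ I v₀, pullEnd ρ J v₀, pullEnd ρ K v₀},
        (S u).comp T - T.comp (S u) ∈
          Submodule.span ℝ {pullEnd ρ I v₀, pullEnd ρ J v₀, pullEnd ρ K v₀}) :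
    IsQuaternionicKahler gW QW := by
  have hF := hT.data
  have hcharts : ∀ w : W, ∃ ρ κ ψ U Ω η v₀, TwistChart X F a πM πW θ ρ κ ψ U Ω η v₀ ∧ κ v₀ = w := by
    intro w
    obtain ⟨Y, X', -, -, -, hq⟩ := hT.exists_lift
    obtain ⟨p, rfl⟩ := hq.surjective w
    obtain ⟨ρ, κ, ψ, U, Ω, η, v₀, t, -, ht⟩ := exists_twistChart hT hHK.metric p
    exact ⟨ρ, κ, ψ, U, Ω, η, v₀, t, ht⟩
  -- A chart centred at each point of W is chosen, because the comparison of jets holds only where η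
  -- = 0. The connection and its parallelism at w are computed in the chart centred at w, whereas
  -- the frame comes from a single chart around w₀.
  choose ρ κ ψ U Ω η v₀ t hw using hcharts
  choose Γ L r jet using fun w => (t w).exists_jet hHK hX hF hf hh hgW hrel
  choose Γ' symm compat using fun w => (t w).paramW.exists_christoffel (t w).mem hgW
  obtain ⟨nab, hnab⟩ := exists_covariantDerivative (fun w => (t w).paramW) (fun w => (t w).mem) hw Γ'
  refine ⟨hgW, nab, isLeviCivita_of_hasChristoffel hgW.smooth fun w => ⟨κ w, U w, v₀ w, Γ' w,
    (t w).paramW, (t w).mem, hw w, hnab w, symm w, compat w⟩, fun w₀ => ?_⟩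
  obtain ⟨U₁, I', J', K', hU₁, hm, sI, sJ, sK, hfr⟩ := (t w₀).exists_frame hHK hX.smooth hF hrel hQ
  rw [hw] at hm
  refine ⟨U₁, I', J', K', hU₁, hm, sI, sJ, sK, fun w hwU => ⟨(hfr w hwU).1, (hfr w hwU).2,
    fun T hT' z => ?_⟩⟩
  have sT : SmoothEndOn T U₁ := by rcases hT' with rfl | rfl | rfl <;> assumption
  refine (t w).exists_covariant_mem hF hgW hQ (r w) (hN _ _ _ _ _ _ _ (t w) _ _ _ (r w)
    (jet w (Γ' w) (symm w) (compat w))) (hnab w) hU₁ sT (fun w hw => ?_) (hw w) hwU z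
  rw [(hfr w hw).2]
  exact Submodule.subset_span (by rcases hT' with rfl | rfl | rfl <;> simp)

/-- A function with vanishing derivative on a connected manifold is constant. -/
lemma exists_eq_const_of_hasFDerivAt_zero [ConnectedSpace M] {φ : M → ℝ}
    (h : ∀ (ρ : EuclideanSpace ℝ (Fin m) → M) (U : Set (EuclideanSpace ℝ (Fin m))), IsParam ρ U →
      ∀ v ∈ U, HasFDerivAt (fun v => φ (ρ v)) (0 : EuclideanSpace ℝ (Fin m) →L[ℝ] ℝ) v) :
    ∃ b, ∀ x, φ x = b := by
  obtain ⟨x₀⟩ : Nonempty M := inferInstance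
  refine ⟨φ x₀, fun x => ?_⟩
  refine (IsLocallyConstant.iff_eventually_eq φ).mpr (fun y => ?_) |>.apply_eq_of_preconnectedSpace x x₀
  let e := chartAt (EuclideanSpace ℝ (Fin m)) y
  have c : IsParam e.symm e.target := isParam_symm (IsManifold.chart_mem_maximalAtlas y)
  obtain ⟨r, hr, hball⟩ := Metric.isOpen_iff.mp e.open_target (e y)
    (e.map_source (mem_chart_source _ y))
  have hd : ∀ v ∈ Metric.ball (e y) r, HasFDerivAt (fun v => φ (e.symm v)) (0 : _ →L[ℝ] ℝ) v :=
    fun v hv => h _ _ c v (hball hv)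
  have hev : ∀ᶠ z in nhds y, z ∈ e.source ∧ e z ∈ Metric.ball (e y) r :=
    (e.open_source.eventually_mem (mem_chart_source _ y)).and
      ((e.continuousAt (mem_chart_source _ y)).eventually_mem (Metric.ball_mem_nhds _ hr))
  filter_upwards [hev] with z hz
  -- A ball in the chart is convex, which gives local constancy; connectedness does the rest.
  have h3 := (convex_ball (e y) r).is_const_of_fderivWithin_eq_zero (𝕜 := ℝ)
    (f := fun v => φ (e.symm v)) (fun v hv => (hd v hv).differentiableAt.differentiableWithinAt)
    (fun v hv => by
      rw [fderivWithin_of_isOpen Metric.isOpen_ball hv, (hd v hv).fderiv]) hz.2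
      (Metric.mem_ball_self hr)
  simpa only [e.left_inv hz.1, e.left_inv (mem_chart_source _ y)] using h3

lemma exists_isParam (x : M) : ∃ (ρ : EuclideanSpace ℝ (Fin m) → M)
    (U : Set (EuclideanSpace ℝ (Fin m))), ∃ v ∈ U, IsParam ρ U ∧ ρ v = x :=
  ⟨_, _, _, (chartAt _ x).map_source (mem_chart_source _ x),
    isParam_symm (IsManifold.chart_mem_maximalAtlas x), (chartAt _ x).left_inv (mem_chart_source _ x)⟩

end

/-! ### Consequences of second derivatives: the relation between dh and dμ, and closedness of F -/

section Flat

variable {V : Type*} [NormedAddCommGroup V] [NormedSpace ℝ V]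

/-- If `df = h dμ`, then `dh` is a multiple of `dμ`. -/
lemma fderiv_eq_smul_of_fderiv_eq_smul {f h μ : V → ℝ} {v : V} (hf : ContDiffAt ℝ 2 f v)
    (hμ : ContDiffAt ℝ 2 μ v) (hh : DifferentiableAt ℝ h v)
    (eq : ∀ᶠ w in nhds v, fderiv ℝ f w = h w • fderiv ℝ μ w) (u p : V) :
    fderiv ℝ h v u * fderiv ℝ μ v p = fderiv ℝ h v p * fderiv ℝ μ v u := by
  have s1 := hf.isSymmSndFDerivAt (by simp) u p
  have s2 := hμ.isSymmSndFDerivAt (by simp) u p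
  have hd : DifferentiableAt ℝ (fderiv ℝ μ) v :=
    (hμ.fderiv_right (m := 1) (by norm_num)).differentiableAt (by simp)
  -- Differentiating df = h dμ and using the symmetry of the second derivatives of f and μ leaves dh
  -- ∧ dμ = 0.
  have h1 := Filter.EventuallyEq.fderiv_eq (𝕜 := ℝ) eq
  rw [h1, fderiv_fun_smul hh hd] at s1
  simp only [add_apply, smul_apply, ContinuousLinearMap.smulRight_apply, smul_eq_mul, s2] at s1
  linarith

/-- The differential of the closed form `s (dα₀ + σ) + t (α_J ∧ α_K - α₀ ∧ α_I)`, evaluated on a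
vector `p` in the direction of `α_I` and two vectors `v, w` in the kernel of all four forms. -/
lemma mul_eq_zero_of_closed {α₀ αI αJ αK : V → V →L[ℝ] ℝ} {σ F : V → V →L[ℝ] V →L[ℝ] ℝ} {s t : V → ℝ}
    {x : V} (h₀ : ContDiffAt ℝ 2 α₀ x) (hI : DifferentiableAt ℝ αI x)
    (hJ : DifferentiableAt ℝ αJ x) (hK : DifferentiableAt ℝ αK x) (hσ : DifferentiableAt ℝ σ x)
    (hF : DifferentiableAt ℝ F x) (hs : DifferentiableAt ℝ s x) (ht : DifferentiableAt ℝ t x)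
    (closed_σ : ∀ u v w, fderiv ℝ σ x u v w + fderiv ℝ σ x v w u + fderiv ℝ σ x w u v = 0)
    (closed_F : ∀ u v w, fderiv ℝ F x u v w + fderiv ℝ F x v w u + fderiv ℝ F x w u v = 0)
    (ds : ∀ u, fderiv ℝ s x u = t x * αI x u)
    (eq : ∀ᶠ y in nhds x, ∀ u v, F y u v = s y * (fderiv ℝ α₀ y u v - fderiv ℝ α₀ y v u + σ y u v)
      + t y * (αJ y u * αK y v - αK y u * αJ y v - (α₀ y u * αI y v - αI y u * α₀ y v)))
    {p v w : V} (p₀ : α₀ x p = 0) (pJ : αJ x p = 0) (pK : αK x p = 0)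
    (v₀ : α₀ x v = 0) (vI : αI x v = 0) (vJ : αJ x v = 0) (vK : αK x v = 0)
    (w₀ : α₀ x w = 0) (wI : αI x w = 0) (wJ : αJ x w = 0) (wK : αK x w = 0) :
    t x * αI x p * σ x v w = 0 := by
  have hD : DifferentiableAt ℝ (fderiv ℝ α₀) x :=
    (h₀.fderiv_right (m := 1) (by norm_num)).differentiableAt (by simp)
  have sym : ∀ u v z, fderiv ℝ (fderiv ℝ α₀) x u v z = fderiv ℝ (fderiv ℝ α₀) x v u z := fun u v z =>
    congrArg (fun l : V →L[ℝ] ℝ => l z) (h₀.isSymmSndFDerivAt (by simp) u v)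
  have hα : ∀ {α : V → V →L[ℝ] ℝ}, DifferentiableAt ℝ α x → ∀ u, HasFDerivAt (fun y => α y u)
      ((fderiv ℝ α x).flip u) x := fun hα u => by
    simpa using hα.hasFDerivAt.clm_apply (hasFDerivAt_const u x)
  have hβ : ∀ {b : V → V →L[ℝ] V →L[ℝ] ℝ}, DifferentiableAt ℝ b x → ∀ u v,
      HasFDerivAt (fun y => b y u v) (((fderiv ℝ b x).flip u).flip v) x := fun hb u v => by
    have := (hb.hasFDerivAt.clm_apply (hasFDerivAt_const u x)).clm_apply (hasFDerivAt_const v x)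
    simpa using this
  have key : ∀ z u v, fderiv ℝ F x z u v =
      fderiv ℝ s x z * (fderiv ℝ α₀ x u v - fderiv ℝ α₀ x v u + σ x u v)
      + s x * (fderiv ℝ (fderiv ℝ α₀) x z u v - fderiv ℝ (fderiv ℝ α₀) x z v u + fderiv ℝ σ x z u v)
      + fderiv ℝ t x z * (αJ x u * αK x v - αK x u * αJ x v - (α₀ x u * αI x v - αI x u * α₀ x v))
      + t x * (fderiv ℝ αJ x z u * αK x v + αJ x u * fderiv ℝ αK x z v
        - (fderiv ℝ αK x z u * αJ x v + αK x u * fderiv ℝ αJ x z v)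
        - (fderiv ℝ α₀ x z u * αI x v + α₀ x u * fderiv ℝ αI x z v
        - (fderiv ℝ αI x z u * α₀ x v + αI x u * fderiv ℝ α₀ x z v))) := by
    intro z u v
    have h₀' := h₀.differentiableAt (by simp)
    have h1 := ((hs.hasFDerivAt.mul (((hβ hD u v).sub (hβ hD v u)).add (hβ hσ u v))).add
      (ht.hasFDerivAt.mul ((((hα hJ u).mul (hα hK v)).sub ((hα hK u).mul (hα hJ v))).sub
        (((hα h₀' u).mul (hα hI v)).sub ((hα hI u).mul (hα h₀' v))))))
    have h2 := (hβ hF u v).unique (h1.congr_of_eventuallyEq (eq.mono fun y hy => hy u v))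
    have h3 := congrArg (fun l : V →L[ℝ] ℝ => l z) h2
    simp only [ContinuousLinearMap.flip_apply, add_apply, smul_apply, sub_apply, smul_eq_mul,
      Pi.sub_apply, Pi.add_apply, Pi.mul_apply] at h3
    rw [h3]
    ring
  -- The form α_J ∧ α_K - α₀ ∧ α_I vanishes on every pair from p, v, w, which removes dt. The term
  -- ds ∧ dα₀ = t α_I ∧ dα₀ cancels the contribution of -t d(α₀ ∧ α_I), second derivatives of α₀
  -- cancel by symmetry, and t α_I ∧ σ remains.
  have h1 := closed_F p v w
  have h2 := closed_σ p v w
  simp only [key, p₀, pJ, pK, v₀, vI, vJ, vK, w₀, wI, wJ, wK, ds] at h1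
  rw [sym v p, sym w p, sym w v] at h1
  linear_combination h1 - s x * h2

end Flat

/-! ## The equations of a quaternionic Kähler twist -/

section Param

variable {m : ℕ} {M : Type*} [TopologicalSpace M] [ChartedSpace (EuclideanSpace ℝ (Fin m)) M]
  {g : BilinField m M} {I J K : EndField m M} {X : VectorField m M}

namespace IsParam

variable {ρ : EuclideanSpace ℝ (Fin m) → M} {U : Set (EuclideanSpace ℝ (Fin m))}
  (c : IsParam ρ U) {v : EuclideanSpace ℝ (Fin m)} (hv : v ∈ U)
include c hv

lemma alphaOf_vec {T : EndField m M} (sq : ∀ x (u : TangentSpace (𝓡 m) x), T x (T x u) = -u)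
    (herm : ∀ x (u w : TangentSpace (𝓡 m) x), g x (T x u) (T x w) = g x u w)
    (A : VectorField m M) : alphaOf g X T (ρ v) (A (ρ v)) =
      pullBilin ρ g v (pullEnd ρ T v (pullVec ρ X v)) (pullVec ρ A v) :=
  (congrArg (alphaOf g X T (ρ v)) (c.pder_pullVec hv A)).symm.trans (c.alphaOf_eq hv sq herm _)

lemma alphaZero_vec (A : VectorField m M) : alphaZero g X (ρ v) (A (ρ v)) =
      pullBilin ρ g v (pullVec ρ X v) (pullVec ρ A v) := c.bilin_eq hv g X A

variable [IsManifold (𝓡 m) ∞ M]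

lemma contDiffAt_comp {f : M → ℝ} (hf : ContMDiff (𝓡 m) 𝓘(ℝ, ℝ) ∞ f) :
    ContDiffAt ℝ ∞ (fun v => f (ρ v)) v :=
  (hf.contMDiffAt.comp v (c.contMDiffAt hv)).contDiffAt

lemma differentiableAt_comp {f : M → ℝ} (hf : ContMDiff (𝓡 m) 𝓘(ℝ, ℝ) ∞ f) :
    DifferentiableAt ℝ (fun v => f (ρ v)) v :=
  (c.contDiffAt_comp hv hf).differentiableAt (by simp)

lemma dirDeriv_pder {f : M → ℝ} (hf : ContMDiff (𝓡 m) 𝓘(ℝ, ℝ) ∞ f)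
    (u : EuclideanSpace ℝ (Fin m)) :
    dirDeriv f (ρ v) (pder (m := m) ρ v u) = fderiv ℝ (fun v => f (ρ v)) v u :=
  dirDeriv_comp (c.mdifferentiableAt hv) (hf.mdifferentiable (by simp) _) u

/-- The equation for the curvature in a parametrization. -/
lemma twistForm_iff {F : BilinField m M} (hHK : IsHyperKahler g I J K) (hX : IsRotating g I J K X)
    {Γ L} (r : RotJet (pullBilin ρ g) (pullEnd ρ I) (pullEnd ρ J) (pullEnd ρ K) (pullVec ρ X) v Γ L)
    {A B : VectorField m M} (hA : DiffAt A (ρ v)) (hB : DiffAt B (ρ v)) (s t y : ℝ) :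
    s * (extDerivOne (alphaZero g X) A B (ρ v) + fundForm g I (ρ v) (A (ρ v)) (B (ρ v)))
        - t * F (ρ v) (A (ρ v)) (B (ρ v)) =
      y * (alphaOf g X J (ρ v) (A (ρ v)) * alphaOf g X K (ρ v) (B (ρ v))
        - alphaOf g X K (ρ v) (A (ρ v)) * alphaOf g X J (ρ v) (B (ρ v))
        - (alphaZero g X (ρ v) (A (ρ v)) * alphaOf g X I (ρ v) (B (ρ v))
        - alphaOf g X I (ρ v) (A (ρ v)) * alphaZero g X (ρ v) (B (ρ v)))) ↔
    let G := pullBilin ρ g v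
    let x := pullVec ρ X v
    2 * s * G (L (pullVec ρ A v)) (pullVec ρ B v) - t * pullBilin ρ F v (pullVec ρ A v) (pullVec ρ B v) =
      y * (G (pullEnd ρ J v x) (pullVec ρ A v) * G (pullEnd ρ K v x) (pullVec ρ B v)
        - G (pullEnd ρ K v x) (pullVec ρ A v) * G (pullEnd ρ J v x) (pullVec ρ B v)
        - (G x (pullVec ρ A v) * G (pullEnd ρ I v x) (pullVec ρ B v)
        - G (pullEnd ρ I v x) (pullVec ρ A v) * G x (pullVec ρ B v))) := by
  rw [c.extDerivOne_alphaZero hv hHK hX r hA hB,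
    c.alphaOf_vec hv (fun x => (hHK.hermitian x).sq_J) (fun x => (hHK.hermitian x).herm_J),
    c.alphaOf_vec hv (fun x => (hHK.hermitian x).sq_J) (fun x => (hHK.hermitian x).herm_J),
    c.alphaOf_vec hv (fun x => (hHK.hermitian x).sq_K) (fun x => (hHK.hermitian x).herm_K),
    c.alphaOf_vec hv (fun x => (hHK.hermitian x).sq_K) (fun x => (hHK.hermitian x).herm_K),
    c.alphaOf_vec hv (fun x => (hHK.hermitian x).sq_I) (fun x => (hHK.hermitian x).herm_I),
    c.alphaOf_vec hv (fun x => (hHK.hermitian x).sq_I) (fun x => (hHK.hermitian x).herm_I),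
    c.alphaZero_vec hv, c.alphaZero_vec hv, c.bilin_eq hv F A B,
    show ∀ y : ℝ, s * (2 * y) = 2 * s * y from fun y => by ring]

end IsParam

end Param

section

variable {m : ℕ}
  {M : Type*} [TopologicalSpace M] [ChartedSpace (EuclideanSpace ℝ (Fin m)) M]
  [IsManifold (𝓡 m) ∞ M]
  {P : Type*} [TopologicalSpace P] [ChartedSpace (EuclideanSpace ℝ (Fin (m + 1))) P]
  [IsManifold (𝓡 (m + 1)) ∞ P] [MulAction Circle P]
  {W : Type*} [TopologicalSpace W] [ChartedSpace (EuclideanSpace ℝ (Fin m)) W]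
  [IsManifold (𝓡 m) ∞ W]
  {X : VectorField m M} {F : BilinField m M} {a : M → ℝ} {πM : P → M} {πW : P → W}
  {θ : CovectorField (m + 1) P} {g : BilinField m M} {I J K : EndField m M} {f h μ : M → ℝ}
  {QW : (w : W) → Submodule ℝ (TangentSpace (𝓡 m) w →L[ℝ] TangentSpace (𝓡 m) w)}
  {gW : BilinField m W}

-- At the base point the shear is the identity, so the metric on W is the deformation itself.
omit [IsManifold (𝓡 m) ∞ M] [IsManifold (𝓡 (m + 1)) ∞ P] [MulAction Circle P] in
lemma TwistChart.deform_nondeg {ρ : EuclideanSpace ℝ (Fin m) → M}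
    {κ : EuclideanSpace ℝ (Fin m) → W} {ψ : W → EuclideanSpace ℝ (Fin m)}
    {U : Set (EuclideanSpace ℝ (Fin m))} {Ω : Set W}
    {η : EuclideanSpace ℝ (Fin m) → EuclideanSpace ℝ (Fin m) →L[ℝ] ℝ}
    {v₀ : EuclideanSpace ℝ (Fin m)} (t : TwistChart X F a πM πW θ ρ κ ψ U Ω η v₀)
    (h₁ : ∀ x, IsQuaternionHermitianAt g I J K x) (hgW : IsPseudoMetric gW)
    (hrel : HRelatedBilin πM πW θ (elemDeform g I J K X f h) gW) (u : EuclideanSpace ℝ (Fin m))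
    (hu : ∀ w, deform (pullBilin ρ g v₀) (pullEnd ρ I v₀) (pullEnd ρ J v₀) (pullEnd ρ K v₀)
      (pullVec ρ X v₀) (f (ρ v₀)) (h (ρ v₀)) u w = 0) : u = 0 := by
  refine t.paramW.nondeg_pullBilin t.mem hgW.nondegenerate u fun w => ?_
  rw [t.pullBilin_eq t.mem hrel, t.paramM.elemDeform_eq t.mem h₁, shear_eq_id t.eq_zero]
  exact hu w

/-- The functions of a quaternionic Kähler twist satisfy the equations of the jets in any
parametrization of `M`. -/
theorem twist_equations (hm : 8 ≤ m) (hT : IsTwist X F a πM πW θ) (hHK : IsHyperKahler g I J K)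
    (hX : IsRotating g I J K X) (hnull : ∀ x, g x (X x) (X x) ≠ 0)
    (hμ : IsKahlerMomentMap g I X μ)
    (hf : ContMDiff (𝓡 m) 𝓘(ℝ, ℝ) ∞ f) (hh : ContMDiff (𝓡 m) 𝓘(ℝ, ℝ) ∞ h)
    (hrel : HRelatedBilin πM πW θ (elemDeform g I J K X f h) gW)
    (hQ : HRelatedBundle πM πW θ (quatSpan I J K) QW)
    (hQK : IsQuaternionicKahler gW QW) (x : M) :
    f x ≠ 0 ∧ f x + h x * g x (X x) (X x) ≠ 0 ∧
      (∀ v : TangentSpace (𝓡 m) x, dirDeriv f x v = h x * dirDeriv μ x v) ∧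
      ∀ z : ℝ, (∀ v : TangentSpace (𝓡 m) x, dirDeriv h x v = z * dirDeriv μ x v) → ∀ A B : VectorField m M,
        DiffAt A x → DiffAt B x →
        h x * (extDerivOne (alphaZero g X) A B x + fundForm g I x (A x) (B x))
          - (f x + h x * g x (X x) (X x)) / a x * F x (A x) (B x) =
        (2 * h x ^ 2 / f x - z) * (alphaOf g X J x (A x) * alphaOf g X K x (B x)
          - alphaOf g X K x (A x) * alphaOf g X J x (B x)
          - (alphaZero g X x (A x) * alphaOf g X I x (B x)
          - alphaOf g X I x (A x) * alphaZero g X x (B x))) := by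
  have : Nontrivial (EuclideanSpace ℝ (Fin m)) :=
    Module.nontrivial_of_finrank_pos (R := ℝ) (by rw [finrank_euclideanSpace_fin]; omega)
  obtain ⟨p, rfl⟩ : ∃ p, πM p = x := by
    obtain ⟨Y, X', hY, -⟩ := hT.exists_lift
    exact hY.surjective x
  obtain ⟨ρ, κ, ψ, U, Ω, η, v₀, t, hρ, -⟩ := exists_twistChart hT hHK.metric p
  rw [← hρ]
  have hF := hT.data
  obtain ⟨Γ, L, r, hjet⟩ := t.exists_jet hHK hX hF hf hh hQK.metric hrel
  obtain ⟨Γ', symm, compat, hS⟩ := t.commutator_mem hF hQ r hQK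
  have j := hjet Γ' symm compat
  have c := t.paramM
  have hv := t.mem
  have hn : pullBilin ρ g v₀ (pullVec ρ X v₀) (pullVec ρ X v₀) ≠ 0 := by
    rw [← c.bilin_eq hv]; exact hnull _
  -- The dimension bound enters here: the three-form equations need a non-null vector outside the
  -- quaternionic line of X.
  obtain ⟨e, he, hee⟩ := j.quat.exists_quatPerp_ne_zero hn
    (by rw [finrank_euclideanSpace_fin]; omega)
  obtain ⟨hf₀, hq₀⟩ := j.quat.deform_ne_zero hn he hee (t.deform_nondeg hHK.hermitian hQK.metric hrel)
  have alt : ∀ u w, pullBilin ρ F v₀ u w = -pullBilin ρ F v₀ w u := fun u w => by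
    have h1 : ∀ u, pullBilin ρ F v₀ u u = 0 := fun u => hF.alternating _ _
    have h2 := h1 (u + w)
    simp only [map_add, add_apply, h1] at h2
    linarith
  obtain ⟨s1, s2⟩ := j.solution hS hn he hee hf₀ hq₀ alt
  have surj := (c.invertible v₀ hv).surjective
  refine ⟨hf₀, by rw [c.bilin_eq hv]; exact hq₀, fun z => ?_, fun z hz A B hA hB => ?_⟩
  · obtain ⟨u, rfl⟩ := surj z
    rw [c.dirDeriv_pder hv hf, c.dirDeriv_pder hv hμ.smooth, s1, c.fderiv_momentMap hv hHK hμ]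
  · have h1 := s2 z (fun u => by
      rw [← c.dirDeriv_pder hv hh, ← c.fderiv_momentMap hv hHK hμ, ← c.dirDeriv_pder hv hμ.smooth]
      exact hz _)
      (pullVec ρ A v₀) (pullVec ρ B v₀)
    rw [c.twistForm_iff hv hHK hX r hA hB, c.bilin_eq hv g X X]
    exact h1

end

section Flat

variable {V : Type*} [NormedAddCommGroup V] [NormedSpace ℝ V]

/-- The function `a f² / q` is constant, for `q = f + h g(X, X)`. -/
lemma RotJet.hasFDerivAt_zero {G : V → V →L[ℝ] V →L[ℝ] ℝ} {I J K : V → V →L[ℝ] V} {X : V → V} {v : V}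
    {Γ : V →L[ℝ] V →L[ℝ] V} {L : V →L[ℝ] V} (r : RotJet G I J K X v Γ L) {f h a : V → ℝ} {z : ℝ}
    {F : V →L[ℝ] V →L[ℝ] ℝ} (hf : DifferentiableAt ℝ f v) (hh : DifferentiableAt ℝ h v)
    (ha : DifferentiableAt ℝ a v) (hf₀ : f v ≠ 0) (hq₀ : f v + h v * G v (X v) (X v) ≠ 0)
    (ha₀ : a v ≠ 0) (df : ∀ u, fderiv ℝ f v u = h v * G v (I v (X v)) u)
    (dh : ∀ u, fderiv ℝ h v u = z * G v (I v (X v)) u) (da : ∀ u, fderiv ℝ a v u = -F (X v) u)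
    (hF : ∀ u w, 2 * h v * G v (L u) w - (f v + h v * G v (X v) (X v)) / a v * F u w =
        (2 * h v ^ 2 / f v - z) * (G v (J v (X v)) u * G v (K v (X v)) w
        - G v (K v (X v)) u * G v (J v (X v)) w
        - (G v (X v) u * G v (I v (X v)) w - G v (I v (X v)) u * G v (X v) w))) :
    HasFDerivAt (fun v => a v * f v ^ 2 / (f v + h v * G v (X v) (X v))) (0 : V →L[ℝ] ℝ) v := by
  have q := r.quat.self_of_nhds
  have hn := (r.diff_G.clm_apply r.diff_X).clm_apply r.diff_X
  have dn := fderiv_bilin_apply r.diff_G r.diff_X r.diff_X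
  have h1 := (ha.hasFDerivAt.mul (hf.hasFDerivAt.pow 2)).mul
    ((hasDerivAt_inv hq₀).comp_hasFDerivAt v (hf.hasFDerivAt.add (hh.hasFDerivAt.mul hn.hasFDerivAt)))
  simp only [div_eq_mul_inv]
  refine h1.congr_fderiv ?_
  ext u
  have hFu := hF (X v) u
  rw [q.I_self, q.J_self, q.K_self, r.skew] at hFu
  simp only [add_apply, smul_apply, smul_eq_mul, neg_apply, zero_apply, df, dh, da, dn,
    r.compat, r.deriv_X, map_sub, map_smul, sub_apply, Pi.add_apply, Pi.mul_apply, Function.comp_apply]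
  have e1 : G v (I v u) (X v) = -G v (I v (X v)) u := q.I_skew _ _
  have e2 : G v (X v) (L u) = G v (L u) (X v) := q.symm _ _
  have e3 : G v (X v) (I v u) = -G v (I v (X v)) u := q.gI _ _
  rw [e1, e2, e3]
  -- The equation for F, contracted with X, where α_I, α_J, α_K vanish; it expresses da through α_I
  -- and g(LX, ·), the forms that also occur in dq.
  have hFu' : F (X v) u = a v / (f v + h v * G v (X v) (X v)) * (-(2 * h v * G v (L u) (X v))
    + (2 * h v ^ 2 / f v - z) * (G v (X v) (X v) * G v (I v (X v)) u)) := by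
    field_simp at hFu ⊢
    linear_combination -hFu
  rw [hFu']
  field_simp
  ring

end Flat

/-! ## Solution of the equations -/

section

variable {m : ℕ} {M : Type*} [TopologicalSpace M] [ChartedSpace (EuclideanSpace ℝ (Fin m)) M]
  [IsManifold (𝓡 m) ∞ M] {g : BilinField m M} {I J K : EndField m M} {X : VectorField m M}
  {F : BilinField m M} {a f h μ : M → ℝ}

/-- The equations of a quaternionic Kähler twist, with `dh = z dμ`. -/
structure TwistEquations (g : BilinField m M) (I J K : EndField m M) (X : VectorField m M)
    (F : BilinField m M) (a f h μ z : M → ℝ) : Prop where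
  f_ne_zero : ∀ x, f x ≠ 0
  q_ne_zero : ∀ x, f x + h x * g x (X x) (X x) ≠ 0
  df : ∀ x (v : TangentSpace (𝓡 m) x), dirDeriv f x v = h x * dirDeriv μ x v
  dh : ∀ x (v : TangentSpace (𝓡 m) x), dirDeriv h x v = z x * dirDeriv μ x v
  form : ∀ x (A B : VectorField m M), DiffAt A x → DiffAt B x →
    h x * (extDerivOne (alphaZero g X) A B x + fundForm g I x (A x) (B x))
      - (f x + h x * g x (X x) (X x)) / a x * F x (A x) (B x) =
    (2 * h x ^ 2 / f x - z x) * (alphaOf g X J x (A x) * alphaOf g X K x (B x)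
      - alphaOf g X K x (A x) * alphaOf g X J x (B x)
      - (alphaZero g X x (A x) * alphaOf g X I x (B x)
      - alphaOf g X I x (A x) * alphaZero g X x (B x)))

/-- If `df = h dμ`, then `dh` is a multiple of `dμ`. -/
lemma exists_dirDeriv_eq_smul (hHK : IsHyperKahler g I J K) (hX : IsRotating g I J K X)
    (hnull : ∀ x, g x (X x) (X x) ≠ 0) (hμ : IsKahlerMomentMap g I X μ)
    (hf : ContMDiff (𝓡 m) 𝓘(ℝ, ℝ) ∞ f) (hh : ContMDiff (𝓡 m) 𝓘(ℝ, ℝ) ∞ h)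
    (hdf : ∀ x (v : TangentSpace (𝓡 m) x), dirDeriv f x v = h x * dirDeriv μ x v) :
    ∃ z : M → ℝ, (∀ x (v : TangentSpace (𝓡 m) x), dirDeriv h x v = z x * dirDeriv μ x v) ∧
      ∀ (ρ : EuclideanSpace ℝ (Fin m) → M) (U : Set (EuclideanSpace ℝ (Fin m))), IsParam ρ U →
        ∀ v ∈ U, DifferentiableAt ℝ (fun v => z (ρ v)) v := by
  have key : ∀ (ρ : EuclideanSpace ℝ (Fin m) → M) (U : Set (EuclideanSpace ℝ (Fin m))),
      IsParam ρ U → ∀ v ∈ U, ∀ u, fderiv ℝ (fun v => h (ρ v)) v u *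
        g (ρ v) (X (ρ v)) (X (ρ v)) =
      fderiv ℝ (fun v => h (ρ v)) v (pullEnd ρ I v (pullVec ρ X v))
        * fderiv ℝ (fun v => μ (ρ v)) v u := fun ρ U c v hv u => by
    have q := c.quatHerm hv hHK.metric.symm hHK.metric.nondegenerate (hHK.hermitian (ρ v))
    have h1 := fderiv_eq_smul_of_fderiv_eq_smul ((c.contDiffAt_comp hv hf).of_le two_le_infty)
      ((c.contDiffAt_comp hv hμ.smooth).of_le two_le_infty) (c.differentiableAt_comp hv hh)
      (by
        filter_upwards [c.isOpen.mem_nhds hv] with w hw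
        ext u
        rw [← c.dirDeriv_pder hw hf, smul_apply, ← c.dirDeriv_pder hw hμ.smooth]
        exact hdf _ _) u (pullEnd ρ I v (pullVec ρ X v))
    rw [c.fderiv_momentMap hv hHK hμ (pullEnd ρ I v (pullVec ρ X v)), q.gII, ← c.bilin_eq hv] at h1
    exact h1
  have hz : ∀ (ρ : EuclideanSpace ℝ (Fin m) → M) (U : Set (EuclideanSpace ℝ (Fin m))),
      IsParam ρ U → ∀ v ∈ U, dirDeriv h (ρ v) (I (ρ v) (X (ρ v))) =
        fderiv ℝ (fun v => h (ρ v)) v (pullEnd ρ I v (pullVec ρ X v)) := fun ρ U c v hv => by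
    rw [← c.dirDeriv_pder hv hh, c.pullEnd_pullVec hv]
    exact congrArg (dirDeriv h (ρ v)) (c.pder_pullVec hv (fun y => I y (X y))).symm
  -- The factor is read off in the direction I X, where dμ takes the value g(X, X) ≠ 0.
  refine ⟨fun x => dirDeriv h x (I x (X x)) / g x (X x) (X x), fun x v => ?_, fun ρ U c v hv => ?_⟩
  · obtain ⟨ρ, U, w, hw, c, rfl⟩ := exists_isParam (m := m) x
    obtain ⟨u, rfl⟩ := (c.invertible w hw).surjective v
    have h1 := key ρ U c w hw u
    rw [← hz ρ U c w hw, ← c.dirDeriv_pder hw hh, ← c.dirDeriv_pder hw hμ.smooth] at h1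
    rw [div_mul_eq_mul_div, eq_div_iff (hnull _)]
    exact h1
  · have he : (fun v => dirDeriv h (ρ v) (I (ρ v) (X (ρ v))) / g (ρ v) (X (ρ v)) (X (ρ v))) =ᶠ[nhds v]
        fun v => fderiv ℝ (fun v => h (ρ v)) v (pullEnd ρ I v (pullVec ρ X v)) /
          pullBilin ρ g v (pullVec ρ X v) (pullVec ρ X v) := by
      filter_upwards [c.isOpen.mem_nhds hv] with w hw
      rw [hz ρ U c w hw, c.bilin_eq hw g X X]
    have dX := c.differentiableAt_pullVec hv (hX.smooth.mdifferentiable (by simp) _)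
    have d1 : DifferentiableAt ℝ (fun v => fderiv ℝ (fun v => h (ρ v)) v
        (pullEnd ρ I v (pullVec ρ X v))) v :=
      ((((c.contDiffAt_comp hv hh).of_le two_le_infty).fderiv_right (m := 1) (by norm_num)).differentiableAt
        (by simp)).clm_apply ((c.differentiableAt_pullEnd hv hHK.metric hHK.smooth_I
          (Set.mapsTo_univ _ _)).clm_apply dX)
    have d2 : DifferentiableAt ℝ (fun v => pullBilin ρ g v (pullVec ρ X v) (pullVec ρ X v)) v :=
      ((c.differentiableAt_pullBilin hv hHK.metric.smooth).clm_apply dX).clm_apply dX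
    refine he.differentiableAt_iff.mpr ?_
    simp only [div_eq_mul_inv]
    exact d1.mul (d2.inv (by rw [← c.bilin_eq hv]; exact hnull _))

/-- The equation is solved for F, with a/q replaced by k/f². The coefficients take the form s = k
h/f² and t = -k (2h²/f - z)/f² needed for dF = 0. -/
lemma solve_coeff {a f h q k z A B C : ℝ} (hf : f ≠ 0) (hq : q ≠ 0) (ha : a ≠ 0)
    (hk : a * f ^ 2 / q = k) (eq : h * A - q / a * B = (2 * h ^ 2 / f - z) * C) :
    B = k * (h * (f ^ 2)⁻¹) * A + -(k * (2 * h ^ 2 * f⁻¹ - z) * (f ^ 2)⁻¹) * C := by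
  subst hk
  have h1 : B = a / q * (h * A - (2 * h ^ 2 / f - z) * C) := by
    rw [← eq]; field_simp; ring
  rw [h1]
  field_simp
  ring

namespace TwistEquations

variable {z : M → ℝ} (E : TwistEquations g I J K X F a f h μ z)
include E

/-- The function `a f² / q` is constant. -/
lemma exists_const [ConnectedSpace M] (hHK : IsHyperKahler g I J K) (hX : IsRotating g I J K X)
    (hμ : IsKahlerMomentMap g I X μ) (hF : IsTwistData X F a)
    (hf : ContMDiff (𝓡 m) 𝓘(ℝ, ℝ) ∞ f) (hh : ContMDiff (𝓡 m) 𝓘(ℝ, ℝ) ∞ h) :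
    ∃ k, k ≠ 0 ∧ ∀ x, a x * f x ^ 2 / (f x + h x * g x (X x) (X x)) = k := by
  obtain ⟨k, hk⟩ := exists_eq_const_of_hasFDerivAt_zero
    (φ := fun x => a x * f x ^ 2 / (f x + h x * g x (X x) (X x))) fun ρ U c v hv => by
    obtain ⟨Γ, L, r⟩ := c.exists_rotJet hv hHK hX
    have he : (fun v => a (ρ v) * f (ρ v) ^ 2 / (f (ρ v) + h (ρ v) * g (ρ v) (X (ρ v)) (X (ρ v))))
        =ᶠ[nhds v] fun v => a (ρ v) * f (ρ v) ^ 2 /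
          (f (ρ v) + h (ρ v) * pullBilin ρ g v (pullVec ρ X v) (pullVec ρ X v)) := by
      filter_upwards [c.isOpen.mem_nhds hv] with w hw
      rw [c.bilin_eq hw g X X]
    refine HasFDerivAt.congr_of_eventuallyEq ?_ he
    refine r.hasFDerivAt_zero (f := fun v => f (ρ v)) (h := fun v => h (ρ v))
      (a := fun v => a (ρ v)) (z := z (ρ v)) (F := pullBilin ρ F v) (c.differentiableAt_comp hv hf)
      (c.differentiableAt_comp hv hh) (c.differentiableAt_comp hv hF.smooth_a) (E.f_ne_zero _) ?_
      (hF.ne_zero _) (fun u => ?_) (fun u => ?_) (fun u => ?_) fun u w => ?_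
    · rw [← c.bilin_eq hv]; exact E.q_ne_zero _
    · rw [← c.fderiv_momentMap hv hHK hμ, ← c.dirDeriv_pder hv hf, ← c.dirDeriv_pder hv hμ.smooth]
      exact E.df _ _
    · rw [← c.fderiv_momentMap hv hHK hμ, ← c.dirDeriv_pder hv hh, ← c.dirDeriv_pder hv hμ.smooth]
      exact E.dh _ _
    · rw [← c.dirDeriv_pder hv hF.smooth_a]
      refine (hF.hamiltonian _ _).trans ?_
      exact congrArg (fun y => -F (ρ v) y (pder (m := m) ρ v u)) (c.pder_pullVec hv X).symm
    · obtain ⟨A, hA, rfl⟩ := c.exists_pullVec_eq hv u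
      obtain ⟨B, hB, rfl⟩ := c.exists_pullVec_eq hv w
      have h1 := E.form _ A B hA hB
      rw [c.twistForm_iff hv hHK hX r hA hB, c.bilin_eq hv g X X] at h1
      exact h1
  obtain ⟨x⟩ : Nonempty M := inferInstance
  refine ⟨k, ?_, hk⟩
  rw [← hk x]
  exact div_ne_zero (mul_ne_zero (hF.ne_zero _) (pow_ne_zero _ (E.f_ne_zero _))) (E.q_ne_zero _)

/-- Multiplied by k this is the relation ds = t dμ between the two coefficients of F. -/
lemma hasFDerivAt_div_sq {ρ : EuclideanSpace ℝ (Fin m) → M} {U : Set (EuclideanSpace ℝ (Fin m))}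
    (c : IsParam ρ U) {v : EuclideanSpace ℝ (Fin m)} (hv : v ∈ U) (hμ : IsKahlerMomentMap g I X μ)
    (hf : ContMDiff (𝓡 m) 𝓘(ℝ, ℝ) ∞ f) (hh : ContMDiff (𝓡 m) 𝓘(ℝ, ℝ) ∞ h) :
    HasFDerivAt (fun v => h (ρ v) * (f (ρ v) ^ 2)⁻¹)
      (-((2 * h (ρ v) ^ 2 / f (ρ v) - z (ρ v)) / f (ρ v) ^ 2) • fderiv ℝ (fun v => μ (ρ v)) v) v := by
  have hf₀ := E.f_ne_zero (ρ v)
  have h1 := (c.differentiableAt_comp hv hh).hasFDerivAt.mul ((hasDerivAt_inv (pow_ne_zero 2 hf₀)).comp_hasFDerivAt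
    v ((c.differentiableAt_comp hv hf).hasFDerivAt.pow 2))
  refine h1.congr_fderiv ?_
  ext u
  have e1 : fderiv ℝ (fun v => f (ρ v)) v u = h (ρ v) * fderiv ℝ (fun v => μ (ρ v)) v u := by
    rw [← c.dirDeriv_pder hv hf, ← c.dirDeriv_pder hv hμ.smooth]
    exact E.df _ _
  have e2 : fderiv ℝ (fun v => h (ρ v)) v u = z (ρ v) * fderiv ℝ (fun v => μ (ρ v)) v u := by
    rw [← c.dirDeriv_pder hv hh, ← c.dirDeriv_pder hv hμ.smooth]
    exact E.dh _ _
  simp only [add_apply, smul_apply, smul_eq_mul, neg_apply, e1, e2, Pi.pow_apply, Function.comp_apply]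
  field_simp
  ring

/-- Closedness of `F` makes the coefficient of `α_J ∧ α_K - α₀ ∧ α_I` vanish. -/
lemma coeff_eq_zero (hm : 8 ≤ m) (hHK : IsHyperKahler g I J K) (hX : IsRotating g I J K X)
    (hnull : ∀ x, g x (X x) (X x) ≠ 0)
    (hμ : IsKahlerMomentMap g I X μ) (hF : IsTwistData X F a)
    (hf : ContMDiff (𝓡 m) 𝓘(ℝ, ℝ) ∞ f) (hh : ContMDiff (𝓡 m) 𝓘(ℝ, ℝ) ∞ h)
    (hz : ∀ (ρ : EuclideanSpace ℝ (Fin m) → M) (U : Set (EuclideanSpace ℝ (Fin m))),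
      IsParam ρ U → ∀ v ∈ U, DifferentiableAt ℝ (fun v => z (ρ v)) v) {k : ℝ} (hk₀ : k ≠ 0)
    (hk : ∀ x, a x * f x ^ 2 / (f x + h x * g x (X x) (X x)) = k) (x : M) :
    2 * h x ^ 2 / f x - z x = 0 := by
  obtain ⟨ρ, U, v, hv, c, rfl⟩ := exists_isParam (m := m) x
  have hg := hHK.metric
  have q := c.quatHerm hv hg.symm hg.nondegenerate (hHK.hermitian (ρ v))
  have hn : pullBilin ρ g v (pullVec ρ X v) (pullVec ρ X v) ≠ 0 := by
    rw [← c.bilin_eq hv]; exact hnull _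
  obtain ⟨e, he, hee⟩ := q.exists_quatPerp_ne_zero hn (by rw [finrank_euclideanSpace_fin]; omega)
  have skF : ∀ x (u w : TangentSpace (𝓡 m) x), F x u w = -F x w u := fun x u w => by
    have h2 := hF.alternating x (u + w)
    simp only [map_add, add_apply, hF.alternating] at h2
    linarith
  have dX := c.differentiableAt_pullVec hv (hX.smooth.mdifferentiable (by simp) _)
  have dG := c.differentiableAt_pullBilin hv hg.smooth
  have df := c.differentiableAt_comp hv hf
  have dh := c.differentiableAt_comp hv hh
  have hf₀ := E.f_ne_zero (ρ v)
  have c₀ : ContDiffAt ℝ 2 (pullCov ρ (alphaZero g X)) v := by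
    have : ContDiffAt ℝ ∞ (fun v => pullBilin ρ g v (pullVec ρ X v)) v :=
      (((contDiffOn_pullBilin hg.smooth c.isOpen c.contMDiff).contDiffAt
        (c.isOpen.mem_nhds hv)).clm_apply
        ((c.contDiffOn_pullVec hg hX.smooth).contDiffAt (c.isOpen.mem_nhds hv)))
    refine (this.congr_of_eventuallyEq ?_).of_le two_le_infty
    filter_upwards [c.isOpen.mem_nhds hv] with w hw using c.pullCov_alphaZero hw X
  have hinv : DifferentiableAt ℝ (fun v => (f (ρ v) ^ 2)⁻¹) v := (df.pow 2).inv (pow_ne_zero _ hf₀)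
  have ds := (E.hasFDerivAt_div_sq c hv hμ hf hh).const_mul k
  -- The test vectors are I X, on which only α_I is nonzero, and e, I e in the common kernel of the
  -- four forms. There ω_I(e, I e) = g(e, e) ≠ 0 and α_I(I X) = g(X, X) ≠ 0, so the coefficient t
  -- must vanish.
  have key := mul_eq_zero_of_closed (x := v) (α₀ := pullCov ρ (alphaZero g X))
    (αI := fun v => pullBilin ρ g v (pullEnd ρ I v (pullVec ρ X v)))
    (αJ := fun v => pullBilin ρ g v (pullEnd ρ J v (pullVec ρ X v)))
    (αK := fun v => pullBilin ρ g v (pullEnd ρ K v (pullVec ρ X v)))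
    (σ := pullBilin ρ (fundForm g I)) (F := pullBilin ρ F)
    (s := fun v => k * (h (ρ v) * (f (ρ v) ^ 2)⁻¹))
    (t := fun v => -(k * (2 * h (ρ v) ^ 2 * (f (ρ v))⁻¹ - z (ρ v)) * (f (ρ v) ^ 2)⁻¹)) c₀
    (dG.clm_apply ((c.differentiableAt_pullEnd hv hg hHK.smooth_I (Set.mapsTo_univ _ _)).clm_apply dX))
    (dG.clm_apply ((c.differentiableAt_pullEnd hv hg hHK.smooth_J (Set.mapsTo_univ _ _)).clm_apply dX))
    (dG.clm_apply ((c.differentiableAt_pullEnd hv hg hHK.smooth_K (Set.mapsTo_univ _ _)).clm_apply dX))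
    (c.differentiableAt_pullBilin_fundForm hv hg hHK.smooth_I)
    (c.differentiableAt_pullBilin hv hF.smooth_F) ds.differentiableAt
    ((((((dh.pow 2).const_mul 2).mul (df.inv hf₀)).sub (hz ρ U c v hv)).const_mul k).mul hinv).neg
    (c.closed_fderiv hv (IsParam.bilinDiffAt_fundForm hg hHK.smooth_I _)
      (c.differentiableAt_pullBilin_fundForm hv hg hHK.smooth_I)
      (fundForm_skew hg.symm (fun x => (hHK.hermitian x).sq_I)
      (fun x => (hHK.hermitian x).herm_I)) hHK.closed_I)
    (c.closed_fderiv hv (hF.smooth_F.bilinDiffAt _) (c.differentiableAt_pullBilin hv hF.smooth_F)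
      skF hF.closed) (fun u => ?_) ?_ (p := pullEnd ρ I v (pullVec ρ X v)) (v := e)
    (w := pullEnd ρ I v e) ?_ ?_ ?_ ?_ ?_ ?_ ?_ ?_ ?_ ?_ ?_
  · have hGn : pullBilin ρ g v (pullEnd ρ I v (pullVec ρ X v)) (pullEnd ρ I v (pullVec ρ X v)) ≠ 0 := by
      rw [q.gII]; exact hn
    have hσ : pullBilin ρ (fundForm g I) v e (pullEnd ρ I v e) ≠ 0 := by
      rw [c.pullBilin_fundForm hv]
      exact (q.gII e e).trans_ne hee
    have h1 := (mul_eq_zero.mp ((mul_eq_zero.mp key).resolve_right hσ)).resolve_right hGn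
    rw [neg_eq_zero] at h1
    have h2 := (mul_eq_zero.mp h1).resolve_right (inv_ne_zero (pow_ne_zero 2 hf₀))
    exact (mul_eq_zero.mp h2).resolve_left hk₀
  · rw [ds.fderiv, ← c.fderiv_momentMap hv hHK hμ]
    simp only [smul_apply, smul_eq_mul, div_eq_mul_inv]
    ring
  · filter_upwards [c.isOpen.mem_nhds hv] with w hw A' B'
    obtain ⟨A, hA, rfl⟩ := c.exists_pullVec_eq hw A'
    obtain ⟨B, hB, rfl⟩ := c.exists_pullVec_eq hw B'
    have h1 := E.form _ A B hA hB
    have hX' : DiffAt X (ρ w) := hX.smooth.mdifferentiable (by simp) _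
    have hd : DifferentiableAt ℝ (pullCov ρ (alphaZero g X)) w := by
      have : DifferentiableAt ℝ (fun v => pullBilin ρ g v (pullVec ρ X v)) w :=
        (c.differentiableAt_pullBilin hw hg.smooth).clm_apply (c.differentiableAt_pullVec hw hX')
      refine this.congr_of_eventuallyEq ?_
      filter_upwards [c.isOpen.mem_nhds hw] with w hw using c.pullCov_alphaZero hw X
    rw [c.extDerivOne_eq (α := alphaZero g X) hw (fun A hA => hg.smooth.bilinDiffAt _ X A hX' hA) hd hA hB,
      c.alphaOf_vec hw (fun x => (hHK.hermitian x).sq_J) (fun x => (hHK.hermitian x).herm_J),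
      c.alphaOf_vec hw (fun x => (hHK.hermitian x).sq_J) (fun x => (hHK.hermitian x).herm_J),
      c.alphaOf_vec hw (fun x => (hHK.hermitian x).sq_K) (fun x => (hHK.hermitian x).herm_K),
      c.alphaOf_vec hw (fun x => (hHK.hermitian x).sq_K) (fun x => (hHK.hermitian x).herm_K),
      c.alphaOf_vec hw (fun x => (hHK.hermitian x).sq_I) (fun x => (hHK.hermitian x).herm_I),
      c.alphaOf_vec hw (fun x => (hHK.hermitian x).sq_I) (fun x => (hHK.hermitian x).herm_I),
      c.cov_eq hw, c.cov_eq hw, c.bilin_eq hw F A B, c.bilin_eq hw (fundForm g I) A B] at h1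
    have h2 := hk (ρ w)
    have h3 := E.f_ne_zero (ρ w)
    have h4 := E.q_ne_zero (ρ w)
    have h5 := hF.ne_zero (ρ w)
    exact solve_coeff h3 h4 h5 h2 h1
  · rw [c.pullCov_alphaZero hv, q.gI, q.I_self, neg_zero]
  · rw [q.gI, q.IJ, q.K_self, neg_zero]
  · rw [q.gI, q.IK, map_neg, neg_apply, q.J_self, neg_zero, neg_zero]
  · rw [c.pullCov_alphaZero hv, he.r]
  · exact he.i
  · exact he.j
  · exact he.k
  · rw [c.pullCov_alphaZero hv, (he.mapI q).r]
  · exact (he.mapI q).i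
  · exact (he.mapI q).j
  · exact (he.mapI q).k

end TwistEquations

end

/-! ## Classification of the quaternionic Kähler twists -/

section Flat

variable {V : Type*} [NormedAddCommGroup V] [NormedSpace ℝ V]

lemma hasFDerivAt_neg_div {φ : V → ℝ} {φ' : V →L[ℝ] ℝ} {v : V} {c : ℝ} (l : ℝ)
    (hφ : HasFDerivAt φ φ' v) (hc : φ v - c ≠ 0) :
    HasFDerivAt (fun v => -(l / (φ v - c))) ((l / (φ v - c) ^ 2) • φ') v := by
  have h1 : HasDerivAt (fun s : ℝ => -(l / (s - c))) (l / (φ v - c) ^ 2) (φ v) := by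
    have := (((hasDerivAt_id (φ v)).sub_const c).fun_inv hc).const_mul (-l)
    refine (this.congr_deriv ?_).congr_of_eventuallyEq (.of_forall fun s => ?_)
    · simp only [id]; field_simp
    · simp only [id]; ring
  exact h1.comp_hasFDerivAt v hφ

lemma hasFDerivAt_div_sq {φ : V → ℝ} {φ' : V →L[ℝ] ℝ} {v : V} {c : ℝ} (l : ℝ)
    (hφ : HasFDerivAt φ φ' v) (hc : φ v - c ≠ 0) :
    HasFDerivAt (fun v => l / (φ v - c) ^ 2) ((-(2 * l / (φ v - c) ^ 3)) • φ') v := by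
  have h1 : HasDerivAt (fun s : ℝ => l / (s - c) ^ 2) (-(2 * l / (φ v - c) ^ 3)) (φ v) := by
    have := ((((hasDerivAt_id (φ v)).sub_const c).fun_pow 2).fun_inv (pow_ne_zero 2 hc)).const_mul l
    refine (this.congr_deriv ?_).congr_of_eventuallyEq (.of_forall fun s => ?_)
    · simp only [id]; field_simp; norm_num; ring
    · simp only [id]; ring
  exact h1.comp_hasFDerivAt v hφ

/-- The coefficients of an elementary deformation are determined by the metric. -/
lemma QuatHerm.deform_injective {g : V →L[ℝ] V →L[ℝ] ℝ} {I J K : V →L[ℝ] V} (q : QuatHerm g I J K)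
    {X e : V} (hn : g X X ≠ 0) (he : QuatPerp g I J K X e) (hee : g e e ≠ 0) {f h f' h' : ℝ}
    (eq : ∀ u w, deform g I J K X f h u w = deform g I J K X f' h' u w) : f = f' ∧ h = h' := by
  have h1 := eq e e
  have h2 := eq X X
  simp only [deform, galpha, he.r, he.i, he.j, he.k, mul_zero, add_zero] at h1
  simp only [deform, galpha, q.I_self, q.J_self, q.K_self, mul_zero, add_zero] at h2
  have h3 : f = f' := mul_right_cancel₀ hee h1
  subst h3
  exact ⟨rfl, mul_right_cancel₀ (mul_ne_zero hn hn) (add_left_cancel h2)⟩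

end Flat

section

variable {m : ℕ} {M : Type*} [TopologicalSpace M] [ChartedSpace (EuclideanSpace ℝ (Fin m)) M]
  [IsManifold (𝓡 m) ∞ M] {g : BilinField m M} {I J K : EndField m M} {X : VectorField m M}
  {F : BilinField m M} {a f h μ : M → ℝ}

/-- The coefficients of an elementary deformation are determined by the metric. -/
lemma elemDeform_injective (hm : 8 ≤ m) (hHK : IsHyperKahler g I J K)
    (hnull : ∀ x, g x (X x) (X x) ≠ 0) {f' h' : M → ℝ}
    (eq : ∀ x (u v : TangentSpace (𝓡 m) x),
      elemDeform g I J K X f h x u v = elemDeform g I J K X f' h' x u v) (x : M) :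
    f x = f' x ∧ h x = h' x := by
  obtain ⟨ρ, U, v, hv, c, rfl⟩ := exists_isParam (m := m) x
  have q := c.quatHerm hv hHK.metric.symm hHK.metric.nondegenerate (hHK.hermitian (ρ v))
  have hn : pullBilin ρ g v (pullVec ρ X v) (pullVec ρ X v) ≠ 0 := by
    rw [← c.bilin_eq hv]; exact hnull _
  obtain ⟨e, he, hee⟩ := q.exists_quatPerp_ne_zero hn (by rw [finrank_euclideanSpace_fin]; omega)
  refine q.deform_injective hn he hee fun u w => ?_
  rw [← c.elemDeform_eq hv hHK.hermitian, ← c.elemDeform_eq hv hHK.hermitian]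
  exact eq _ _ _

/-- Differentiable vector fields take all values. -/
lemma exists_diffAt_eq (x : M) (u : TangentSpace (𝓡 m) x) : ∃ A : VectorField m M, DiffAt A x ∧ A x = u := by
  obtain ⟨ρ, U, v, hv, c, rfl⟩ := exists_isParam (m := m) x
  obtain ⟨u', hu'⟩ := (c.invertible v hv).surjective u
  obtain ⟨A, hA, rfl⟩ := c.exists_pullVec_eq hv u'
  exact ⟨A, hA, (c.pder_pullVec hv A).symm.trans hu'⟩

namespace TwistEquations

variable {z : M → ℝ} (E : TwistEquations g I J K X F a f h μ z)
include E

/-- When 2h²/f = z, the function h/f² has zero derivative. -/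
lemma exists_eq_mul_sq [ConnectedSpace M] (hμ : IsKahlerMomentMap g I X μ)
    (hf : ContMDiff (𝓡 m) 𝓘(ℝ, ℝ) ∞ f) (hh : ContMDiff (𝓡 m) 𝓘(ℝ, ℝ) ∞ h)
    (hc : ∀ x, 2 * h x ^ 2 / f x - z x = 0) : ∃ s, ∀ x, h x = s * f x ^ 2 := by
  obtain ⟨s, hs⟩ := exists_eq_const_of_hasFDerivAt_zero (m := m) (φ := fun x => h x * (f x ^ 2)⁻¹)
    fun ρ U c v hv => by
      have h1 := E.hasFDerivAt_div_sq c hv hμ hf hh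
      rwa [hc, zero_div, neg_zero, zero_smul] at h1
  refine ⟨s, fun x => ?_⟩
  have := E.f_ne_zero x
  rw [← hs x]
  field_simp

/-- From df = h dμ and h = s f² follows d(1/f) = -s dμ. -/
lemma exists_inv_eq [ConnectedSpace M] (hμ : IsKahlerMomentMap g I X μ)
    (hf : ContMDiff (𝓡 m) 𝓘(ℝ, ℝ) ∞ f) {s : ℝ} (hs : ∀ x, h x = s * f x ^ 2) :
    ∃ b, ∀ x, (f x)⁻¹ + s * μ x = b := by
  refine exists_eq_const_of_hasFDerivAt_zero (m := m) (φ := fun x => (f x)⁻¹ + s * μ x)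
    fun ρ U c v hv => ?_
  have hf₀ := E.f_ne_zero (ρ v)
  have h1 := ((hasDerivAt_inv hf₀).comp_hasFDerivAt v (c.differentiableAt_comp hv hf).hasFDerivAt).add
    ((c.differentiableAt_comp hv hμ.smooth).hasFDerivAt.const_mul s)
  refine h1.congr_fderiv ?_
  ext u
  have e1 : fderiv ℝ (fun v => f (ρ v)) v u = h (ρ v) * fderiv ℝ (fun v => μ (ρ v)) v u := by
    rw [← c.dirDeriv_pder hv hf, ← c.dirDeriv_pder hv hμ.smooth]
    exact E.df _ _
  simp only [add_apply, smul_apply, smul_eq_mul, e1, hs, zero_apply]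
  field_simp
  ring

/-- The solutions of the equations of a quaternionic Kähler twist. -/
theorem classification [ConnectedSpace M] (hμ : IsKahlerMomentMap g I X μ) (hF : IsTwistData X F a)
    (hf : ContMDiff (𝓡 m) 𝓘(ℝ, ℝ) ∞ f) (hh : ContMDiff (𝓡 m) 𝓘(ℝ, ℝ) ∞ h)
    (hc : ∀ x, 2 * h x ^ 2 / f x - z x = 0) {k : ℝ} (hk₀ : k ≠ 0)
    (hk : ∀ x, a x * f x ^ 2 / (f x + h x * g x (X x) (X x)) = k) :
    (∃ c l k : ℝ, l ≠ 0 ∧ k ≠ 0 ∧ (∀ x, μ x ≠ c) ∧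
        (∀ (x : M) (u v : TangentSpace (𝓡 m) x), elemDeform g I J K X f h x u v =
          l * (1 / (μ x - c) ^ 2 * gAlpha g I J K X x u v - 1 / (μ x - c) * g x u v)) ∧
        (∀ (x : M) (A B : VectorField m M), DiffAt A x → DiffAt B x →
          F x (A x) (B x) = k * (extDerivOne (alphaZero g X) A B x
            + fundForm g I x (A x) (B x))) ∧
        (∀ x, a x = k * (g x (X x) (X x) - μ x + c))) ∨
      (∃ b k : ℝ, b ≠ 0 ∧ k ≠ 0 ∧
        (∀ (x : M) (u v : TangentSpace (𝓡 m) x),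
          elemDeform g I J K X f h x u v = b * g x u v) ∧
        (∀ (x : M) (u v : TangentSpace (𝓡 m) x), F x u v = 0) ∧
        (∀ x, a x = k)) := by
  obtain ⟨s, hs⟩ := E.exists_eq_mul_sq hμ hf hh hc
  obtain ⟨b, hb⟩ := E.exists_inv_eq hμ hf hs
  have hF' : ∀ (x : M) (A B : VectorField m M), DiffAt A x → DiffAt B x →
      F x (A x) (B x) = k * s * (extDerivOne (alphaZero g X) A B x
        + fundForm g I x (A x) (B x)) := fun x A B hA hB => by
    have h1 := solve_coeff (E.f_ne_zero x) (E.q_ne_zero x) (hF.ne_zero x) (hk x) (E.form x A B hA hB)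
    have h2 := hc x
    rw [div_eq_mul_inv] at h2
    have hf₀ := E.f_ne_zero x
    rw [h1, h2, hs]
    field_simp
    ring
  -- The constancy of a f²/q is solved for a, with q = f + s f² g(X, X).
  have ha : ∀ x, a x = k * ((f x)⁻¹ + s * g x (X x) (X x)) := fun x => by
    have h1 := hk x
    have hf₀ := E.f_ne_zero x
    rw [div_eq_iff (E.q_ne_zero x), hs] at h1
    field_simp
    have h2 : f x * (a x * f x) = f x * (k * (1 + s * g x (X x) (X x) * f x)) := by
      linear_combination h1
    linear_combination mul_left_cancel₀ hf₀ h2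
  -- The slope of 1/f as a function of μ separates the two families; for slope zero f is constant
  -- and h, F vanish.
  by_cases hs₀ : s = 0
  · subst hs₀
    simp only [zero_mul, add_zero] at hs hb ha
    have hf' : ∀ x, f x = b⁻¹ := fun x => by rw [← hb x, inv_inv]
    have hb₀ : b ≠ 0 := by
      obtain ⟨x⟩ : Nonempty M := inferInstance
      rw [← hb x]
      exact inv_ne_zero (E.f_ne_zero x)
    refine .inr ⟨b⁻¹, k * b, inv_ne_zero hb₀, mul_ne_zero hk₀ hb₀, fun x u v => ?_, fun x u v => ?_,
      fun x => by rw [ha, hb]⟩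
    · simp [elemDeform, hs, hf']
    · obtain ⟨A, hA, rfl⟩ := exists_diffAt_eq x u
      obtain ⟨B, hB, rfl⟩ := exists_diffAt_eq x v
      rw [hF' x A B hA hB, mul_zero, zero_mul]
  · have hinv : ∀ x, (f x)⁻¹ = -(s * (μ x - b / s)) := fun x => by
      have h1 : s * (b / s) = b := by field_simp
      linear_combination hb x - h1
    have hne : ∀ x, μ x - b / s ≠ 0 := fun x h0 => by
      have h1 := hinv x
      rw [h0, mul_zero, neg_zero] at h1
      exact inv_ne_zero (E.f_ne_zero x) h1
    -- The root of the affine function 1/f = b - s μ is c = b/s, so f = -1/(s (μ - c)) and h = s f²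
    -- = 1/(s (μ - c)²). This gives the scale 1/s and the factor k s of F.
    refine .inl ⟨b / s, s⁻¹, k * s, inv_ne_zero hs₀, mul_ne_zero hk₀ hs₀,
      fun x => sub_ne_zero.mp (hne x), fun x u v => ?_, hF', fun x => ?_⟩
    · have hx := hne x
      have hf' : f x = -(s * (μ x - b / s))⁻¹ := by rw [← inv_inv (f x), hinv, inv_neg]
      rw [elemDeform, hs, hf']
      generalize μ x - b / s = ν at hx
      field_simp
      ring
    · rw [ha, hinv]
      ring

end TwistEquations

end

/-! ### The two implications for twists -/

section

variable {m : ℕ}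
  {M : Type*} [TopologicalSpace M] [ChartedSpace (EuclideanSpace ℝ (Fin m)) M]
  [IsManifold (𝓡 m) ∞ M]
  {P : Type*} [TopologicalSpace P] [ChartedSpace (EuclideanSpace ℝ (Fin (m + 1))) P]
  [IsManifold (𝓡 (m + 1)) ∞ P] [MulAction Circle P]
  {W : Type*} [TopologicalSpace W] [ChartedSpace (EuclideanSpace ℝ (Fin m)) W]
  [IsManifold (𝓡 m) ∞ W]
  {X : VectorField m M} {F : BilinField m M} {a : M → ℝ} {πM : P → M} {πW : P → W}
  {θ : CovectorField (m + 1) P} {g : BilinField m M} {I J K : EndField m M} {f h μ : M → ℝ}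
  {QW : (w : W) → Submodule ℝ (TangentSpace (𝓡 m) w →L[ℝ] TangentSpace (𝓡 m) w)}
  {gW : BilinField m W}

theorem exists_twistEquations (hm : 8 ≤ m) (hT : IsTwist X F a πM πW θ) (hHK : IsHyperKahler g I J K)
    (hX : IsRotating g I J K X) (hnull : ∀ x, g x (X x) (X x) ≠ 0)
    (hμ : IsKahlerMomentMap g I X μ)
    (hf : ContMDiff (𝓡 m) 𝓘(ℝ, ℝ) ∞ f) (hh : ContMDiff (𝓡 m) 𝓘(ℝ, ℝ) ∞ h)
    (hrel : HRelatedBilin πM πW θ (elemDeform g I J K X f h) gW)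
    (hQ : HRelatedBundle πM πW θ (quatSpan I J K) QW)
    (hQK : IsQuaternionicKahler gW QW) :
    ∃ z, TwistEquations g I J K X F a f h μ z ∧
      ∀ (ρ : EuclideanSpace ℝ (Fin m) → M) (U : Set (EuclideanSpace ℝ (Fin m))), IsParam ρ U →
        ∀ v ∈ U, DifferentiableAt ℝ (fun v => z (ρ v)) v := by
  have key := twist_equations hm hT hHK hX hnull hμ hf hh hrel hQ hQK
  obtain ⟨z, hz, dz⟩ := exists_dirDeriv_eq_smul hHK hX hnull hμ hf hh fun x => (key x).2.2.1
  exact ⟨z, ⟨fun x => (key x).1, fun x => (key x).2.1, fun x => (key x).2.2.1, hz,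
    fun x => (key x).2.2.2 _ (hz x)⟩, dz⟩

/-- The twists with the data of the first family are quaternionic Kähler. -/
theorem isQuaternionicKahler_of_momentMap (hm : 8 ≤ m) (hT : IsTwist X F a πM πW θ)
    (hHK : IsHyperKahler g I J K) (hX : IsRotating g I J K X) (hnull : ∀ x, g x (X x) (X x) ≠ 0)
    (hμ : IsKahlerMomentMap g I X μ)
    (hf : ContMDiff (𝓡 m) 𝓘(ℝ, ℝ) ∞ f) (hh : ContMDiff (𝓡 m) 𝓘(ℝ, ℝ) ∞ h)
    (hgW : IsPseudoMetric gW) (hrel : HRelatedBilin πM πW θ (elemDeform g I J K X f h) gW)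
    (hQ : HRelatedBundle πM πW θ (quatSpan I J K) QW) {c l k : ℝ} (hk : k ≠ 0)
    (hc : ∀ x, μ x ≠ c)
    (hN : ∀ (x : M) (u v : TangentSpace (𝓡 m) x), elemDeform g I J K X f h x u v =
      l * (1 / (μ x - c) ^ 2 * gAlpha g I J K X x u v - 1 / (μ x - c) * g x u v))
    (hF : ∀ (x : M) (A B : VectorField m M), DiffAt A x → DiffAt B x →
      F x (A x) (B x) = k * (extDerivOne (alphaZero g X) A B x + fundForm g I x (A x) (B x)))
    (ha : ∀ x, a x = k * (g x (X x) (X x) - μ x + c)) : IsQuaternionicKahler gW QW := by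
  have : Nontrivial (EuclideanSpace ℝ (Fin m)) :=
    Module.nontrivial_of_finrank_pos (R := ℝ) (by rw [finrank_euclideanSpace_fin]; omega)
  -- The hypothesis prescribes the metric only. Its values on X and on a non-null vector orthogonal
  -- to the quaternionic line recover f and h.
  have hfh := elemDeform_injective (f := f) (h := h) (f' := fun x => -(l / (μ x - c)))
    (h' := fun x => l / (μ x - c) ^ 2) hm hHK hnull fun x u v => by
      rw [hN]; simp only [elemDeform]; ring
  obtain rfl : f = fun x => -(l / (μ x - c)) := funext fun x => (hfh x).1
  obtain rfl : h = fun x => l / (μ x - c) ^ 2 := funext fun x => (hfh x).2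
  refine isQuaternionicKahler_of_normalizes hT hHK hX hf hh hgW hrel hQ
    fun ρ κ ψ U Ω η v₀ t Γ L S r jet => ?_
  have d := t.paramM
  have hv := t.mem
  have hν : μ (ρ v₀) - c ≠ 0 := sub_ne_zero.mpr (hc _)
  have hdμ := (d.differentiableAt_comp hv hμ.smooth).hasFDerivAt
  have haν : a (ρ v₀) = k * (pullBilin ρ g v₀ (pullVec ρ X v₀) (pullVec ρ X v₀) - (μ (ρ v₀) - c)) := by
    rw [ha, d.bilin_eq hv g X X]; ring
  refine jet.normalizes (t.deform_nondeg hHK.hermitian hgW hrel) (l := l) hν hk (fun h0 => ?_) rfl rfl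
    (fun u => ?_) (fun u => ?_) (fun u w => ?_) haν
  · rw [h0, mul_zero] at haν
    exact hT.data.ne_zero _ haν
  · rw [(hasFDerivAt_neg_div l hdμ hν).fderiv, ← d.fderiv_momentMap hv hHK hμ]; rfl
  · rw [(hasFDerivAt_div_sq l hdμ hν).fderiv, ← d.fderiv_momentMap hv hHK hμ]; rfl
  · obtain ⟨A, hA, rfl⟩ := d.exists_pullVec_eq hv u
    obtain ⟨B, hB, rfl⟩ := d.exists_pullVec_eq hv w
    rw [← d.bilin_eq hv F A B, hF _ A B hA hB, d.extDerivOne_alphaZero hv hHK hX r hA hB]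
    ring

/-- The trivial twists are quaternionic Kähler. -/
theorem isQuaternionicKahler_of_trivial (hm : 8 ≤ m) (hT : IsTwist X F a πM πW θ)
    (hHK : IsHyperKahler g I J K) (hX : IsRotating g I J K X) (hnull : ∀ x, g x (X x) (X x) ≠ 0)
    (hf : ContMDiff (𝓡 m) 𝓘(ℝ, ℝ) ∞ f) (hh : ContMDiff (𝓡 m) 𝓘(ℝ, ℝ) ∞ h)
    (hgW : IsPseudoMetric gW) (hrel : HRelatedBilin πM πW θ (elemDeform g I J K X f h) gW)
    (hQ : HRelatedBundle πM πW θ (quatSpan I J K) QW) {b : ℝ}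
    (hN : ∀ (x : M) (u v : TangentSpace (𝓡 m) x), elemDeform g I J K X f h x u v = b * g x u v)
    (hF : ∀ (x : M) (u v : TangentSpace (𝓡 m) x), F x u v = 0) : IsQuaternionicKahler gW QW := by
  have : Nontrivial (EuclideanSpace ℝ (Fin m)) :=
    Module.nontrivial_of_finrank_pos (R := ℝ) (by rw [finrank_euclideanSpace_fin]; omega)
  have hfh := elemDeform_injective (f := f) (h := h) (f' := fun _ => b) (h' := fun _ => 0) hm hHK
    hnull fun x u v => by rw [hN]; simp only [elemDeform]; ring
  obtain rfl : f = fun _ => b := funext fun x => (hfh x).1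
  obtain rfl : h = fun _ => 0 := funext fun x => (hfh x).2
  refine isQuaternionicKahler_of_normalizes hT hHK hX hf hh hgW hrel hQ
    fun ρ κ ψ U Ω η v₀ t Γ L S r jet u T _ => ?_
  -- With constant f, h = 0 and F = 0 the zero tensor satisfies the jet equations, and their
  -- solution is unique.
  have hS : S u = 0 := ContinuousLinearMap.ext fun w =>
    jet.eq_zero_of_trivial (t.deform_nondeg hHK.hermitian hgW hrel) rfl (fun u => by simp)
      (fun u => by simp) (fun u w => hF _ _ _) u w
  rw [hS, ContinuousLinearMap.zero_comp, ContinuousLinearMap.comp_zero, sub_zero]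
  exact Submodule.zero_mem _

end

end HKQK

end

theorem mainTheorem1 {m : ℕ} (hm : 8 ≤ m)
    -- the hyperKähler manifold, its rotating symmetry and the moment map
    {M : Type*} [TopologicalSpace M] [ChartedSpace (EuclideanSpace ℝ (Fin m)) M]
    [IsManifold (𝓡 m) ∞ M] [T2Space M] [SecondCountableTopology M] [ConnectedSpace M]
    (g : HKQK.BilinField m M) (I J K : HKQK.EndField m M)
    (hHK : HKQK.IsHyperKahler g I J K)
    (X : HKQK.VectorField m M) (hX : HKQK.IsRotating g I J K X)
    (hnull : ∀ x : M, g x (X x) (X x) ≠ 0)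
    (μ : M → ℝ) (hμ : HKQK.IsKahlerMomentMap g I X μ)
    -- an arbitrary twist of it
    {P : Type*} [TopologicalSpace P] [ChartedSpace (EuclideanSpace ℝ (Fin (m + 1))) P]
    [IsManifold (𝓡 (m + 1)) ∞ P] [T2Space P] [SecondCountableTopology P] [MulAction Circle P]
    {W : Type*} [TopologicalSpace W] [ChartedSpace (EuclideanSpace ℝ (Fin m)) W]
    [IsManifold (𝓡 m) ∞ W] [T2Space W] [SecondCountableTopology W]
    (F : HKQK.BilinField m M) (a : M → ℝ)
    (πM : P → M) (πW : P → W) (θ : HKQK.CovectorField (m + 1) P)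
    (hT : HKQK.IsTwist X F a πM πW θ)
    -- the twist of an arbitrary elementary deformation
    (f h : M → ℝ) (hf : ContMDiff (𝓡 m) 𝓘(ℝ, ℝ) ∞ f) (hh : ContMDiff (𝓡 m) 𝓘(ℝ, ℝ) ∞ h)
    (gW : HKQK.BilinField m W) (hgW : HKQK.IsPseudoMetric gW)
    (hgW_rel : HKQK.HRelatedBilin πM πW θ (HKQK.elemDeform g I J K X f h) gW)
    (QW : (w : W) → Submodule ℝ (TangentSpace (𝓡 m) w →L[ℝ] TangentSpace (𝓡 m) w))
    (hQW_rel : HKQK.HRelatedBundle πM πW θ (HKQK.quatSpan I J K) QW) :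
    HKQK.IsQuaternionicKahler gW QW ↔
      (∃ c l k : ℝ, l ≠ 0 ∧ k ≠ 0 ∧ (∀ x, μ x ≠ c) ∧
        (∀ (x : M) (u v : TangentSpace (𝓡 m) x), HKQK.elemDeform g I J K X f h x u v =
          l * (1 / (μ x - c) ^ 2 * HKQK.gAlpha g I J K X x u v - 1 / (μ x - c) * g x u v)) ∧
        (∀ (x : M) (A B : HKQK.VectorField m M), HKQK.DiffAt A x → HKQK.DiffAt B x →
          F x (A x) (B x) = k * (HKQK.extDerivOne (HKQK.alphaZero g X) A B x
            + HKQK.fundForm g I x (A x) (B x))) ∧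
        (∀ x, a x = k * (g x (X x) (X x) - μ x + c))) ∨
      (∃ b k : ℝ, b ≠ 0 ∧ k ≠ 0 ∧
        (∀ (x : M) (u v : TangentSpace (𝓡 m) x),
          HKQK.elemDeform g I J K X f h x u v = b * g x u v) ∧
        (∀ (x : M) (u v : TangentSpace (𝓡 m) x), F x u v = 0) ∧
        (∀ x, a x = k)) := by
  refine ⟨fun hQK => ?_, ?_⟩
  -- The constant k must be found first: closedness of F becomes usable only after a/q has been
  -- replaced by k/f².
  · obtain ⟨z, E, hz⟩ := HKQK.exists_twistEquations hm hT hHK hX hnull hμ hf hh hgW_rel hQW_rel hQK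
    obtain ⟨k, hk₀, hk⟩ := E.exists_const hHK hX hμ hT.data hf hh
    exact E.classification hμ hT.data hf hh
      (E.coeff_eq_zero hm hHK hX hnull hμ hT.data hf hh hz hk₀ hk) hk₀ hk
  · rintro (⟨c, l, k, -, hk, hc, hN, hF, ha⟩ | ⟨b, k, -, -, hN, hF, -⟩)
    · exact HKQK.isQuaternionicKahler_of_momentMap hm hT hHK hX hnull hμ hf hh hgW hgW_rel hQW_rel hk
        hc hN hF ha
    · exact HKQK.isQuaternionicKahler_of_trivial hm hT hHK hX hnull hf hh hgW hgW_rel hQW_rel hN hF
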